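/- **Setting.** Let $r$ be a positive integer and let $0\le a_1,a_2,a_3,a_4,e<r$ be integers such that * $\gcd(a_i,r)\mid\gcd(e,r)$ for $1\le i\le 4$; * $\gcd(a_i,a_j,r)=1$ for $1\le i<j\le 4$; * $a_1+a_2+a_3+a_4-e\equiv 1 \pmod r$. Let $\xi\in\mathbb C$ be a primitive $r$-th root of unity, let $\mathfrak m$ be the maximal ideal of the ring $\mathbb C\{x_1,x_2,x_3,x_4\}$ of convergent power series, and let $f\in\mathbb C\{x_1,x_2,x_3,x_4\}$ satisfy $f(\xi^{a_1}x_1,\dots,\xi^{a_4}x_4)=\xi^{e}f(x_1,\dots,x_4)$ and be of one of the following types: * (cA type) $f=x_1x_2+g(x_3,x_4)$ with $g\in\mathfrak m^2$; * (odd type) $f=x_1^2+x_2^2+g(x_3,x_4)$ with $g\in\mathfrak m^3$, and $a_1\not\equiv a_2\pmod r$; * (cD-E type) $f=x_1^2+g(x_2,x_3,x_4)$ with $g\in\mathfrak m^3$. If $f$ is of cA type, assume moreover that for no integer $b$ with $\gcd(b,r)=1$ is $(a_1,a_2,a_3,a_4,e)$ congruent modulo $r$ to $(b,-b,1,0,0)$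 or to $(b,-b,0,1,0)$. Let $L=\mathbb Z^4+\mathbb Z\cdot\frac1r(a_1,a_2,a_3,a_4)\subset\mathbb Q^4$, let $\mathbf e_1,\dots,\mathbf e_4$ be the standard basis of $\mathbb Q^4$, and put $$N=\bigl(L\cap\mathbb Q^4_{\ge 0}\bigr)\setminus\{\mathbf 0,\mathbf e_1,\mathbf e_2,\mathbf e_3,\mathbf e_4\}.$$ For $\alpha\in N$ let $\alpha(x_1^{n_1}x_2^{n_2}x_3^{n_3}x_4^{n_4})=\sum_i n_i\alpha_i$, and let $\alpha(f)$ be the minimum of $\alpha(\mathbf x)$ over the monomials $\mathbf x$ that occur in $f$ with non-zero coefficient. Let $k$ be a positive integer and $\beta\in\mathbb Q^4$ such that one of the following holds: * (a) $k=1$, $\beta=\mathbf 0$, and $\alpha(x_1x_2x_3x_4)-\alpha(f)>1$ for all $\alpha\in N$; * (b) $k\ge 2$; $\beta\in N$ is primitive in $L$ (that is, $\beta\neq t w$ for all $w\in L$ and all integers $t\ge 2$); either $\frac1k<\beta(x_1x_2x_3x_4)-\beta(f)\le\min\{\frac{12}{13},\frac1{k-1}\}$, or $k=2$ and $\beta(x_1x_2x_3x_4)-\beta(f)=1$;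 and $\alpha(x_1x_2x_3x_4)-\alpha(f)>1$ for all $\alpha\in N\setminus\{\beta,2\beta,\dots,(k-1)\beta\}$. **Theorem.** For every positive integer $k$ there are finite sets $\Gamma_k\subset\mathbb N$ and $\Gamma_k'\subset\mathbb Q^4$, depending only on $k$, such that for all data $r,a_1,\dots,a_4,e,\xi,f,\beta$ as in the Setting with this $k$, either $r\in\Gamma_k$, or $\beta\ne\mathbf 0$ and $\beta\in\Gamma_k'$. -/

import Mathlib

namespace EncCDV

/-- A formal power series in `x₁, …, x₄` (indexed by `Fin 4`) is convergent if it converges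
absolutely on some polydisc of positive radius around the origin. -/
def IsConvergent (f : MvPowerSeries (Fin 4) ℂ) : Prop :=
  ∃ R : ℝ, 0 < R ∧ Summable fun n : Fin 4 →₀ ℕ => ‖MvPowerSeries.coeff n f‖ * R ^ n.degree

lemma summable_of_le {f : MvPowerSeries (Fin 4) ℂ} {R S : ℝ} (hS : 0 < S) (hSR : S ≤ R)
    (h : Summable fun n : Fin 4 →₀ ℕ => ‖MvPowerSeries.coeff n f‖ * R ^ n.degree) :
    Summable fun n : Fin 4 →₀ ℕ => ‖MvPowerSeries.coeff n f‖ * S ^ n.degree :=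
  Summable.of_nonneg_of_le (fun n => by positivity) (fun n => by gcongr) h

lemma IsConvergent.of_finite_support {f : MvPowerSeries (Fin 4) ℂ} {s : Finset (Fin 4 →₀ ℕ)}
    (h : ∀ n ∉ s, MvPowerSeries.coeff n f = 0) : IsConvergent f :=
  ⟨1, one_pos, summable_of_ne_finset_zero (s := s) fun n hn => by simp [h n hn]⟩

lemma IsConvergent.add {f g : MvPowerSeries (Fin 4) ℂ} (hf : IsConvergent f)
    (hg : IsConvergent g) : IsConvergent (f + g) := by
  obtain ⟨R, hR, hf⟩ := hf
  obtain ⟨S, hS, hg⟩ := hg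
  have hm : 0 < min R S := lt_min hR hS
  refine ⟨min R S, hm, Summable.of_nonneg_of_le (fun n => by positivity) (fun n => ?_)
    ((summable_of_le hm (min_le_left R S) hf).add (summable_of_le hm (min_le_right R S) hg))⟩
  rw [← add_mul, map_add]
  gcongr
  exact norm_add_le _ _

lemma IsConvergent.neg {f : MvPowerSeries (Fin 4) ℂ} (hf : IsConvergent f) :
    IsConvergent (-f) := by
  obtain ⟨R, hR, hf⟩ := hf
  exact ⟨R, hR, by simpa using hf⟩

lemma IsConvergent.mul {f g : MvPowerSeries (Fin 4) ℂ} (hf : IsConvergent f)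
    (hg : IsConvergent g) : IsConvergent (f * g) := by
  obtain ⟨R, hR, hf⟩ := hf
  obtain ⟨S, hS, hg⟩ := hg
  obtain ⟨T, hT, hTR, hTS⟩ : ∃ T : ℝ, 0 < T ∧ T ≤ R ∧ T ≤ S :=
    ⟨min R S, lt_min hR hS, min_le_left R S, min_le_right R S⟩
  have hf' := summable_of_le hT hTR hf
  have hg' := summable_of_le hT hTS hg
  have hfg := hf'.mul_of_nonneg hg' (fun n => by positivity) (fun n => by positivity)
  have hsum := summable_sum_mul_antidiagonal_of_summable_mul
    (f := fun n : Fin 4 →₀ ℕ => ‖MvPowerSeries.coeff n f‖ * T ^ n.degree)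
    (g := fun n : Fin 4 →₀ ℕ => ‖MvPowerSeries.coeff n g‖ * T ^ n.degree) hfg
  refine ⟨T, hT, Summable.of_nonneg_of_le (fun n => by positivity) (fun n => ?_) hsum⟩
  have hle : ‖MvPowerSeries.coeff n (f * g)‖ ≤ ∑ p ∈ Finset.HasAntidiagonal.antidiagonal n,
      ‖MvPowerSeries.coeff p.1 f * MvPowerSeries.coeff p.2 g‖ := by
    rw [MvPowerSeries.coeff_mul]
    exact norm_sum_le _ _
  refine (mul_le_mul_of_nonneg_right hle (pow_nonneg hT.le _)).trans ?_
  rw [Finset.sum_mul]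
  refine Finset.sum_le_sum fun p hp => le_of_eq ?_
  have hd : n.degree = p.1.degree + p.2.degree := by
    rw [← Finset.HasAntidiagonal.mem_antidiagonal.1 hp, map_add]
  rw [norm_mul, hd, pow_add]
  ring

/-- The ring `ℂ{x₁, x₂, x₃, x₄}` of convergent power series. -/
def ConvergentSeries : Subring (MvPowerSeries (Fin 4) ℂ) where
  carrier := {f | IsConvergent f}
  mul_mem' := IsConvergent.mul
  add_mem' := IsConvergent.add
  neg_mem' := IsConvergent.neg
  zero_mem' := IsConvergent.of_finite_support (s := ∅) fun n _ => by simp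
  one_mem' := IsConvergent.of_finite_support (s := {0}) fun n hn => by
    classical
    rw [MvPowerSeries.coeff_one, if_neg (by simpa using hn)]

/-- The maximal ideal `𝔪` of `ℂ{x₁, x₂, x₃, x₄}`: the series without constant term. -/
noncomputable def maxIdeal : Ideal ConvergentSeries :=
  RingHom.ker ((MvPowerSeries.constantCoeff (σ := Fin 4) (R := ℂ)).comp ConvergentSeries.subtype)

/-- The series `g` involves only the variables with index in `s`. -/
def InvolvesOnly (s : Set (Fin 4)) (g : ConvergentSeries) : Prop :=
  ∀ n : Fin 4 →₀ ℕ, MvPowerSeries.coeff n (g : MvPowerSeries (Fin 4) ℂ) ≠ 0 → ∀ i ∉ s, n i = 0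

open MvPowerSeries in
/-- cA type: `f = x₁x₂ + g(x₃, x₄)` with `g ∈ 𝔪²`. -/
def IsCAType (f : ConvergentSeries) : Prop :=
  ∃ g ∈ maxIdeal ^ 2, InvolvesOnly {2, 3} g ∧
    (f : MvPowerSeries (Fin 4) ℂ) = X 0 * X 1 + (g : MvPowerSeries (Fin 4) ℂ)

open MvPowerSeries in
/-- Odd type: `f = x₁² + x₂² + g(x₃, x₄)` with `g ∈ 𝔪³` and `a₁ ≢ a₂ mod r`. -/
def IsOddType (r : ℕ) (a : Fin 4 → ℕ) (f : ConvergentSeries) : Prop :=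
  (∃ g ∈ maxIdeal ^ 3, InvolvesOnly {2, 3} g ∧
    (f : MvPowerSeries (Fin 4) ℂ) = X 0 ^ 2 + X 1 ^ 2 + (g : MvPowerSeries (Fin 4) ℂ)) ∧
  ¬ a 0 ≡ a 1 [MOD r]

open MvPowerSeries in
/-- cD-E type: `f = x₁² + g(x₂, x₃, x₄)` with `g ∈ 𝔪³`. -/
def IsCDEType (f : ConvergentSeries) : Prop :=
  ∃ g ∈ maxIdeal ^ 3, InvolvesOnly {1, 2, 3} g ∧
    (f : MvPowerSeries (Fin 4) ℂ) = X 0 ^ 2 + (g : MvPowerSeries (Fin 4) ℂ)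

/-- `f(ξ^{a₁}x₁, …, ξ^{a₄}x₄) = ξ^e f(x₁, …, x₄)`. -/
def IsSemiInvariant (ξ : ℂ) (a : Fin 4 → ℕ) (e : ℕ) (f : ConvergentSeries) : Prop :=
  MvPowerSeries.rescale (fun i => ξ ^ a i) (f : MvPowerSeries (Fin 4) ℂ)
    = ξ ^ e • (f : MvPowerSeries (Fin 4) ℂ)

/-- `α(f)`, the least `α`-weight `∑ nᵢ αᵢ` of a monomial `xⁿ` that occurs in `f` with non-zero
coefficient. It is only used for `α ≥ 0` rational and `f ≠ 0`, where the infimum is a minimum. -/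
noncomputable def weight (α : Fin 4 → ℚ) (f : ConvergentSeries) : ℝ :=
  sInf ((fun n : Fin 4 →₀ ℕ => ((∑ i, (n i : ℚ) * α i : ℚ) : ℝ)) ''
    {n | MvPowerSeries.coeff n (f : MvPowerSeries (Fin 4) ℂ) ≠ 0})

/-- `α(x₁x₂x₃x₄) - α(f)`. -/
noncomputable def gap (α : Fin 4 → ℚ) (f : ConvergentSeries) : ℝ :=
  ((∑ i, α i : ℚ) : ℝ) - weight α f

/-- The lattice `ℤ⁴ + ℤ · (1/r)(a₁, a₂, a₃, a₄)` in `ℚ⁴`. -/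
def lattice (r : ℕ) (a : Fin 4 → ℕ) : Set (Fin 4 → ℚ) :=
  {w | ∃ j : ℤ, ∀ i, ∃ m : ℤ, w i = (j * a i : ℚ) / r + m}

/-- The set `N` of weights: the non-zero vectors of the lattice with non-negative coordinates,
apart from the four standard basis vectors `e₁, …, e₄`. (The weight `eᵢ` is the order of
vanishing along the coordinate hyperplane `xᵢ = 0`, and
`eᵢ(x₁x₂x₃x₄) - eᵢ(f) ≤ 1` whatever `f` is.) -/
def weights (r : ℕ) (a : Fin 4 → ℕ) : Set (Fin 4 → ℚ) :=
  {w | w ∈ lattice r a ∧ (∀ i, 0 ≤ w i) ∧ w ≠ 0 ∧ ∀ i, w ≠ Pi.single i 1}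

/-- `β` is a primitive vector of the lattice: it is not a proper integral multiple of a lattice
vector. -/
def IsPrimitive (r : ℕ) (a : Fin 4 → ℕ) (β : Fin 4 → ℚ) : Prop :=
  ∀ w ∈ lattice r a, ∀ t : ℕ, 2 ≤ t → β ≠ t • w

/-- The weight inequalities: either they hold for all weights, and `k = 1`, `β = 0`; or `k ≥ 2`
and they hold away from `β, 2β, …, (k - 1)β`, where `β` is a primitive weight with
`1/k < β(x₁x₂x₃x₄) - β(f) ≤ min {12/13, 1/(k-1)}`, or `k = 2` and
`β(x₁x₂x₃x₄) - β(f) = 1`. -/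
def EncInequalities (r : ℕ) (a : Fin 4 → ℕ) (f : ConvergentSeries) (k : ℕ)
    (β : Fin 4 → ℚ) : Prop :=
  (k = 1 ∧ β = 0 ∧ ∀ α ∈ weights r a, 1 < gap α f) ∨
  (2 ≤ k ∧ β ∈ weights r a ∧ IsPrimitive r a β ∧
    ((1 / (k : ℝ) < gap β f ∧ gap β f ≤ min (12 / 13) (1 / ((k : ℝ) - 1))) ∨
      (gap β f = 1 ∧ k = 2)) ∧
    ∀ α ∈ weights r a, (∀ t : ℕ, 1 ≤ t → t ≤ k - 1 → α ≠ t • β) → 1 < gap α f)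

/-- The numerical and analytic data under consideration. -/
structure EncSetting (k r : ℕ) (a : Fin 4 → ℕ) (e : ℕ) (ξ : ℂ) (f : ConvergentSeries)
    (β : Fin 4 → ℚ) : Prop where
  r_pos : 0 < r
  a_lt : ∀ i, a i < r
  e_lt : e < r
  gcd_dvd : ∀ i, Nat.gcd (a i) r ∣ Nat.gcd e r
  gcd_pair : ∀ i j, i < j → Nat.gcd (Nat.gcd (a i) (a j)) r = 1
  sum_sub : (∑ i, (a i : ℤ)) - e ≡ 1 [ZMOD r]
  primitiveRoot : IsPrimitiveRoot ξ r
  semiInvariant : IsSemiInvariant ξ a e f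
  type : IsCAType f ∨ IsOddType r a f ∨ IsCDEType f
  inequalities : EncInequalities r a f k β
  /-- In the cA case, up to interchanging `x₃` and `x₄`,
  `(a₁, a₂, a₃, a₄, e)` is not congruent to `(b, -b, 1, 0, 0)` modulo `r` with `b` prime to `r`. -/
  exclude : IsCAType f → ∀ b : ℤ, Int.gcd b r = 1 →
    ¬ ((a 0 : ℤ) ≡ b [ZMOD r] ∧ (a 1 : ℤ) ≡ -b [ZMOD r] ∧ (e : ℤ) ≡ 0 [ZMOD r] ∧
      (((a 2 : ℤ) ≡ 1 [ZMOD r] ∧ (a 3 : ℤ) ≡ 0 [ZMOD r]) ∨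
        ((a 2 : ℤ) ≡ 0 [ZMOD r] ∧ (a 3 : ℤ) ≡ 1 [ZMOD r])))

end EncCDV

/-! The index `r` alone turns out to be bounded in terms of `k`, so the finite set of weights `β`
can be taken empty.

Apply the weight inequality to the translates of `({j a₁/r}, …, {j a₄/r})`, `0 < j < r`, by natural
vectors `b`; at most `k` values of `j` are lost for each `b`. Since `a₁ + a₂ + a₃ + a₄ - e ≡ 1`, the
difference between the weight of `x₁x₂x₃x₄` and that of an occurring monomial is congruent to `j/r`
modulo `1`, so "greater than `1`" sharpens to "at least `1 + j/r`". `Admissible` records this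
together with the divisibility conditions.

If `r` were unbounded, take a sequence of data with `r → ∞` and an ultrafilter on it. The integral
characters that eventually kill `a/r` form a group Λ. Choose an integral vector `c` orthogonal to Λ,
with no accidental orthogonality to the finitely many forms of interest (`exists_generic_line`). A
quantitative Kronecker theorem (`eventually_card_near`) approximates each point `s c` of the line by
so many multiples of `a/r` that the exceptional `j` can be avoided. For irrational `s` the
fractional parts of the non-zero coordinates are continuous there, so the inequality passes to the
limit with a fixed monomial (`exists_limit_exponent`). In terms of floors (`floor_le_of_fract_le`)
it is a statement about `⌊s cᵢ⌋`, `⌊s e⌋` and `⌊s t⌋`, where `e` is now the weight of the equation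
on the line and `t = c₁ + c₂ + c₃ + c₄ - e`.

Comparing `s` with `-s` forces equality in a weakened form of this inequality. The sum of the floors
of `s` times `c₁, …, c₄, -e, -t` is then constant, and its jumps at `s = 1/d` show that each of
these six integers has its negative among them (`floor_eq_and_exists_neg`). Together with the
monomials available for small `s`, this leaves a few one-parameter families, each refuted by an
explicit range of `s` (`not_CALine`, `not_OddLine`, `not_CDELine`). Vanishing coordinates of `c`
need separate care: they are excluded by `le_of_dvd_mul_of_cA` in the cA type and treated by
`not_CDEUnitLine` in the cD-E type. -/

open Filter Topology

namespace EncCDV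

/-! ### Reduction to numerical data. -/

/-- The exponents of the monomials occurring in `f`. -/
def exponents (f : ConvergentSeries) : Set (Fin 4 → ℕ) :=
  {n | MvPowerSeries.coeff (Finsupp.equivFunOnFinite.symm n) (f : MvPowerSeries (Fin 4) ℂ) ≠ 0}

/-- The numerical content of the setting: `ε` is a linear form representing the weight `e` of the
equation, `S` is the set of exponents of the equation, and the weight inequality holds on each
translate of the weights `({j a₁ / r}, …, {j a₄ / r})` up to `k` exceptions. -/
structure Admissible (k r : ℕ) (a ε : Fin 4 → ℤ) (S : Set (Fin 4 → ℕ)) : Prop where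
  r_pos : 0 < r
  semi : ∀ n ∈ S, (r : ℤ) ∣ ∑ i, ((n i : ℤ) - ε i) * a i
  wt : (r : ℤ) ∣ ∑ i, (1 - ε i) * a i - 1
  pair : ∀ i j, i ≠ j → ∀ m : ℤ, (r : ℤ) ∣ m * a i → (r : ℤ) ∣ m * a j → (r : ℤ) ∣ m
  edvd : ∀ i, ∀ m : ℤ, (r : ℤ) ∣ m * a i → (r : ℤ) ∣ m * ∑ i, ε i * a i
  ineq : ∀ b : Fin 4 → ℕ, ∃ J : Finset ℕ, J.card ≤ k ∧ ∀ j : ℕ, 0 < j → j < r → j ∉ J →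
    ∃ n ∈ S, ∑ i, (n i : ℝ) * (Int.fract ((j * a i : ℝ) / r) + b i) + 1 + (j : ℝ) / r
      ≤ ∑ i, (Int.fract ((j * a i : ℝ) / r) + b i)

lemma coeff_eq_zero_of_mem_maxIdeal_pow {d : ℕ} {g : ConvergentSeries} (hg : g ∈ maxIdeal ^ d)
    {n : Fin 4 →₀ ℕ} (hn : n.degree < d) :
    MvPowerSeries.coeff n (g : MvPowerSeries (Fin 4) ℂ) = 0 := by
  have key : (d : ℕ∞) ≤ MvPowerSeries.order (g : MvPowerSeries (Fin 4) ℂ) := by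
    clear hn
    induction hg using Submodule.pow_induction_on_left' with
    | algebraMap r => simp
    | add x y i hx hy h1 h2 =>
      exact (le_min h1 h2).trans (MvPowerSeries.min_order_le_add)
    | mem_mul m hm i x hx h =>
      refine le_trans ?_ (MvPowerSeries.le_order_mul)
      have : (1 : ℕ∞) ≤ MvPowerSeries.order (m : MvPowerSeries (Fin 4) ℂ) := by
        refine MvPowerSeries.le_order fun d hd => ?_
        have hd0 : d = 0 := by
          have : d.degree = 0 := by
            have : ((d.degree : ℕ) : ℕ∞) < (1 : ℕ) := by simpa using hd
            have := Nat.cast_lt.1 this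
            omega
          exact (Finsupp.degree_eq_zero_iff d).1 this
        subst hd0
        simpa [maxIdeal, RingHom.mem_ker] using hm
      have := add_le_add this h
      rw [Nat.cast_succ, add_comm]
      exact this
  exact MvPowerSeries.coeff_of_lt_order (lt_of_lt_of_le (by exact_mod_cast hn) key)

lemma exponents_weight {r : ℕ} {ξ : ℂ} (hξ : IsPrimitiveRoot ξ r) (hr : 0 < r) {a : Fin 4 → ℕ}
    {e : ℕ} {f : ConvergentSeries} (hf : IsSemiInvariant ξ a e f) {n : Fin 4 → ℕ}
    (hn : n ∈ exponents f) : (r : ℤ) ∣ ∑ i, (n i : ℤ) * a i - e := by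
  have h := congrArg (MvPowerSeries.coeff (Finsupp.equivFunOnFinite.symm n)) hf
  rw [MvPowerSeries.coeff_rescale, MvPowerSeries.coeff_smul] at h
  have h2 := mul_right_cancel₀ hn h
  rw [Finsupp.prod_fintype _ _ (by simp)] at h2
  simp only [← pow_mul, Finset.prod_pow_eq_pow_sum] at h2
  have h0 : ξ ≠ 0 := hξ.ne_zero hr.ne'
  have h3 : ξ ^ ((∑ i, (n i : ℤ) * a i) - e) = 1 := by
    rw [zpow_sub₀ h0, div_eq_one_iff_eq (zpow_ne_zero _ h0)]
    have : (∑ i, (n i : ℤ) * a i) = ((∑ i, a i * n i : ℕ) : ℤ) := by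
      push_cast; exact Finset.sum_congr rfl fun i _ => mul_comm _ _
    rw [this, zpow_natCast, zpow_natCast]
    simpa using h2
  exact (hξ.zpow_eq_one_iff_dvd _).1 h3

lemma exists_exponent_of_one_lt_gap {α : Fin 4 → ℚ} {f : ConvergentSeries}
    (hf : (exponents f).Nonempty) (h : 1 < gap α f) :
    ∃ n ∈ exponents f, ∑ i, (n i : ℚ) * α i + 1 < ∑ i, α i := by
  unfold gap weight at h
  obtain ⟨n0, hn0⟩ := hf
  have hlt := exists_lt_of_csInf_lt
    (s := ((fun n : Fin 4 →₀ ℕ => ((∑ i, (n i : ℚ) * α i : ℚ) : ℝ)) ''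
    {n | MvPowerSeries.coeff n (f : MvPowerSeries (Fin 4) ℂ) ≠ 0}))
    (b := ((∑ i, α i : ℚ) : ℝ) - 1) ⟨_, ⟨_, hn0, rfl⟩⟩ (by linarith)
  obtain ⟨_, ⟨n, hn, rfl⟩, hlt⟩ := hlt
  refine ⟨n, ?_, ?_⟩
  · have : Finsupp.equivFunOnFinite.symm (n : Fin 4 → ℕ) = n := by ext; simp
    simpa [exponents, this] using hn
  · have : ((∑ i, (n i : ℚ) * α i : ℚ) : ℝ) + 1 < ((∑ i, α i : ℚ) : ℝ) := by
      simp only at hlt; linarith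
    exact_mod_cast this

/-- From here on only the number of exceptional weights matters, not their shape. -/
lemma EncInequalities.exists_exceptions {r k : ℕ} {a : Fin 4 → ℕ} {f : ConvergentSeries}
    {β : Fin 4 → ℚ} (h : EncInequalities r a f k β) :
    ∃ X : Finset (Fin 4 → ℚ), X.card ≤ k ∧ ∀ α ∈ weights r a, α ∉ X → 1 < gap α f := by
  rcases h with ⟨-, -, h⟩ | ⟨hk, -, -, -, h⟩
  · exact ⟨∅, by simp, fun α hα _ => h α hα⟩
  · classical
    -- The value `t = 0` is harmless, and including it makes the bound exactly `k`.
    refine ⟨(Finset.range k).image fun t => t • β, Finset.card_image_le.trans (by simp),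
      fun α hα hX => h α hα fun t h1 h2 he => hX ?_⟩
    exact Finset.mem_image.2 ⟨t, Finset.mem_range.2 (by omega), he.symm⟩

lemma dvd_of_dvd_mul_of_gcd {r x y : ℕ} {m : ℤ} (h : Nat.gcd (Nat.gcd x y) r = 1)
    (hx : (r : ℤ) ∣ m * x) (hy : (r : ℤ) ∣ m * y) : (r : ℤ) ∣ m := by
  have h1 : Int.gcd (Int.gcd x y) r = 1 := by simpa [Int.gcd_natCast_natCast] using h
  have h2 := Int.gcd_eq_gcd_ab x y
  have h3 := Int.gcd_eq_gcd_ab (Int.gcd x y) r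
  rw [h1] at h3
  have : m = (m * x) * (Int.gcdA x y * Int.gcdA (Int.gcd x y) r) +
      (m * y) * (Int.gcdB x y * Int.gcdA (Int.gcd x y) r) + r * (m * Int.gcdB (Int.gcd x y) r) := by
    calc m = m * ((1 : ℕ) : ℤ) := by simp
      _ = _ := by rw [h3]; nth_rewrite 1 [h2]; ring
  rw [this]
  exact dvd_add (dvd_add (hx.mul_right _) (hy.mul_right _)) (dvd_mul_right _ _)

lemma dvd_mul_of_gcd_dvd {r x e : ℕ} {m : ℤ} (h : Nat.gcd x r ∣ Nat.gcd e r)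
    (hx : (r : ℤ) ∣ m * x) : (r : ℤ) ∣ m * e := by
  obtain ⟨q, hq⟩ := h.trans (Nat.gcd_dvd_left e r)
  have h2 := Int.gcd_eq_gcd_ab x r
  rw [Int.gcd_natCast_natCast] at h2
  have : m * (e : ℤ) = (m * x) * (Int.gcdA x r * q) + r * (m * Int.gcdB x r * q) := by
    rw [hq]; push_cast; rw [h2]; ring
  rw [this]
  exact dvd_add (hx.mul_right _) (dvd_mul_right _ _)

/-- The linear form representing `e` is the exponent of any one monomial of `f`, since
semi-invariance makes all of them congruent to `e` on `a`. -/
lemma EncSetting.admissible {k r : ℕ} {a : Fin 4 → ℕ} {e : ℕ} {ξ : ℂ} {f : ConvergentSeries}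
    {β : Fin 4 → ℚ} (h : EncSetting k r a e ξ f β) {n₀ : Fin 4 → ℕ} (hn₀ : n₀ ∈ exponents f) :
    Admissible k r (fun i => a i) (fun i => n₀ i) (exponents f) := by
  have hr := h.r_pos
  have hrQ : (r : ℚ) ≠ 0 := by positivity
  have he := exponents_weight h.primitiveRoot hr h.semiInvariant hn₀
  have hpair : ∀ i j, i ≠ j → ∀ m : ℤ, (r : ℤ) ∣ m * a i → (r : ℤ) ∣ m * a j → (r : ℤ) ∣ m := by
    intro i j hij m hi hj
    rcases lt_or_gt_of_ne hij with hlt | hlt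
    · exact dvd_of_dvd_mul_of_gcd (h.gcd_pair i j hlt) hi hj
    · exact dvd_of_dvd_mul_of_gcd (h.gcd_pair j i hlt) hj hi
  refine ⟨hr, fun n hn => ?_, ?_, hpair, fun i m hm => ?_, fun b => ?_⟩
  · obtain ⟨u, hu⟩ := exponents_weight h.primitiveRoot hr h.semiInvariant hn
    obtain ⟨v, hv⟩ := he
    simp only [sub_mul, Finset.sum_sub_distrib]
    exact ⟨u - v, by linear_combination hu - hv⟩
  · obtain ⟨u, hu⟩ := Int.modEq_iff_dvd.1 h.sum_sub.symm
    obtain ⟨v, hv⟩ := he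
    simp only [sub_mul, one_mul, Finset.sum_sub_distrib]
    exact ⟨u - v, by linear_combination hu - hv⟩
  · obtain ⟨u, hu⟩ := dvd_mul_of_gcd_dvd (h.gcd_dvd i) hm
    obtain ⟨v, hv⟩ := he
    exact ⟨u + m * v, by linear_combination hu + m * hv⟩
  · classical
    obtain ⟨X, hX, hgap⟩ := h.inequalities.exists_exceptions
    let α : ℕ → Fin 4 → ℚ := fun j i => Int.fract ((j * a i : ℚ) / r) + b i
    have hcast : ∀ j i, ((α j i : ℚ) : ℝ) = Int.fract ((j * (a i : ℤ) : ℝ) / r) + b i := by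
      intro j i
      have := Rat.cast_fract (α := ℝ) ((j * a i : ℚ) / r)
      simp only [α, Rat.cast_add, Rat.cast_natCast, this]
      push_cast; rfl
    have hint : ∀ j i (m : ℤ), α j i = m → (r : ℤ) ∣ (j : ℤ) * a i := by
      intro j i m hm
      have h1 : (j * a i : ℚ) / r = ((m - b i + ⌊(j * a i : ℚ) / r⌋ : ℤ) : ℚ) := by
        have := Int.self_sub_fract ((j * a i : ℚ) / r)
        simp only [α] at hm
        push_cast
        linarith
      generalize m - b i + ⌊(j * a i : ℚ) / r⌋ = z at h1
      rw [div_eq_iff hrQ] at h1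
      exact ⟨z, by rw [mul_comm (r : ℤ)]; exact_mod_cast h1⟩
    -- Two integral coordinates would force `r ∣ j` by coprimality. Hence the point is neither `0`
    -- nor a standard basis vector, and it is a legitimate weight.
    have hnotint : ∀ j, 0 < j → j < r → ¬ ∀ i, ∃ m : ℤ, α j i = m := by
      intro j h0 h1 hall
      obtain ⟨m0, hm0⟩ := hall 0
      obtain ⟨m1, hm1⟩ := hall 1
      have := hpair 0 1 (by decide) j (hint _ _ _ hm0) (hint _ _ _ hm1)
      have := Int.le_of_dvd (by omega) this
      omega
    have hdiff : ∀ j i, ∃ z : ℤ, α j i = (j * a i : ℚ) / r + z := fun j i =>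
      ⟨b i - ⌊(j * a i : ℚ) / r⌋, by
        have := Int.self_sub_fract ((j * a i : ℚ) / r)
        simp only [α]; push_cast; linarith⟩
    have hw : ∀ j, 0 < j → j < r → α j ∈ weights r a := by
      intro j h0 h1
      refine ⟨⟨j, fun i => ?_⟩, fun i => by simp only [α]; positivity, fun h0' => ?_,
        fun i hi => ?_⟩
      · obtain ⟨z, hz⟩ := hdiff j i
        exact ⟨z, by rw [hz]; push_cast; rfl⟩
      · exact hnotint j h0 h1 fun i => ⟨0, by rw [h0']; simp⟩
      · refine hnotint j h0 h1 fun i' => ?_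
        rw [hi]
        by_cases hii : i' = i
        · exact ⟨1, by subst hii; simp⟩
        · exact ⟨0, by simp [hii]⟩
    refine ⟨(Finset.range r).filter fun j => 0 < j ∧ α j ∈ X, ?_, fun j h0 h1 hj => ?_⟩
    -- Distinct `j` give distinct weights, again by coprimality of two of the `aᵢ`, so each
    -- exceptional weight spoils at most one `j`.
    · refine le_trans (Finset.card_le_card_of_injOn α (fun j hj => ?_) ?_) hX
      · exact (Finset.mem_filter.1 hj).2.2
      · intro j hj j' hj' hjj
        simp only [Finset.coe_filter, Finset.mem_range, Set.mem_ofPred_eq] at hj hj'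
        have hd : ∀ i, (r : ℤ) ∣ ((j : ℤ) - j') * a i := by
          intro i
          obtain ⟨z, hz⟩ := hdiff j i
          obtain ⟨z', hz'⟩ := hdiff j' i
          have h2 : (j * a i : ℚ) / r + z = (j' * a i : ℚ) / r + z' := by
            rw [← hz, ← hz', hjj]
          have h3 : ((j : ℚ) - j') * a i = r * (z' - z) := by
            field_simp at h2; linarith
          exact ⟨z' - z, by exact_mod_cast h3⟩
        have := hpair 0 1 (by decide) _ (hd 0) (hd 1)
        have := Int.eq_zero_of_abs_lt_dvd this (by rw [abs_lt]; omega)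
        omega
    · have hjX : α j ∉ X := fun hx => hj (by simp [h0, h1, hx])
      obtain ⟨n, hn, hlt⟩ := exists_exponent_of_one_lt_gap ⟨n₀, hn₀⟩ (hgap _ (hw j h0 h1) hjX)
      refine ⟨n, hn, ?_⟩
      have hnw := exponents_weight h.primitiveRoot hr h.semiInvariant hn
      obtain ⟨u, hu⟩ := Int.modEq_iff_dvd.1 h.sum_sub.symm
      obtain ⟨v, hv⟩ := hnw
      choose z hz using hdiff j
      -- The quantisation step: the gap lies in `j/r + ℤ` and exceeds `1`, while `j/r < 1`, so it is
      -- at least `1 + j/r`.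
      have hq : ∃ q : ℤ, ∑ i, α j i - ∑ i, (n i : ℚ) * α j i = (j : ℚ) / r + q := by
        have huQ : (∑ i, (a i : ℚ)) - e - 1 = r * u := by exact_mod_cast hu
        have hvQ : (∑ i, (n i : ℚ) * a i) - e = r * v := by exact_mod_cast hv
        refine ⟨j * (u - v) + ∑ i, z i - ∑ i, n i * z i, ?_⟩
        have e1 : ∑ i, α j i = (j : ℚ) / r * ∑ i, (a i : ℚ) + ∑ i, (z i : ℚ) := by
          rw [Finset.mul_sum, ← Finset.sum_add_distrib]
          exact Finset.sum_congr rfl fun i _ => by rw [hz]; ring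
        have e2 : ∑ i, (n i : ℚ) * α j i =
            (j : ℚ) / r * ∑ i, (n i : ℚ) * a i + ∑ i, (n i : ℚ) * z i := by
          rw [Finset.mul_sum, ← Finset.sum_add_distrib]
          exact Finset.sum_congr rfl fun i _ => by rw [hz]; ring
        rw [e1, e2, show ∑ i, (a i : ℚ) = e + 1 + r * u by linarith,
          show ∑ i, (n i : ℚ) * a i = e + r * v by linarith]
        push_cast
        field_simp
        ring
      obtain ⟨q, hq⟩ := hq
      have hjr : (j : ℚ) / r < 1 := by
        rw [div_lt_one (by positivity)]; exact_mod_cast h1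
      have hq1 : 1 ≤ q := by
        have : (0 : ℚ) < q := by linarith
        exact_mod_cast this
      have hfin : ∑ i, (n i : ℚ) * α j i + 1 + (j : ℚ) / r ≤ ∑ i, α j i := by
        have : (1 : ℚ) ≤ q := by exact_mod_cast hq1
        linarith
      have hfinR : ((∑ i, (n i : ℚ) * α j i + 1 + (j : ℚ) / r : ℚ) : ℝ) ≤
          ((∑ i, α j i : ℚ) : ℝ) := by exact_mod_cast hfin
      push_cast [hcast] at hfinR
      simpa using hfinR

/-! ### A quantitative Kronecker theorem for finite cyclic groups. -/

/-- A power of the Fejér-type kernel `(1 + cos 2πu) / 2` as a trigonometric polynomial. -/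
lemma cosKernel_pow_eq_sum (m : ℕ) (u : ℝ) :
    ((((1 + Real.cos (2 * Real.pi * u)) / 2) ^ m : ℝ) : ℂ) =
      ∑ p ∈ Finset.range (2 * m + 1), (((2 * m).choose p / 4 ^ m : ℝ) : ℂ) *
        Complex.exp (2 * Real.pi * Complex.I * (((p : ℤ) - m : ℤ) * u)) := by
  have h1 : (((1 + Real.cos (2 * Real.pi * u)) / 2 : ℝ) : ℂ) =
      Complex.exp (-(2 * Real.pi * Complex.I * u)) *
        (Complex.exp (2 * Real.pi * Complex.I * u) + 1) ^ 2 / 4 := by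
    have h2 : Complex.exp (-(2 * Real.pi * Complex.I * u)) *
        Complex.exp (2 * Real.pi * Complex.I * u) = 1 := by
      rw [← Complex.exp_add]; simp
    push_cast
    rw [Complex.cos, show (2 * Real.pi * u : ℂ) * Complex.I = 2 * Real.pi * Complex.I * u by ring,
      show -(2 * Real.pi * u : ℂ) * Complex.I = -(2 * Real.pi * Complex.I * u) by ring]
    linear_combination (-(1 / 4) * Complex.exp (2 * Real.pi * Complex.I * u) - 1 / 2) * h2
  rw [Complex.ofReal_pow, h1, div_pow, mul_pow, ← pow_mul, add_pow, Finset.mul_sum,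
    Finset.sum_div]
  refine Finset.sum_congr rfl fun p _ => ?_
  rw [one_pow, mul_one, ← Complex.exp_nat_mul, ← Complex.exp_nat_mul]
  rw [show (2 * Real.pi * Complex.I * (((p : ℤ) - m : ℤ) * u) : ℂ) =
    (m : ℂ) * -(2 * Real.pi * Complex.I * u) + p * (2 * Real.pi * Complex.I * u) by
      push_cast; ring, Complex.exp_add]
  push_cast
  ring

lemma sum_exp_eq_ite {r : ℕ} (hr : 0 < r) (w : ℤ) :
    ∑ j ∈ Finset.range r, Complex.exp (2 * Real.pi * Complex.I * (j * (w / r))) =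
      if (r : ℤ) ∣ w then (r : ℂ) else 0 := by
  have hr0 : (r : ℂ) ≠ 0 := by exact_mod_cast hr.ne'
  have hpow : ∀ j : ℕ, Complex.exp (2 * Real.pi * Complex.I * (j * (w / r))) =
      Complex.exp (2 * Real.pi * Complex.I * (w / r)) ^ j := by
    intro j; rw [← Complex.exp_nat_mul]; ring_nf
  have hpi : (2 * Real.pi * Complex.I : ℂ) ≠ 0 := Complex.two_pi_I_ne_zero
  simp only [hpow]
  split_ifs with h
  · obtain ⟨q, rfl⟩ := h
    have : Complex.exp (2 * Real.pi * Complex.I * (((r * q : ℤ) : ℂ) / r)) = 1 := by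
      rw [Complex.exp_eq_one_iff]
      exact ⟨q, by push_cast; field_simp⟩
    simp only [this, one_pow, Finset.sum_const, Finset.card_range, nsmul_eq_mul, mul_one]
  · have hne : Complex.exp (2 * Real.pi * Complex.I * ((w : ℂ) / r)) ≠ 1 := by
      rw [Ne, Complex.exp_eq_one_iff]
      rintro ⟨q, hq⟩
      apply h
      rw [mul_comm (q : ℂ)] at hq
      have h2 := mul_left_cancel₀ hpi hq
      rw [div_eq_iff hr0] at h2
      exact ⟨q, by rw [mul_comm]; exact_mod_cast h2⟩
    rw [geom_sum_eq hne, ← hpow, Complex.exp_eq_one_iff.2 ⟨w, by field_simp⟩]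
    simp

section Kronecker

variable {ι : Type*} [Fintype ι] [DecidableEq ι]

/-- Expand the product into characters, all with non-negative coefficients. Summation over `j` kills
the characters that are non-trivial on `a/r`; the others have phase `1` at `h` by hypothesis. Every
surviving term is non-negative, and the trivial character alone gives the lower bound. -/
lemma le_sum_prod_cosKernel {r : ℕ} (hr : 0 < r) (m : ℕ) (a : ι → ℤ) (h : ι → ℝ)
    (hah : ∀ w : ι → ℤ, (∀ i, |w i| ≤ m) → (r : ℤ) ∣ ∑ i, w i * a i → ∑ i, w i * h i = 0) :
    r * (((2 * m).choose m : ℝ) / 4 ^ m) ^ Fintype.card ι ≤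
      ∑ j ∈ Finset.range r,
        ∏ i, ((1 + Real.cos (2 * Real.pi * (j * a i / r - h i))) / 2) ^ m := by
  have hrC : (r : ℂ) ≠ 0 := by exact_mod_cast hr.ne'
  set P : Finset (ι → ℕ) := Fintype.piFinset fun _ => Finset.range (2 * m + 1) with hP
  have key : ((∑ j ∈ Finset.range r,
      ∏ i, ((1 + Real.cos (2 * Real.pi * (j * a i / r - h i))) / 2) ^ m : ℝ) : ℂ) =
      ((∑ p ∈ P, (∏ i, ((2 * m).choose (p i) / 4 ^ m : ℝ)) *
        (if (r : ℤ) ∣ ∑ i, ((p i : ℤ) - m) * a i then (r : ℝ) else 0) : ℝ) : ℂ) := by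
    push_cast [-Complex.ofReal_prod]
    have e1 : ∀ j : ℕ, ((∏ i, ((1 + Real.cos (2 * Real.pi * (j * a i / r - h i))) / 2) ^ m : ℝ) : ℂ)
        = ∑ p ∈ P, (∏ i, (((2 * m).choose (p i) / 4 ^ m : ℝ) : ℂ)) *
          (Complex.exp (2 * Real.pi * Complex.I * (-∑ i, ((p i : ℤ) - m : ℤ) * (h i : ℂ))) *
          Complex.exp (2 * Real.pi * Complex.I *
            (j * ((∑ i, ((p i : ℤ) - m) * a i : ℤ) / r)))) := by
      intro j
      rw [Complex.ofReal_prod]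
      simp only [cosKernel_pow_eq_sum]
      rw [Finset.prod_univ_sum]
      refine Finset.sum_congr rfl fun p _ => ?_
      rw [Finset.prod_mul_distrib, ← Complex.exp_sum, ← Complex.exp_add, ← Finset.mul_sum,
        ← mul_add]
      congr 4
      push_cast
      rw [Finset.sum_div, Finset.mul_sum, ← Finset.sum_neg_distrib, ← Finset.sum_add_distrib]
      refine Finset.sum_congr rfl fun i _ => ?_
      field_simp
      ring
    simp only [e1]
    rw [Finset.sum_comm]
    refine Finset.sum_congr rfl fun p hp => ?_
    rw [← Finset.mul_sum, ← Finset.mul_sum, sum_exp_eq_ite hr]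
    congr 1
    · push_cast; rfl
    split_ifs with hd
    · have h0 := hah (fun i => (p i : ℤ) - m) (fun i => by
        have := Finset.mem_range.1 (Fintype.mem_piFinset.1 hp i)
        rw [abs_le]; omega) hd
      have h0' : ∑ i, (((p i : ℤ) - m : ℤ) : ℂ) * (h i : ℂ) = 0 := by exact_mod_cast h0
      rw [h0']; simp
    · simp
  have key2 := Complex.ofReal_injective key
  rw [key2]
  have hmem : (fun _ : ι => m) ∈ P := by simp [hP]; omega
  have hnn : ∀ p ∈ P, 0 ≤ (∏ i, ((2 * m).choose (p i) / 4 ^ m : ℝ)) *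
        (if (r : ℤ) ∣ ∑ i, ((p i : ℤ) - m) * a i then (r : ℝ) else 0) := by
    intro p _
    split_ifs <;> positivity
  refine le_trans (le_of_eq ?_) (Finset.single_le_sum hnn hmem)
  simp only [sub_self, zero_mul, Finset.sum_const_zero, dvd_zero, if_true, Finset.prod_const,
    Finset.card_univ]
  ring

/-- The kernel decays exponentially in `m` away from its peak, whereas the central coefficient is
only polynomially small. This lets the main term win. -/
lemma exists_pow_lt_inv_pow {ρ : ℝ} (h0 : 0 ≤ ρ) (h1 : ρ < 1) (d : ℕ) :
    ∃ m : ℕ, 0 < m ∧ ρ ^ m < 1 / (2 * (2 * m : ℝ) ^ d) := by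
  have := tendsto_pow_const_mul_const_pow_of_lt_one d h0 h1
  have h2 : Tendsto (fun n : ℕ => (2 * 2 ^ d : ℝ) * ((n : ℝ) ^ d * ρ ^ n)) atTop (𝓝 0) := by
    simpa using this.const_mul (2 * 2 ^ d : ℝ)
  obtain ⟨m, hm, hm0⟩ := ((h2.eventually (gt_mem_nhds one_pos)).and (eventually_gt_atTop 0)).exists
  refine ⟨m, hm0, ?_⟩
  have : (0 : ℝ) < m := by exact_mod_cast hm0
  rw [lt_div_iff₀ (by positivity), mul_pow]
  calc _ = (2 * 2 ^ d : ℝ) * ((m : ℝ) ^ d * ρ ^ m) := by ring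
    _ < 1 := hm

lemma cos_le_of_dist_round {ε u : ℝ} (h0 : 0 < ε) (h1 : ε ≤ 1 / 2) (hu : ε ≤ |u - round u|) :
    Real.cos (2 * Real.pi * u) ≤ Real.cos (2 * Real.pi * ε) := by
  have hpi := Real.pi_pos
  have h2 : Real.cos (2 * Real.pi * u) = Real.cos (2 * Real.pi * |u - round u|) := by
    rw [show 2 * Real.pi * |u - round u| = |2 * Real.pi * (u - round u)| by
      rw [abs_mul, abs_of_pos (by positivity : 0 < 2 * Real.pi)], Real.cos_abs,
      show 2 * Real.pi * (u - round u) = 2 * Real.pi * u - (round u : ℤ) * (2 * Real.pi) by ring,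
      Real.cos_sub_int_mul_two_pi]
  rw [h2]
  have h3 := abs_sub_round u
  refine Real.cos_le_cos_of_nonneg_of_le_pi (by positivity) ?_ ?_
  · nlinarith
  · gcongr

/-- A form of Kronecker's theorem for a sequence of finite cyclic subgroups of the torus: a point
annihilated by the characters that are eventually trivial is eventually approximated by
arbitrarily many elements. -/
theorem eventually_card_near {U : Ultrafilter ℕ} {r : ℕ → ℕ} (hr : Tendsto r U atTop)
    (a : ℕ → ι → ℤ) (h : ι → ℝ)
    (hah : ∀ w : ι → ℤ, (∀ᶠ x in U, (r x : ℤ) ∣ ∑ i, w i * a x i) → ∑ i, w i * h i = 0)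
    {ε : ℝ} (hε : 0 < ε) (K : ℕ) :
    ∀ᶠ x in U, ∃ A : Finset ℕ, (∀ j ∈ A, ∀ i,
        |((j * a x i / r x - h i : ℝ)) - round (j * a x i / r x - h i : ℝ)| < ε) ∧
      A ⊆ Finset.range (r x) ∧ K ≤ A.card := by
  -- Distances to the nearest integer are at most `1/2`, and the cosine is monotone on that range.
  wlog hε2 : ε ≤ 1 / 2 generalizing ε
  · filter_upwards [this (ε := 1 / 2) (by norm_num) le_rfl] with x ⟨A, hA, hx⟩
    exact ⟨A, fun j hj i => (hA j hj i).trans (not_le.1 hε2), hx⟩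
  set ρ : ℝ := (1 + Real.cos (2 * Real.pi * ε)) / 2 with hρ
  have hρ0 : 0 ≤ ρ := by have := Real.neg_one_le_cos (2 * Real.pi * ε); rw [hρ]; linarith
  have hρ1 : ρ < 1 := by
    have : Real.cos (2 * Real.pi * ε) < Real.cos 0 :=
      Real.cos_lt_cos_of_nonneg_of_le_pi le_rfl (by nlinarith [Real.pi_pos]) (by positivity)
    rw [Real.cos_zero] at this; rw [hρ]; linarith
  obtain ⟨m, hm0, hm⟩ := exists_pow_lt_inv_pow hρ0 hρ1 (Fintype.card ι)
  have hmR : (0 : ℝ) < m := by exact_mod_cast hm0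
  set δ : ℝ := 1 / (2 * (2 * m : ℝ) ^ Fintype.card ι) with hδ
  have hδ0 : 0 < δ := by positivity
  have hcoef : 2 * δ ≤ (((2 * m).choose m : ℝ) / 4 ^ m) ^ Fintype.card ι := by
    have h4 : (4 : ℝ) ^ m ≤ 2 * m * ((2 * m).choose m : ℝ) := by
      exact_mod_cast Nat.four_pow_le_two_mul_self_mul_centralBinom m hm0
    rw [hδ, show 2 * (1 / (2 * (2 * m : ℝ) ^ Fintype.card ι)) = (1 / (2 * m)) ^ Fintype.card ι by
      rw [div_pow, one_pow]; field_simp]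
    refine pow_le_pow_left₀ (by positivity) ?_ _
    rw [div_le_div_iff₀ (by positivity) (by positivity)]
    linarith
  -- Only finitely many characters occur in a kernel of degree `m`. For an ultrafilter each of them
  -- is either eventually trivial, where the hypothesis applies, or eventually non-trivial.
  have hfin : ∀ᶠ x in U, ∀ w ∈ {w : ι → ℤ | ∀ i, |w i| ≤ m},
      (r x : ℤ) ∣ ∑ i, w i * a x i → ∑ i, w i * h i = 0 := by
    have hf : {w : ι → ℤ | ∀ i, |w i| ≤ m}.Finite := by
      refine (Set.finite_Icc (fun _ => -(m : ℤ)) (fun _ => (m : ℤ))).subset fun w hw => ?_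
      exact ⟨fun i => (abs_le.1 (hw i)).1, fun i => (abs_le.1 (hw i)).2⟩
    rw [Filter.eventually_all_finite hf]
    intro w _
    by_cases hw : ∀ᶠ x in U, (r x : ℤ) ∣ ∑ i, w i * a x i
    · exact Eventually.of_forall fun _ _ => hah w hw
    · filter_upwards [Ultrafilter.eventually_not.2 hw] with x hx hx'
      exact absurd hx' hx
  obtain ⟨R, hR⟩ := exists_nat_ge ((K : ℝ) / δ)
  filter_upwards [hfin, hr.eventually_ge_atTop R, hr.eventually_ge_atTop 1] with x hx hRx h1x
  have hmain := le_sum_prod_cosKernel (by omega : 0 < r x) m (a x) h fun w hw => hx w hw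
  set A := (Finset.range (r x)).filter fun j : ℕ => ∀ i,
      |((j * a x i / r x - h i : ℝ)) - round (j * a x i / r x - h i : ℝ)| < ε with hA
  have hk0 : ∀ u : ℝ, 0 ≤ (1 + Real.cos (2 * Real.pi * u)) / 2 := fun u => by
    have := Real.neg_one_le_cos (2 * Real.pi * u); linarith
  have hk1 : ∀ u : ℝ, (1 + Real.cos (2 * Real.pi * u)) / 2 ≤ 1 := fun u => by
    have := Real.cos_le_one (2 * Real.pi * u); linarith
  have hterm : ∀ j ∈ Finset.range (r x),
      ∏ i, ((1 + Real.cos (2 * Real.pi * (j * a x i / r x - h i))) / 2) ^ m ≤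
        (if j ∈ A then 1 else 0) + ρ ^ m := by
    intro j hj
    split_ifs with hjA
    · have : ∏ i, ((1 + Real.cos (2 * Real.pi * (j * a x i / r x - h i))) / 2) ^ m ≤ 1 :=
        Finset.prod_le_one (fun i _ => pow_nonneg (hk0 _) _)
          (fun i _ => pow_le_one₀ (hk0 _) (hk1 _))
      have := pow_nonneg hρ0 m
      linarith
    · have : ∃ i, ε ≤ |((j * a x i / r x - h i : ℝ)) - round (j * a x i / r x - h i : ℝ)| := by
        by_contra hcon
        push Not at hcon
        exact hjA (Finset.mem_filter.2 ⟨hj, hcon⟩)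
      obtain ⟨i, hi⟩ := this
      have hc := cos_le_of_dist_round hε hε2 hi
      rw [← Finset.mul_prod_erase _ _ (Finset.mem_univ i), zero_add]
      have hp : ∏ i ∈ Finset.univ.erase i,
          ((1 + Real.cos (2 * Real.pi * (j * a x i / r x - h i))) / 2) ^ m ≤ 1 :=
        Finset.prod_le_one (fun i _ => pow_nonneg (hk0 _) _)
          (fun i _ => pow_le_one₀ (hk0 _) (hk1 _))
      have hq : ((1 + Real.cos (2 * Real.pi * (j * a x i / r x - h i))) / 2) ^ m ≤ ρ ^ m :=
        pow_le_pow_left₀ (hk0 _) (by rw [hρ]; linarith) _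
      exact (mul_le_of_le_one_right (pow_nonneg (hk0 _) _) hp).trans hq
  have hsum := Finset.sum_le_sum hterm
  rw [Finset.sum_add_distrib, Finset.sum_ite_mem, Finset.sum_const, Finset.sum_const,
    Finset.inter_eq_right.2 (Finset.filter_subset _ _), Finset.card_range, nsmul_eq_mul,
    nsmul_eq_mul, mul_one] at hsum
  have hr0 : (0 : ℝ) < r x := by exact_mod_cast h1x
  -- The average of the kernel is at least `2δ` and far points contribute less than `δ` each, so at
  -- least `δ r` points are near.
  have h5 : (r x : ℝ) * (2 * δ) ≤ A.card + r x * ρ ^ m :=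
    (mul_le_mul_of_nonneg_left hcoef hr0.le).trans (hmain.trans hsum)
  have h6 : (r x : ℝ) * ρ ^ m ≤ r x * δ := by gcongr
  have h7 : (K : ℝ) ≤ r x * δ := by
    rw [div_le_iff₀ hδ0] at hR
    refine hR.trans ?_
    gcongr
  have : (K : ℝ) ≤ A.card := by linarith
  exact ⟨A, fun j hj => (Finset.mem_filter.1 hj).2, Finset.filter_subset _ _, by exact_mod_cast this⟩

end Kronecker

/-! ### Generic integral vectors orthogonal to a group of relations. -/

lemma exists_nat_smul_mem_of_mem_span {ι : Type*} (Λ : AddSubgroup (ι → ℤ)) {v : ι → ℚ}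
    (hv : v ∈ Submodule.span ℚ {u : ι → ℚ | ∃ w ∈ Λ, u = fun i => (w i : ℚ)}) :
    ∃ N : ℕ, 0 < N ∧ ∃ w ∈ Λ, ∀ i, (N : ℚ) * v i = w i := by
  induction hv using Submodule.span_induction with
  | mem u hu =>
    obtain ⟨w, hw, rfl⟩ := hu
    exact ⟨1, one_pos, w, hw, by simp⟩
  | zero => exact ⟨1, one_pos, 0, Λ.zero_mem, by simp⟩
  | add u v _ _ hu hv =>
    obtain ⟨N, hN, w, hw, h1⟩ := hu
    obtain ⟨M, hM, w', hw', h2⟩ := hv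
    refine ⟨N * M, by positivity, (M : ℤ) • w + (N : ℤ) • w',
      Λ.add_mem (Λ.zsmul_mem hw _) (Λ.zsmul_mem hw' _), fun i => ?_⟩
    simp only [Pi.add_apply, Pi.smul_apply, smul_eq_mul]
    push_cast
    rw [← h1, ← h2]; ring
  | smul q u _ hu =>
    obtain ⟨N, hN, w, hw, h1⟩ := hu
    refine ⟨q.den * N, Nat.mul_pos q.den_pos hN, q.num • w, Λ.zsmul_mem hw _, fun i => ?_⟩
    simp only [Pi.smul_apply, smul_eq_mul]
    push_cast
    rw [← h1]
    have := Rat.mul_den_eq_num q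
    linear_combination ((N : ℚ) * u i) * this

/-- An integral vector orthogonal to a group of relations and to no other relation in a given
finite family, up to multiples. -/
lemma exists_generic_orthogonal {ι κ : Type*} [Fintype ι] [DecidableEq ι] [Finite κ]
    (Λ : AddSubgroup (ι → ℤ)) (F : κ → ι → ℤ) :
    ∃ c : ι → ℤ, (∀ w ∈ Λ, ∑ i, w i * c i = 0) ∧
      ∀ k, ∑ i, F k i * c i = 0 → ∃ N : ℕ, 0 < N ∧ (N : ℤ) • F k ∈ Λ := by
  set W := Submodule.span ℚ {u : ι → ℚ | ∃ w ∈ Λ, u = fun i => (w i : ℚ)} with hW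
  let v : κ → (ι → ℚ) ⧸ W := fun k => W.mkQ fun i => (F k i : ℚ)
  -- Over an infinite field some functional on the quotient by the span of `Λ` vanishes at none of
  -- finitely many non-zero vectors; `c` is this functional with denominators cleared.
  obtain ⟨φ, hφ⟩ := Module.exists_dual_forall_apply_ne_zero (K := ℚ)
    (fun k : {k // v k ≠ 0} => v k) fun k => k.2
  let g := φ ∘ₗ W.mkQ
  let q : ι → ℚ := fun i => g (Pi.single i 1)
  have hg : ∀ u : ι → ℚ, g u = ∑ i, u i * q i := fun u => by
    have := LinearMap.pi_apply_eq_sum_univ g u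
    simp only [smul_eq_mul] at this
    rw [this]
    refine Finset.sum_congr rfl fun i _ => ?_
    congr 2
    funext j
    simp [Pi.single_apply, eq_comm]
  let D : ℕ := ∏ i, (q i).den
  have hD : 0 < D := Finset.prod_pos fun i _ => (q i).den_pos
  have hint : ∀ i, ∃ z : ℤ, (z : ℚ) = D * q i := fun i => by
    obtain ⟨m, hm⟩ := Finset.dvd_prod_of_mem (fun i => (q i).den) (Finset.mem_univ i)
    refine ⟨m * (q i).num, ?_⟩
    have : (D : ℚ) = (q i).den * m := by exact_mod_cast hm
    rw [this]; push_cast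
    have := Rat.mul_den_eq_num (q i)
    linear_combination -(m : ℚ) * this
  choose c hc using hint
  have hgc : ∀ w : ι → ℤ, ((∑ i, w i * c i : ℤ) : ℚ) = D * g fun i => (w i : ℚ) := fun w => by
    rw [hg, Finset.mul_sum]; push_cast
    exact Finset.sum_congr rfl fun i _ => by rw [hc]; ring
  refine ⟨c, fun w hw => ?_, fun k hk => ?_⟩
  · have h0 : g (fun i => (w i : ℚ)) = 0 := by
      have : W.mkQ (fun i => (w i : ℚ)) = 0 := by
        rw [Submodule.mkQ_apply, Submodule.Quotient.mk_eq_zero]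
        exact Submodule.subset_span ⟨w, hw, rfl⟩
      simp only [g, LinearMap.comp_apply, this, map_zero]
    have := hgc w
    rw [h0, mul_zero] at this
    exact_mod_cast this
  · have hDQ : (D : ℚ) ≠ 0 := by exact_mod_cast hD.ne'
    have h0 : g (fun i => (F k i : ℚ)) = 0 := by
      have := hgc (F k)
      rw [hk] at this
      simpa [hDQ] using this.symm
    have hv : v k = 0 := by
      by_contra hne
      exact hφ ⟨k, hne⟩ h0
    have hmem : (fun i => (F k i : ℚ)) ∈ W := by
      simpa only [v, Submodule.mkQ_apply, Submodule.Quotient.mk_eq_zero] using hv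
    obtain ⟨N, hN, w, hw, h1⟩ := exists_nat_smul_mem_of_mem_span Λ hmem
    refine ⟨N, hN, ?_⟩
    have : (N : ℤ) • F k = w := by
      funext i
      have := h1 i
      simp only [Pi.smul_apply, smul_eq_mul]
      exact_mod_cast this
    rw [this]; exact hw

/-- The characters that are eventually trivial on the cyclic groups generated by `a x / r x`. -/
def relations (U : Ultrafilter ℕ) (r : ℕ → ℕ) (a : ℕ → Fin 4 → ℤ) :
    AddSubgroup (Fin 4 → ℤ) where
  carrier := {w | ∀ᶠ x in U, (r x : ℤ) ∣ ∑ i, w i * a x i}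
  zero_mem' := by simp
  add_mem' := by
    intro v w hv hw
    filter_upwards [hv, hw] with x h1 h2
    simp only [Pi.add_apply, add_mul, Finset.sum_add_distrib]
    exact Int.dvd_add h1 h2
  neg_mem' := by
    intro v hv
    filter_upwards [hv] with x h1
    simp only [Pi.neg_apply, neg_mul, Finset.sum_neg_distrib]
    exact Int.dvd_neg.2 h1

lemma mem_relations {U : Ultrafilter ℕ} {r : ℕ → ℕ} {a : ℕ → Fin 4 → ℤ} {w : Fin 4 → ℤ} :
    w ∈ relations U r a ↔ ∀ᶠ x in U, (r x : ℤ) ∣ ∑ i, w i * a x i := Iff.rfl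

/-! ### Passing to the limit along a line. -/

/-- Choosing a minimiser of `M x` among the finitely many candidates avoids a diagonal argument. -/
lemma exists_seq_tendsto_zero {F : Filter ℕ} {P : ℕ → ℕ → Prop} {M : ℕ → ℕ → ℝ}
    (hfin : ∀ x, {j | P x j}.Finite) (hM : ∀ x j, 0 ≤ M x j)
    (h : ∀ δ > 0, ∀ᶠ x in F, ∃ j, P x j ∧ M x j < δ) :
    ∃ j : ℕ → ℕ, (∀ᶠ x in F, P x (j x)) ∧ Tendsto (fun x => M x (j x)) F (𝓝 0) := by
  have hmin : ∀ x, ∃ j, (∃ j', P x j') → P x j ∧ ∀ j', P x j' → M x j ≤ M x j' := fun x => by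
    by_cases hx : ∃ j', P x j'
    · obtain ⟨j, hj, hj'⟩ := Set.exists_min_image _ (M x) (hfin x) hx
      exact ⟨j, fun _ => ⟨hj, hj'⟩⟩
    · exact ⟨0, fun h => absurd h hx⟩
  choose j hj using hmin
  refine ⟨j, ?_, ?_⟩
  · filter_upwards [h 1 one_pos] with x ⟨j', hj', _⟩
    exact (hj x ⟨j', hj'⟩).1
  · rw [Metric.tendsto_nhds]
    intro δ hδ
    filter_upwards [h δ hδ] with x ⟨j', hj', hlt⟩
    rw [Real.dist_eq, sub_zero, abs_of_nonneg (hM _ _)]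
    exact ((hj x ⟨j', hj'⟩).2 j' hj').trans_lt hlt

/-- Two elements with the same residue of `N j` are told apart by the quotient `N j / r`, which is
less than `N`. -/
lemma card_filter_mul_mod_le {r N : ℕ} (hN : 0 < N) {A : Finset ℕ} (hA : A ⊆ Finset.range r)
    (d : ℕ) : (A.filter fun j => N * j % r = d).card ≤ N := by
  refine le_trans (Finset.card_le_card_of_injOn (t := Finset.range N) (fun j => N * j / r)
    (fun j hj => ?_) ?_) (by simp)
  · have hj' := Finset.mem_range.1 (hA (Finset.mem_filter.1 hj).1)
    simp only [Finset.coe_range, Set.mem_Iio]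
    rw [Nat.div_lt_iff_lt_mul (by omega)]
    exact Nat.mul_lt_mul_of_pos_left hj' hN
  · intro j hj j' hj' h
    have h1 := (Finset.mem_filter.1 hj).2
    have h2 := (Finset.mem_filter.1 hj').2
    have h3 := Nat.div_add_mod (N * j) r
    have h4 := Nat.div_add_mod (N * j') r
    simp only at h
    rw [h1, h] at h3
    rw [h2, h3] at h4
    exact Nat.eq_of_mul_eq_mul_left hN h4

lemma abs_sub_round_add_int (u : ℝ) (z : ℤ) :
    |u + z - round (u + z)| = |u - round u| := by
  rw [round_add_intCast]; push_cast; congr 1; ring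

/-- Points on the line spanned by a vector orthogonal to all relations are approximated by
multiples of `a x / r x` outside of small exceptional sets, and exactly so in the coordinates that
vanish. -/
lemma eventually_exists_near {U : Ultrafilter ℕ} {r : ℕ → ℕ} {a : ℕ → Fin 4 → ℤ}
    (hr : Tendsto r U atTop) {c : Fin 4 → ℤ} (hc : ∀ w ∈ relations U r a, ∑ i, w i * c i = 0)
    {N : ℕ} (hN : 0 < N) (hz : ∀ i, c i = 0 → ∀ᶠ x in U, (r x : ℤ) ∣ N * a x i)
    {k : ℕ} {J : ℕ → Finset ℕ} (hJ : ∀ x, (J x).card ≤ k) (s : ℝ) {δ : ℝ} (hδ : 0 < δ) :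
    ∀ᶠ x in U, ∃ j : ℕ, (0 < j ∧ j < r x ∧ j ∉ J x ∧ ∀ i, c i = 0 → (r x : ℤ) ∣ j * a x i) ∧
      ∀ i, |(j * a x i / r x - s * c i : ℝ) - round (j * a x i / r x - s * c i : ℝ)| < δ := by
  -- Approximation is done with `N a` in place of `a`, and `j` is then the residue of `N j'`. This
  -- makes `j a i` exactly divisible by `r` where `c i = 0`; mere closeness would allow fractional
  -- parts near `1`. Since a residue arises from at most `N` values of `j'`, having `(k + 1) N + 1`
  -- of them leaves one outside `J x` and different from `0`.
  have hnear := eventually_card_near hr (fun x i => N * a x i) (fun i => s * c i) (fun w hw => ?_)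
    hδ ((k + 1) * N + 1)
  swap
  · have hmem : (fun i => (N : ℤ) * w i) ∈ relations U r a := by
      rw [mem_relations]
      filter_upwards [hw] with x hx
      have : ∑ i, (N : ℤ) * w i * a x i = ∑ i, w i * (N * a x i) :=
        Finset.sum_congr rfl fun i _ => by ring
      rw [this]; exact hx
    have h0 := hc _ hmem
    have h1 : (N : ℤ) * ∑ i, w i * c i = 0 := by
      rw [← h0, Finset.mul_sum]
      exact Finset.sum_congr rfl fun i _ => by ring
    have h2 : ∑ i, w i * c i = 0 := by
      rcases mul_eq_zero.1 h1 with h | h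
      · omega
      · exact h
    have h3 : ((∑ i, w i * c i : ℤ) : ℝ) = 0 := by rw [h2]; simp
    push_cast at h3
    calc ∑ i, (w i : ℝ) * (s * c i) = s * ∑ i, (w i : ℝ) * c i := by
          rw [Finset.mul_sum]; exact Finset.sum_congr rfl fun i _ => by ring
      _ = 0 := by rw [h3, mul_zero]
  have hz' : ∀ᶠ x in U, ∀ i, c i = 0 → (r x : ℤ) ∣ N * a x i := by
    rw [Filter.eventually_all]
    intro i
    by_cases hi : c i = 0
    · filter_upwards [hz i hi] with x hx _ using hx
    · exact Eventually.of_forall fun x h => absurd h hi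
  filter_upwards [hnear, hz', hr.eventually_ge_atTop 1] with x ⟨A, hA, hAr, hAc⟩ hzx hrx
  obtain ⟨j', hj', hnot⟩ : ∃ j' ∈ A, N * j' % r x ∉ insert 0 (J x) := by
    by_contra hcon
    push Not at hcon
    have h1 := Finset.card_le_mul_card_image_of_maps_to (s := A) (t := insert 0 (J x))
      (f := fun j => N * j % r x) hcon N fun d _ => card_filter_mul_mod_le hN hAr d
    have h2 : (insert 0 (J x)).card ≤ k + 1 := (Finset.card_insert_le _ _).trans (by
      have := hJ x; omega)
    have h3 : N * (insert 0 (J x)).card ≤ N * (k + 1) := Nat.mul_le_mul_left _ h2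
    have h4 : N * (k + 1) = (k + 1) * N := mul_comm _ _
    omega
  rw [Finset.mem_insert, not_or] at hnot
  have hdiv : (r x : ℤ) * ((N * j' / r x : ℕ) : ℤ) + ((N * j' % r x : ℕ) : ℤ) = N * j' := by
    exact_mod_cast Nat.div_add_mod (N * j') (r x)
  have hrR : (r x : ℝ) ≠ 0 := by
    have : 0 < r x := hrx
    positivity
  refine ⟨N * j' % r x, ⟨Nat.pos_of_ne_zero hnot.1, Nat.mod_lt _ hrx, hnot.2, fun i hi => ?_⟩,
    fun i => ?_⟩
  · obtain ⟨q, hq⟩ := hzx i hi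
    refine ⟨q * j' - ((N * j' / r x : ℕ) : ℤ) * a x i, ?_⟩
    linear_combination a x i * hdiv + (j' : ℤ) * hq
  · have h1 := hA j' hj' i
    have hdivR : (r x : ℝ) * ((N * j' / r x : ℕ) : ℝ) + ((N * j' % r x : ℕ) : ℝ) = N * j' := by
      exact_mod_cast hdiv
    rw [← abs_sub_round_add_int _ (((N * j' / r x : ℕ) : ℤ) * a x i)]
    have : ((N * j' % r x : ℕ) : ℝ) * (a x i : ℝ) / r x - s * c i +
        ((((N * j' / r x : ℕ) : ℤ) * a x i : ℤ) : ℝ) =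
        (j' : ℝ) * ((N * a x i : ℤ) : ℝ) / r x - s * c i := by
      simp only [Int.cast_mul, Int.cast_natCast]
      field_simp
      linear_combination (a x i : ℝ) * hdivR
    rw [this]
    exact h1

/-- The fractional part is discontinuous only at integers, which an irrational limit avoids. This is
why only irrational parameters are used on the line. -/
lemma tendsto_fract_of_tendsto {F : Filter ℕ} {u v : ℕ → ℝ} {h : ℝ} (hh : Irrational h)
    (hv : Tendsto v F (𝓝 h)) (huv : ∀ᶠ x in F, ∃ z : ℤ, u x = v x + z) :
    Tendsto (fun x => Int.fract (u x)) F (𝓝 (Int.fract h)) := by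
  have h1 : ContinuousAt Int.fract h := continuousAt_fract fun h0 => hh ⟨⌊h⌋, by
    push_cast; exact h0.symm⟩
  refine Tendsto.congr' ?_ (h1.tendsto.comp hv)
  filter_upwards [huv] with x ⟨z, hz⟩
  rw [hz, Function.comp_apply, Int.fract_add_intCast]

/-- The weight inequality in the limit along a line orthogonal to all relations. -/
theorem exists_limit_exponent {U : Ultrafilter ℕ} {k : ℕ} {r : ℕ → ℕ} {a : ℕ → Fin 4 → ℤ}
    {ε : Fin 4 → ℤ} {S : ℕ → Set (Fin 4 → ℕ)} (hr : Tendsto r U atTop)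
    (hadm : ∀ x, Admissible k (r x) (a x) ε (S x))
    {c : Fin 4 → ℤ} (hc : ∀ w ∈ relations U r a, ∑ i, w i * c i = 0)
    {N : ℕ} (hN : 0 < N) (hz : ∀ i, c i = 0 → ∀ᶠ x in U, (r x : ℤ) ∣ N * a x i)
    (ht : ∑ i, (1 - ε i) * c i ≠ 0) {s : ℝ} (hs : Irrational s) (b : Fin 4 → ℕ) :
    ∃ n : Fin 4 → ℕ, (∀ᶠ x in U, ∃ n' ∈ S x, ∀ i, c i ≠ 0 ∨ b i ≠ 0 → n' i = n i) ∧
      ∑ i, (n i : ℤ) * c i = ∑ i, ε i * c i ∧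
      ∑ i, (n i : ℝ) * (Int.fract (s * c i) + b i) + 1 +
        Int.fract (s * (∑ i, (1 - ε i) * c i : ℤ)) ≤ ∑ i, (Int.fract (s * c i) + b i) := by
  choose J hJ hJn using fun x => (hadm x).ineq b
  obtain ⟨j, hj, hlim⟩ := exists_seq_tendsto_zero (F := U)
    (P := fun x j => 0 < j ∧ j < r x ∧ j ∉ J x ∧ ∀ i, c i = 0 → (r x : ℤ) ∣ j * a x i)
    (M := fun x j => ∑ i, |(j * a x i / r x - s * c i : ℝ) -
      round (j * a x i / r x - s * c i : ℝ)|)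
    (fun x => (Set.finite_Iio (r x)).subset fun j hj => hj.2.1)
    (fun x j => Finset.sum_nonneg fun i _ => abs_nonneg _)
    (fun δ hδ => by
      filter_upwards [eventually_exists_near hr hc hN hz hJ s (by positivity : 0 < δ / 4)]
        with x ⟨j, hj, hn⟩
      refine ⟨j, hj, ?_⟩
      rw [Fin.sum_univ_four]
      linarith [hn 0, hn 1, hn 2, hn 3])
  let u : ℕ → Fin 4 → ℝ := fun x i => (j x : ℝ) * a x i / r x
  let v : ℕ → Fin 4 → ℝ := fun x i => u x i - round (u x i - s * c i)
  have hv : ∀ i, Tendsto (fun x => v x i) U (𝓝 (s * c i)) := by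
    intro i
    rw [tendsto_iff_dist_tendsto_zero]
    refine squeeze_zero (fun x => dist_nonneg) (fun x => ?_) hlim
    have h1 := Finset.single_le_sum
      (f := fun i => |(j x * a x i / r x - s * c i : ℝ) - round (j x * a x i / r x - s * c i : ℝ)|)
      (fun i _ => abs_nonneg _) (Finset.mem_univ i)
    refine le_trans (le_of_eq ?_) h1
    rw [Real.dist_eq]
    congr 1
    simp only [v, u]
    ring
  have hsz : ∀ z : ℤ, z ≠ 0 → Irrational (s * z) := fun z hz0 => hs.mul_intCast hz0
  let α : Fin 4 → ℝ := fun i => Int.fract (s * c i) + b i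
  have hα : ∀ i, Tendsto (fun x => Int.fract (u x i) + (b i : ℝ)) U (𝓝 (α i)) := by
    intro i
    refine Tendsto.add_const _ ?_
    by_cases hi : c i = 0
    · rw [hi]; simp only [Int.cast_zero, mul_zero, Int.fract_zero]
      refine tendsto_const_nhds.congr' ?_
      filter_upwards [hj] with x hx
      obtain ⟨q, hq⟩ := hx.2.2.2 i hi
      have hr0 : (r x : ℝ) ≠ 0 := by have := (hadm x).r_pos; positivity
      have hqR : (j x : ℝ) * a x i = r x * q := by exact_mod_cast hq
      simp only [u]
      rw [hqR, mul_div_cancel_left₀ _ hr0, Int.fract_intCast]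
    · exact tendsto_fract_of_tendsto (hsz _ hi) (hv i) (Eventually.of_forall fun x =>
        ⟨round (u x i - s * c i), by simp only [v]; ring⟩)
  set τ : ℤ := ∑ i, (1 - ε i) * c i with hτ
  -- As `∑ (1 - εᵢ) aᵢ ≡ 1` modulo `r`, the number `j/r` agrees modulo `1` with the value of this
  -- form at the approximating point.
  have htlim : Tendsto (fun x => (j x : ℝ) / r x) U (𝓝 (Int.fract (s * τ))) := by
    have h1 : Tendsto (fun x => ∑ i, ((1 - ε i : ℤ) : ℝ) * v x i) U (𝓝 (s * τ)) := by
      have : s * (τ : ℝ) = ∑ i, ((1 - ε i : ℤ) : ℝ) * (s * c i) := by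
        rw [hτ]; push_cast; rw [Finset.mul_sum]
        exact Finset.sum_congr rfl fun i _ => by ring
      rw [this]
      exact tendsto_finsetSum _ fun i _ => (hv i).const_mul _
    have h2 := tendsto_fract_of_tendsto (u := fun x => (j x : ℝ) / r x) (hsz _ ht) h1
      (Eventually.of_forall fun x => by
        obtain ⟨q, hq⟩ := (hadm x).wt
        have hr0 : (r x : ℝ) ≠ 0 := by have := (hadm x).r_pos; positivity
        refine ⟨∑ i, (1 - ε i) * round (u x i - s * c i) - j x * q, ?_⟩
        have hqR : ∑ i, ((1 - ε i : ℤ) : ℝ) * a x i - 1 = r x * q := by exact_mod_cast hq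
        have h3 : ∑ i, ((1 - ε i : ℤ) : ℝ) * v x i = (j x : ℝ) / r x *
            ∑ i, ((1 - ε i : ℤ) : ℝ) * a x i -
              ∑ i, ((1 - ε i : ℤ) : ℝ) * round (u x i - s * c i) := by
          rw [Finset.mul_sum, ← Finset.sum_sub_distrib]
          exact Finset.sum_congr rfl fun i _ => by simp only [v, u]; ring
        rw [h3, show ∑ i, ((1 - ε i : ℤ) : ℝ) * a x i = 1 + r x * q by linarith]
        simp only [Int.cast_sub, Int.cast_sum, Int.cast_mul, Int.cast_natCast]
        field_simp
        ring)
    refine h2.congr' ?_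
    filter_upwards [hj] with x hx
    have hr0 : (0 : ℝ) < r x := by have := (hadm x).r_pos; positivity
    have : (j x : ℝ) < r x := by exact_mod_cast hx.2.1
    exact Int.fract_eq_self.2 ⟨by positivity, by rwa [div_lt_one hr0]⟩
  have hex : ∀ x, ∃ n, 0 < j x ∧ j x < r x ∧ j x ∉ J x → n ∈ S x ∧
      ∑ i, (n i : ℝ) * (Int.fract (u x i) + b i) + 1 + (j x : ℝ) / r x
      ≤ ∑ i, (Int.fract (u x i) + b i) := fun x => by
    by_cases h : 0 < j x ∧ j x < r x ∧ j x ∉ J x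
    · obtain ⟨n, hn, hle⟩ := hJn x (j x) h.1 h.2.1 h.2.2
      exact ⟨n, fun _ => ⟨hn, hle⟩⟩
    · exact ⟨0, fun h' => absurd h' h⟩
  choose n hn using hex
  have hnj : ∀ᶠ x in U, n x ∈ S x ∧ ∑ i, (n x i : ℝ) * (Int.fract (u x i) + b i) + 1 +
      (j x : ℝ) / r x ≤ ∑ i, (Int.fract (u x i) + b i) := by
    filter_upwards [hj] with x hx using hn x ⟨hx.1, hx.2.1, hx.2.2.1⟩
  have hαpos : ∀ i, c i ≠ 0 ∨ b i ≠ 0 → 0 < α i := by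
    rintro i (hi | hi)
    · have h1 : Int.fract (s * c i) ≠ 0 := fun h0 => by
        rw [Int.fract_eq_iff] at h0
        obtain ⟨-, -, z, hz⟩ := h0
        exact hsz _ hi ⟨z, by push_cast; linarith⟩
      have h2 := Int.fract_nonneg (s * (c i : ℝ))
      have h3 : 0 < Int.fract (s * (c i : ℝ)) := lt_of_le_of_ne h2 h1.symm
      simp only [α]; positivity
    · have h2 := Int.fract_nonneg (s * (c i : ℝ))
      have : 0 < b i := Nat.pos_of_ne_zero hi
      simp only [α]; positivity
  set B : ℝ := ∑ i, (1 + b i : ℝ) with hB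
  -- A coordinate with positive limiting weight has bounded exponent, because the right-hand side of
  -- the inequality is at most `B`.
  have hbd : ∀ i, ∃ K : ℕ, c i ≠ 0 ∨ b i ≠ 0 → ∀ᶠ x in U, n x i ≤ K := by
    intro i
    obtain ⟨K, hK⟩ := exists_nat_ge (B / (α i / 2))
    refine ⟨K, fun hi => ?_⟩
    have hpos := hαpos i hi
    filter_upwards [(hα i).eventually (lt_mem_nhds (half_lt_self hpos)), hnj] with x hx hx2
    have hterm : ∀ i, 0 ≤ (n x i : ℝ) * (Int.fract (u x i) + b i) := fun i =>
      mul_nonneg (by positivity) (add_nonneg (Int.fract_nonneg _) (by positivity))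
    have h1 := Finset.single_le_sum (fun i _ => hterm i) (Finset.mem_univ i)
    have h2 : ∑ i, (Int.fract (u x i) + b i : ℝ) ≤ B := by
      refine Finset.sum_le_sum fun i _ => ?_
      have := (Int.fract_lt_one (u x i)).le
      linarith
    have h3 : (0 : ℝ) ≤ (j x : ℝ) / r x := by positivity
    have h4 : (n x i : ℝ) * (α i / 2) ≤ (n x i : ℝ) * (Int.fract (u x i) + b i) := by gcongr
    have h5 : (n x i : ℝ) ≤ B / (α i / 2) := by
      rw [le_div_iff₀ (by positivity)]; linarith [hx2.2]
    exact_mod_cast h5.trans hK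
  choose K hK using hbd
  classical
  -- Exponents of variables of limiting weight `0` are not controlled. They are replaced by `0`,
  -- which does not affect the limiting inequality; finitely many vectors remain and the ultrafilter
  -- selects one.
  let m : ℕ → Fin 4 → ℕ := fun x i => if c i ≠ 0 ∨ b i ≠ 0 then n x i else 0
  have hmK : ∀ᶠ x in U, ∃ n' ∈ Set.Icc (0 : Fin 4 → ℕ) K, m x = n' := by
    have : ∀ᶠ x in U, ∀ i, c i ≠ 0 ∨ b i ≠ 0 → n x i ≤ K i := by
      rw [Filter.eventually_all]
      intro i
      by_cases hi : c i ≠ 0 ∨ b i ≠ 0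
      · filter_upwards [hK i hi] with x hx _ using hx
      · exact Eventually.of_forall fun x h => absurd h hi
    filter_upwards [this] with x hx
    refine ⟨m x, ⟨fun i => Nat.zero_le _, fun i => ?_⟩, rfl⟩
    simp only [m]
    split_ifs with h
    · exact hx i h
    · exact Nat.zero_le _
  rw [Ultrafilter.eventually_exists_mem_iff (Set.finite_Icc _ _)] at hmK
  obtain ⟨n', -, hn'⟩ := hmK
  refine ⟨n', ?_, ?_, ?_⟩
  · filter_upwards [hn', hnj] with x hx hx2
    refine ⟨n x, hx2.1, fun i hi => ?_⟩
    rw [← hx]; simp only [m, if_pos hi]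
  -- The factor `N` absorbs the coordinates replaced by `0`, so that the difference between the
  -- selected exponent and `ε` becomes a relation, orthogonal to `c`.
  · have hmem : (fun i => (N : ℤ) * ((n' i : ℤ) - ε i)) ∈ relations U r a := by
      rw [mem_relations]
      have hz' : ∀ᶠ x in U, ∀ i, c i = 0 → (r x : ℤ) ∣ N * a x i := by
        rw [Filter.eventually_all]
        intro i
        by_cases hi : c i = 0
        · filter_upwards [hz i hi] with x hx _ using hx
        · exact Eventually.of_forall fun x h => absurd h hi
      filter_upwards [hn', hnj, hz'] with x hx hx2 hzx
      have h1 := (hadm x).semi _ hx2.1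
      have h2 : ∑ i, (N : ℤ) * ((n' i : ℤ) - ε i) * a x i =
          N * ∑ i, ((n x i : ℤ) - ε i) * a x i + ∑ i, ((n' i : ℤ) - n x i) * (N * a x i) := by
        rw [Finset.mul_sum, ← Finset.sum_add_distrib]
        exact Finset.sum_congr rfl fun i _ => by ring
      rw [h2]
      refine Int.dvd_add (Dvd.dvd.mul_left h1 _) (Finset.dvd_sum fun i _ => ?_)
      by_cases hi : c i ≠ 0 ∨ b i ≠ 0
      · have : n' i = n x i := by rw [← hx]; simp only [m, if_pos hi]
        rw [this]; simp
      · push Not at hi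
        exact Dvd.dvd.mul_left (hzx i hi.1) _
    have h0 := hc _ hmem
    have h1 : (N : ℤ) * (∑ i, (n' i : ℤ) * c i - ∑ i, ε i * c i) = 0 := by
      rw [← h0, ← Finset.sum_sub_distrib, Finset.mul_sum]
      exact Finset.sum_congr rfl fun i _ => by ring
    rcases mul_eq_zero.1 h1 with h | h
    · omega
    · linarith
  · have l1 : Tendsto (fun x => ∑ i, (n' i : ℝ) * (Int.fract (u x i) + b i) + 1 + (j x : ℝ) / r x) U
        (𝓝 (∑ i, (n' i : ℝ) * α i + 1 + Int.fract (s * τ))) :=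
      ((tendsto_finsetSum _ fun i _ => (hα i).const_mul _).add_const 1).add htlim
    have l2 : Tendsto (fun x => ∑ i, (Int.fract (u x i) + b i : ℝ)) U (𝓝 (∑ i, α i)) :=
      tendsto_finsetSum _ fun i _ => hα i
    refine le_of_tendsto_of_tendsto l1 l2 ?_
    filter_upwards [hn', hnj] with x hx hx2
    refine le_trans ?_ hx2.2
    gcongr with i
    rw [← hx]; simp only [m]
    split_ifs
    · exact le_rfl
    · exact Nat.zero_le _

/-! ### Floor sums and the pairing of weights. -/

lemma floor_neg_of_irrational {u : ℝ} (hu : Irrational u) : ⌊-u⌋ = -⌊u⌋ - 1 := by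
  rw [Int.floor_eq_iff]
  have h1 := Int.floor_le u
  have h2 := Int.lt_floor_add_one u
  have h3 : (⌊u⌋ : ℝ) ≠ u := fun h => hu ⟨⌊u⌋, by push_cast; exact h⟩
  have h4 : (⌊u⌋ : ℝ) < u := lt_of_le_of_ne h1 h3
  push_cast
  constructor <;> linarith

lemma floor_neg_mul {s : ℝ} (hs : Irrational s) {c : ℤ} (hc : c ≠ 0) :
    ⌊-s * (c : ℝ)⌋ = -⌊s * (c : ℝ)⌋ - 1 := by
  rw [neg_mul]; exact floor_neg_of_irrational (hs.mul_intCast hc)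

lemma floor_mul_neg {s : ℝ} (hs : Irrational s) {c : ℤ} (hc : c ≠ 0) :
    ⌊s * ((-c : ℤ) : ℝ)⌋ = -⌊s * (c : ℝ)⌋ - 1 := by
  rw [Int.cast_neg, mul_neg]; exact floor_neg_of_irrational (hs.mul_intCast hc)

lemma exists_irrational_small {x : ℝ} (hx : 0 < x) : ∃ s : ℝ, Irrational s ∧ 0 < s ∧ s < x := by
  obtain ⟨s, hs, h1, h2⟩ := exists_irrational_btwn hx
  exact ⟨s, hs, h1, h2⟩

lemma floor_mul_small {s : ℝ} (h0 : 0 < s) {z : ℤ} (h : s * |(z : ℝ)| < 1) :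
    ⌊s * (z : ℝ)⌋ = if z < 0 then -1 else 0 := by
  split_ifs with hz
  · have hzR : (z : ℝ) < 0 := by exact_mod_cast hz
    rw [abs_of_neg hzR] at h
    rw [Int.floor_eq_iff]
    push_cast
    constructor <;> nlinarith
  · have hzR : (0 : ℝ) ≤ z := by exact_mod_cast not_lt.1 hz
    rw [abs_of_nonneg hzR] at h
    rw [Int.floor_eq_iff]
    push_cast
    constructor <;> nlinarith

/-- The jump of `⌊s z⌋` at `s = 1 / d`. -/
lemma floor_jump {d : ℕ} (hd : 0 < d) {η : ℝ} (hη : 0 < η) (z : ℤ) (h : d * (η * |(z : ℝ)|) < 1) :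
    ⌊(1 / d + η) * (z : ℝ)⌋ - ⌊(1 / d - η) * (z : ℝ)⌋ = if (d : ℤ) ∣ z then z.sign else 0 := by
  have hdR : (0 : ℝ) < d := by exact_mod_cast hd
  have hd1 : (1 : ℝ) ≤ d := by exact_mod_cast hd
  have hz1 : η * |(z : ℝ)| < 1 := by
    have : 0 ≤ η * |(z : ℝ)| := by positivity
    nlinarith
  split_ifs with hdz
  · obtain ⟨q, hq⟩ := hdz
    have hqR : (z : ℝ) = d * q := by exact_mod_cast hq
    have e1 : (1 / d + η) * (z : ℝ) = q + η * z := by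
      rw [add_mul]; congr 1; rw [hqR]; field_simp
    have e2 : (1 / d - η) * (z : ℝ) = q + η * ((-z : ℤ) : ℝ) := by
      push_cast; rw [sub_mul, mul_neg, ← sub_eq_add_neg]; congr 1; rw [hqR]; field_simp
    rw [e1, e2, Int.floor_intCast_add, Int.floor_intCast_add, floor_mul_small hη hz1,
      floor_mul_small hη (by push_cast; rwa [abs_neg])]
    rcases lt_trichotomy z 0 with h0 | h0 | h0
    · rw [Int.sign_eq_neg_one_of_neg h0, if_pos h0, if_neg (by omega)]; ring
    · simp [h0]
    · rw [Int.sign_eq_one_of_pos h0, if_neg (by omega), if_pos (by omega)]; ring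
  · have hm0 : 0 < z % d := lt_of_le_of_ne (Int.emod_nonneg _ (by omega)) fun h0 =>
      hdz (Int.dvd_of_emod_eq_zero h0.symm)
    have hm1 : z % d + 1 ≤ d := Int.emod_lt_of_pos z (by omega)
    have hm0R : (1 : ℝ) ≤ ((z % d : ℤ) : ℝ) := by exact_mod_cast hm0
    have hm1R : ((z % d : ℤ) : ℝ) + 1 ≤ d := by exact_mod_cast hm1
    have hdec : (z : ℝ) = d * ((z / d : ℤ) : ℝ) + ((z % d : ℤ) : ℝ) := by
      exact_mod_cast (Int.mul_ediv_add_emod z d).symm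
    have hdiv : (z : ℝ) / d = ((z / d : ℤ) : ℝ) + ((z % d : ℤ) : ℝ) / d := by
      rw [hdec]; field_simp
    have habs := abs_le.1 (le_refl |(z : ℝ)|)
    have hlo : η * |(z : ℝ)| < ((z % d : ℤ) : ℝ) / d := by
      rw [lt_div_iff₀ hdR]; nlinarith
    have hhi : ((z % d : ℤ) : ℝ) / d + η * |(z : ℝ)| < 1 := by
      have : ((z % d : ℤ) : ℝ) / d ≤ 1 - 1 / d := by
        rw [div_le_iff₀ hdR]; field_simp; linarith
      have h3 : η * |(z : ℝ)| < 1 / d := by rw [lt_div_iff₀ hdR]; linarith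
      linarith
    have hup : η * z ≤ η * |(z : ℝ)| := by gcongr; exact habs.2
    have hdn : -(η * |(z : ℝ)|) ≤ η * z := by nlinarith [habs.1]
    have f1 : ⌊(1 / d + η) * (z : ℝ)⌋ = z / d := by
      rw [Int.floor_eq_iff, show (1 / d + η) * (z : ℝ) = z / d + η * z by ring, hdiv]
      constructor <;> linarith
    have f2 : ⌊(1 / d - η) * (z : ℝ)⌋ = z / d := by
      rw [Int.floor_eq_iff, show (1 / d - η) * (z : ℝ) = z / d - η * z by ring, hdiv]
      constructor <;> linarith
    rw [f1, f2, sub_self]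

section Pairing

variable {ι : Type*} [Fintype ι] {z : ι → ℤ} {C : ℤ}

/-- This is the total jump of the constant sum across `s = 1/d`, read off at `1/d ± η` with `η` a
small irrational number. -/
lemma sum_sign_dvd_eq_zero (h : ∀ s : ℝ, Irrational s → ∑ i, ⌊s * (z i : ℝ)⌋ = C) {d : ℕ}
    (hd : 0 < d) : ∑ i, (if (d : ℤ) ∣ z i then (z i).sign else 0) = 0 := by
  have hdR : (0 : ℝ) < d := by exact_mod_cast hd
  set B : ℝ := 1 + ∑ i, |(z i : ℝ)| with hB
  have hB0 : 0 < B := by positivity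
  obtain ⟨η, hη, h0, h1⟩ := exists_irrational_small (x := 1 / (d * B)) (by positivity)
  have hi1 : Irrational (1 / d + η) := by
    have := hη.ratCast_add (1 / d : ℚ); push_cast at this; exact this
  have hi2 : Irrational (1 / d - η) := by
    have := hη.ratCast_sub (1 / d : ℚ); push_cast at this; exact this
  have h2 := h _ hi1
  have h3 := h _ hi2
  have h4 : ∑ i, (⌊(1 / d + η) * (z i : ℝ)⌋ - ⌊(1 / d - η) * (z i : ℝ)⌋) = 0 := by
    rw [Finset.sum_sub_distrib, h2, h3, sub_self]
  refine (Finset.sum_congr rfl fun i _ => (floor_jump hd h0 (z i) ?_).symm).trans h4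
  rw [lt_div_iff₀ (by positivity)] at h1
  have h5 : |(z i : ℝ)| ≤ B := by
    have := Finset.single_le_sum (f := fun i => |(z i : ℝ)|) (fun i _ => abs_nonneg _)
      (Finset.mem_univ i)
    linarith
  calc (d : ℝ) * (η * |(z i : ℝ)|) ≤ d * (η * B) := by gcongr
    _ = η * (d * B) := by ring
    _ < 1 := h1

lemma sum_sign_natAbs_eq_zero (h : ∀ s : ℝ, Irrational s → ∑ i, ⌊s * (z i : ℝ)⌋ = C) {d : ℕ}
    (hd : 0 < d) : ∑ i, (if (z i).natAbs = d then (z i).sign else 0) = 0 := by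
  set B : ℕ := ∑ i, (z i).natAbs with hB
  have hle : ∀ i, (z i).natAbs ≤ B := fun i =>
    Finset.single_le_sum (f := fun i => (z i).natAbs) (fun i _ => Nat.zero_le _) (Finset.mem_univ i)
  induction hk : B + 1 - d using Nat.strong_induction_on generalizing d with
  -- Downward induction on `d`: the `zᵢ` divisible by `d` are those of absolute value `d`, whose
  -- signed count is sought, and those of larger multiples, already balanced. Above `B` nothing
  -- remains.
  | _ k ih =>
  by_cases hdB : B < d
  · refine Finset.sum_eq_zero fun i _ => if_neg ?_
    have := hle i; omega
  have h0 := sum_sign_dvd_eq_zero h hd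
  have h1 : ∑ i, (if (d : ℤ) ∣ z i then (z i).sign else 0) =
      ∑ D ∈ Finset.Icc 1 B, if d ∣ D then
        ∑ i, (if (z i).natAbs = D then (z i).sign else 0) else 0 := by
    have : ∀ i, (if (d : ℤ) ∣ z i then (z i).sign else 0) =
        ∑ D ∈ Finset.Icc 1 B, if d ∣ D then
          (if (z i).natAbs = D then (z i).sign else 0) else 0 := by
      intro i
      by_cases hz : z i = 0
      · simp [hz]
      · rw [Finset.sum_eq_single_of_mem (z i).natAbs
          (Finset.mem_Icc.2 ⟨Int.natAbs_pos.2 hz, hle i⟩)]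
        · simp [Int.natCast_dvd]
        · intro D _ hD
          simp [Ne.symm hD]
    rw [Finset.sum_congr rfl fun i _ => this i, Finset.sum_comm]
    refine Finset.sum_congr rfl fun D _ => ?_
    split_ifs <;> simp
  rw [h1, Finset.sum_eq_single_of_mem d (Finset.mem_Icc.2 ⟨hd, by omega⟩)] at h0
  · simpa using h0
  · intro D hD hne
    split_ifs with hdD
    · have hD1 := (Finset.mem_Icc.1 hD).1
      have := Nat.le_of_dvd hD1 hdD
      exact ih (B + 1 - D) (by omega) hD1 rfl
    · rfl

/-- If a sum of functions `⌊s zᵢ⌋` is constant, then the non-zero `zᵢ` occur in opposite pairs. -/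
lemma exists_eq_neg_of_sum_floor_const
    (h : ∀ s : ℝ, Irrational s → ∑ i, ⌊s * (z i : ℝ)⌋ = C) {i : ι} (hi : z i ≠ 0) :
    ∃ j, z j = -z i := by
  by_contra hcon
  push Not at hcon
  have h0 := sum_sign_natAbs_eq_zero h (Int.natAbs_pos.2 hi)
  -- Without an opposite of `zᵢ`, all entries of the same absolute value have the same sign and
  -- cannot cancel.
  have h1 : ∑ j, (if (z j).natAbs = (z i).natAbs then (z j).sign * (z i).sign else 0) = 0 := by
    have := congrArg (· * (z i).sign) h0
    simpa [Finset.sum_mul, ite_mul] using this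
  have hnn : ∀ j ∈ Finset.univ, 0 ≤
      (if (z j).natAbs = (z i).natAbs then (z j).sign * (z i).sign else 0) := by
    intro j _
    split_ifs with hj
    · rcases Int.natAbs_eq_natAbs_iff.1 hj with h | h
      · rw [h]; exact mul_self_nonneg _
      · exact absurd h (hcon j)
    · exact le_rfl
  have h2 := (Finset.sum_eq_zero_iff_of_nonneg hnn).1 h1 i (Finset.mem_univ i)
  simp [hi] at h2

end Pairing

/-- The pairing of the weights of the four variables with those of the equation and of the
generator. -/
lemma floor_eq_and_exists_neg {c₁ c₂ c₃ c₄ e t : ℤ} (h1 : c₁ ≠ 0) (h2 : c₂ ≠ 0) (h3 : c₃ ≠ 0)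
    (h4 : c₄ ≠ 0) (he : e ≠ 0) (ht : t ≠ 0)
    (H : ∀ s : ℝ, Irrational s → ⌊s * (c₁ : ℝ)⌋ + ⌊s * (c₂ : ℝ)⌋ + ⌊s * (c₃ : ℝ)⌋ +
      ⌊s * (c₄ : ℝ)⌋ + 1 ≤ ⌊s * (t : ℝ)⌋ + ⌊s * (e : ℝ)⌋) :
    (∀ s : ℝ, Irrational s → ⌊s * (c₁ : ℝ)⌋ + ⌊s * (c₂ : ℝ)⌋ + ⌊s * (c₃ : ℝ)⌋ +
      ⌊s * (c₄ : ℝ)⌋ + 1 = ⌊s * (t : ℝ)⌋ + ⌊s * (e : ℝ)⌋) ∧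
    ∀ v, v = c₁ ∨ v = c₂ ∨ v = c₃ ∨ v = c₄ ∨ v = -e ∨ v = -t →
      c₁ = -v ∨ c₂ = -v ∨ c₃ = -v ∨ c₄ = -v ∨ -e = -v ∨ -t = -v := by
  have heq : ∀ s : ℝ, Irrational s → ⌊s * (c₁ : ℝ)⌋ + ⌊s * (c₂ : ℝ)⌋ + ⌊s * (c₃ : ℝ)⌋ +
      ⌊s * (c₄ : ℝ)⌋ + 1 = ⌊s * (t : ℝ)⌋ + ⌊s * (e : ℝ)⌋ := by
    intro s hs
    have ha := H s hs
    -- Reflection turns each floor into `-⌊·⌋ - 1`. With four floors on the left and two on the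
    -- right, the constants combine to the reverse inequality.
    have hb := H (-s) hs.neg
    simp only [floor_neg_mul hs h1, floor_neg_mul hs h2, floor_neg_mul hs h3, floor_neg_mul hs h4,
      floor_neg_mul hs he, floor_neg_mul hs ht] at hb
    omega
  refine ⟨heq, fun v hv => ?_⟩
  have hconst : ∀ s : ℝ, Irrational s →
      ∑ i, ⌊s * ((![c₁, c₂, c₃, c₄, -e, -t] i : ℤ) : ℝ)⌋ = -3 := by
    intro s hs
    have h := heq s hs
    have e1 := floor_mul_neg hs he
    have e2 := floor_mul_neg hs ht
    simp only [Fin.sum_univ_six, Matrix.cons_val]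
    omega
  obtain ⟨i, hi⟩ : ∃ i : Fin 6, ![c₁, c₂, c₃, c₄, -e, -t] i = v := by
    rcases hv with h | h | h | h | h | h
    exacts [⟨0, h.symm⟩, ⟨1, h.symm⟩, ⟨2, h.symm⟩, ⟨3, h.symm⟩, ⟨4, h.symm⟩, ⟨5, h.symm⟩]
  have hv0 : v ≠ 0 := by omega
  obtain ⟨j, hj⟩ := exists_eq_neg_of_sum_floor_const hconst (i := i) (by rw [hi]; exact hv0)
  rw [hi] at hj
  fin_cases j
  exacts [Or.inl hj, Or.inr (Or.inl hj), Or.inr (Or.inr (Or.inl hj)),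
    Or.inr (Or.inr (Or.inr (Or.inl hj))), Or.inr (Or.inr (Or.inr (Or.inr (Or.inl hj)))),
    Or.inr (Or.inr (Or.inr (Or.inr (Or.inr hj))))]

lemma floor_add_floor_eq_or {s : ℝ} (c d : ℤ) :
    ⌊s * ((c + d : ℤ) : ℝ)⌋ = ⌊s * (c : ℝ)⌋ + ⌊s * (d : ℝ)⌋ ∨
      ⌊s * ((c + d : ℤ) : ℝ)⌋ = ⌊s * (c : ℝ)⌋ + ⌊s * (d : ℝ)⌋ + 1 := by
  have h1 := Int.le_floor_add (s * (c : ℝ)) (s * (d : ℝ))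
  have h2 := Int.le_floor_add_floor (s * (c : ℝ)) (s * (d : ℝ))
  rw [← mul_add, ← Int.cast_add] at h1 h2
  omega

lemma floor_lt_of_irrational {s : ℝ} (hs : Irrational s) {c : ℤ} (hc : c ≠ 0) :
    (⌊s * (c : ℝ)⌋ : ℝ) < s * c :=
  lt_of_le_of_ne (Int.floor_le _) fun h => hs.mul_intCast hc ⟨⌊s * (c : ℝ)⌋, by push_cast; exact h⟩

/-- An irrational number which is small with respect to six given integers. -/
lemma exists_irrational_floor_small (z₁ z₂ z₃ z₄ z₅ z₆ : ℤ) :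
    ∃ s : ℝ, Irrational s ∧ ∀ z, z = z₁ ∨ z = z₂ ∨ z = z₃ ∨ z = z₄ ∨ z = z₅ ∨ z = z₆ →
      ⌊s * (z : ℝ)⌋ = if z < 0 then -1 else 0 := by
  set B : ℝ := 1 + |(z₁ : ℝ)| + |(z₂ : ℝ)| + |(z₃ : ℝ)| + |(z₄ : ℝ)| + |(z₅ : ℝ)| + |(z₆ : ℝ)|
    with hB
  have hB0 : 0 < B := by positivity
  obtain ⟨s, hs, h0, h1⟩ := exists_irrational_small (x := 1 / B) (by positivity)
  refine ⟨s, hs, fun z hz => floor_mul_small h0 ?_⟩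
  rw [lt_div_iff₀ hB0] at h1
  have : |(z : ℝ)| ≤ B := by
    have := abs_nonneg (z₁ : ℝ); have := abs_nonneg (z₂ : ℝ); have := abs_nonneg (z₃ : ℝ)
    have := abs_nonneg (z₄ : ℝ); have := abs_nonneg (z₅ : ℝ); have := abs_nonneg (z₆ : ℝ)
    rcases hz with rfl | rfl | rfl | rfl | rfl | rfl <;> linarith
  nlinarith

lemma exists_irrational_scaled {g : ℤ} (hg : 0 < g) {x y : ℝ} (hxy : x < y) :
    ∃ s : ℝ, Irrational s ∧ x < s * g ∧ s * g < y := by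
  have hgR : (0 : ℝ) < g := by exact_mod_cast hg
  obtain ⟨s, hs, h1, h2⟩ := exists_irrational_btwn (div_lt_div_of_pos_right hxy hgR)
  exact ⟨s, hs, by rwa [div_lt_iff₀ hgR] at h1, by rwa [lt_div_iff₀ hgR] at h2⟩

/-! ### Lines for the cA type. -/

/-- The weight inequalities along a line for the type `x₁x₂ + g(x₃, x₄)`. -/
def CALine (c₁ c₂ c₃ c₄ : ℤ) : Prop := ∀ s : ℝ, Irrational s →
  ⌊s * (c₃ : ℝ)⌋ + ⌊s * (c₄ : ℝ)⌋ + 1 ≤ ⌊s * ((c₃ + c₄ : ℤ) : ℝ)⌋ ∨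
  ∃ p q : ℕ, 2 ≤ p + q ∧ p * c₃ + q * c₄ = c₁ + c₂ ∧
    ⌊s * (c₁ : ℝ)⌋ + ⌊s * (c₂ : ℝ)⌋ + ⌊s * (c₃ : ℝ)⌋ + ⌊s * (c₄ : ℝ)⌋ + 1 ≤
      ⌊s * ((c₃ + c₄ : ℤ) : ℝ)⌋ + p * ⌊s * (c₃ : ℝ)⌋ + q * ⌊s * (c₄ : ℝ)⌋

lemma CALine.swap_left {c₁ c₂ c₃ c₄ : ℤ} (h : CALine c₁ c₂ c₃ c₄) : CALine c₂ c₁ c₃ c₄ := by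
  intro s hs
  rcases h s hs with h | ⟨p, q, h1, h2, h3⟩
  · exact Or.inl h
  · exact Or.inr ⟨p, q, h1, by linarith, by linarith⟩

lemma CALine.swap_right {c₁ c₂ c₃ c₄ : ℤ} (h : CALine c₁ c₂ c₃ c₄) : CALine c₁ c₂ c₄ c₃ := by
  intro s hs
  rw [add_comm c₄ c₃]
  rcases h s hs with h | ⟨p, q, h1, h2, h3⟩
  · exact Or.inl (by linarith)
  · exact Or.inr ⟨q, p, by omega, by linarith, by linarith⟩

lemma CALine.neg {c₁ c₂ c₃ c₄ : ℤ} (h : CALine c₁ c₂ c₃ c₄) :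
    CALine (-c₁) (-c₂) (-c₃) (-c₄) := by
  intro s hs
  have key : ∀ c : ℤ, s * ((-c : ℤ) : ℝ) = -s * (c : ℝ) := fun c => by push_cast; ring
  rw [← neg_add c₃ c₄, key, key, key, key, key]
  rcases h (-s) hs.neg with h | ⟨p, q, h1, h2, h3⟩
  · exact Or.inl h
  · exact Or.inr ⟨p, q, h1, by linarith, h3⟩

/-- Superadditivity of the floor replaces the unknown monomial by the weight `c₁ + c₂` of the
equation, giving an inequality to which the pairing applies. -/
lemma CALine.floor_le {c₁ c₂ c₃ c₄ : ℤ} (h : CALine c₁ c₂ c₃ c₄) (s : ℝ) (hs : Irrational s) :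
    ⌊s * (c₁ : ℝ)⌋ + ⌊s * (c₂ : ℝ)⌋ + ⌊s * (c₃ : ℝ)⌋ + ⌊s * (c₄ : ℝ)⌋ + 1 ≤
      ⌊s * ((c₃ + c₄ : ℤ) : ℝ)⌋ + ⌊s * ((c₁ + c₂ : ℤ) : ℝ)⌋ := by
  rcases h s hs with h | ⟨p, q, -, h2, h3⟩
  · rcases floor_add_floor_eq_or (s := s) c₁ c₂ with h1 | h1 <;> omega
  · have : (p : ℤ) * ⌊s * (c₃ : ℝ)⌋ + q * ⌊s * (c₄ : ℝ)⌋ ≤ ⌊s * ((c₁ + c₂ : ℤ) : ℝ)⌋ := by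
      rw [Int.le_floor, ← h2]
      push_cast
      have a3 := Int.floor_le (s * (c₃ : ℝ))
      have a4 := Int.floor_le (s * (c₄ : ℝ))
      have b3 : (p : ℝ) * ⌊s * (c₃ : ℝ)⌋ ≤ p * (s * c₃) := by gcongr
      have b4 : (q : ℝ) * ⌊s * (c₄ : ℝ)⌋ ≤ q * (s * c₄) := by gcongr
      linarith
    omega

/-- One of `√2`, `-√2` makes the floor additive on `c₃, c₄`, which rules out `x₁x₂`. Any other
monomial has weight `0`, yet its floor sum is strictly below `0`, while the inequality asks for a
non-negative one. -/
lemma not_CALine_of_add_eq_zero {c₁ c₂ c₃ c₄ : ℤ} (h1 : c₁ ≠ 0) (h3 : c₃ ≠ 0) (h4 : c₄ ≠ 0)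
    (ht : c₃ + c₄ ≠ 0) (he : c₁ + c₂ = 0) : ¬ CALine c₁ c₂ c₃ c₄ := by
  intro h
  obtain ⟨s, hs, hns⟩ : ∃ s : ℝ, Irrational s ∧
      ⌊s * ((c₃ + c₄ : ℤ) : ℝ)⌋ = ⌊s * (c₃ : ℝ)⌋ + ⌊s * (c₄ : ℝ)⌋ := by
    have hs := irrational_sqrt_two
    rcases floor_add_floor_eq_or (s := √2) c₃ c₄ with h | h
    · exact ⟨_, hs, h⟩
    · refine ⟨_, hs.neg, ?_⟩
      rw [floor_neg_mul hs ht, floor_neg_mul hs h3, floor_neg_mul hs h4, h]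
      ring
  have h2 : c₂ = -c₁ := by omega
  have e2 := floor_mul_neg hs h1
  rw [← h2] at e2
  rcases h s hs with h | ⟨p, q, hpq, hc, hle⟩
  · omega
  · have hge : 0 ≤ (p : ℤ) * ⌊s * (c₃ : ℝ)⌋ + q * ⌊s * (c₄ : ℝ)⌋ := by omega
    have hgeR : (0 : ℝ) ≤ p * ⌊s * (c₃ : ℝ)⌋ + q * ⌊s * (c₄ : ℝ)⌋ := by exact_mod_cast hge
    have hcR : (p : ℝ) * c₃ + q * c₄ = 0 := by rw [he] at hc; exact_mod_cast hc
    have a3 := floor_lt_of_irrational hs h3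
    have a4 := floor_lt_of_irrational hs h4
    have hp : (0 : ℝ) ≤ p := by positivity
    have hq : (0 : ℝ) ≤ q := by positivity
    have hpqR : (2 : ℝ) ≤ p + q := by exact_mod_cast hpq
    have hs0 : (p : ℝ) * (s * c₃) + q * (s * c₄) = 0 := by linear_combination s * hcR
    rcases hp.eq_or_lt with hp0 | hp0
    · nlinarith
    · nlinarith

/-- The case where `x₁` and `x₂` have weights of opposite signs and `x₃` has weight opposite to
`x₁` is contradictory. -/
lemma not_CALine_opposite {g : ℤ} (hg : 0 < g) {q : ℕ} (hq : 2 ≤ q) :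
    ¬ CALine ((q + 1) * g) (-g) (-((q + 1) * g)) g := by
  intro h
  have hqR : (2 : ℝ) ≤ q := by exact_mod_cast hq
  -- In this window, non-empty as `q ≥ 2`, both `q w` and `(q + 1) w` lie strictly between `1` and
  -- `2`, while `w < 1`.
  obtain ⟨s, hs, h1, h2⟩ := exists_irrational_scaled hg (x := 1 / q) (y := 2 / (q + 1)) (by
    rw [div_lt_div_iff₀ (by positivity) (by positivity)]; linarith)
  rw [div_lt_iff₀ (by positivity)] at h1
  rw [lt_div_iff₀ (by positivity)] at h2
  set w := s * (g : ℝ) with hw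
  have f1 : ⌊s * (((q + 1) * g : ℤ) : ℝ)⌋ = 1 := by
    rw [Int.floor_eq_iff]; push_cast
    rw [show s * ((q + 1) * (g : ℝ)) = w * (q + 1) by rw [hw]; ring]
    constructor <;> nlinarith
  have f4 : ⌊s * (g : ℝ)⌋ = 0 := by
    rw [Int.floor_eq_iff]; push_cast; constructor <;> nlinarith
  have f2 := floor_mul_neg hs hg.ne'
  have f3 := floor_mul_neg hs (by positivity : ((q : ℤ) + 1) * g ≠ 0)
  have f5 : ⌊s * ((-((q + 1) * g) + g : ℤ) : ℝ)⌋ = -2 := by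
    rw [Int.floor_eq_iff]; push_cast
    rw [show s * (-((q + 1) * (g : ℝ)) + g) = -(w * q) by rw [hw]; ring]
    constructor <;> nlinarith
  rcases h s hs with h | ⟨p', q', -, -, h⟩
  · rw [f3, f4, f5, f1] at h; omega
  · rw [f3, f4, f5, f1, f2, f4] at h; omega

/-- Here `c₃ + c₄ = c₁` and `c₄ = c₁ + c₂`. In the chosen window the inequality requires the
variable `x₄`; having the full weight already, it would be the whole monomial, which then has degree
`1`. -/
lemma not_CALine_parallel {g : ℤ} (hg : 0 < g) {p : ℕ} (hp : 2 ≤ p) :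
    ¬ CALine ((p + 1) * g) (-g) g (p * g) := by
  intro h
  have hpR : (2 : ℝ) ≤ p := by exact_mod_cast hp
  obtain ⟨s, hs, h1, h2⟩ := exists_irrational_scaled hg (x := 1 / p) (y := 2 / (p + 1)) (by
    rw [div_lt_div_iff₀ (by positivity) (by positivity)]; linarith)
  rw [div_lt_iff₀ (by positivity)] at h1
  rw [lt_div_iff₀ (by positivity)] at h2
  set w := s * (g : ℝ) with hw
  have f1 : ⌊s * (((p + 1) * g : ℤ) : ℝ)⌋ = 1 := by
    rw [Int.floor_eq_iff]; push_cast
    rw [show s * ((p + 1) * (g : ℝ)) = w * (p + 1) by rw [hw]; ring]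
    constructor <;> nlinarith
  have f3 : ⌊s * (g : ℝ)⌋ = 0 := by
    rw [Int.floor_eq_iff]; push_cast; constructor <;> nlinarith
  have f2 := floor_mul_neg hs hg.ne'
  have f4 : ⌊s * ((p * g : ℤ) : ℝ)⌋ = 1 := by
    rw [Int.floor_eq_iff]; push_cast
    rw [show s * (p * (g : ℝ)) = w * p by rw [hw]; ring]
    constructor <;> nlinarith
  rw [CALine] at h
  have hsum : g + p * g = (p + 1) * g := by ring
  rcases h s hs with h | ⟨p', q', hpq, hc, h⟩
  · rw [hsum, f3, f4, f1] at h; omega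
  · rw [hsum, f1, f2, f3, f4] at h
    have hq1 : 1 ≤ q' := by omega
    have hc' : ((p' : ℤ) + q' * p - p) * g = 0 := by linear_combination hc
    rcases mul_eq_zero.1 hc' with h0 | h0
    · have : p' + q' * p = p := by zify; linarith
      have h5 : q' = 1 := by
        by_contra hne
        have : 2 ≤ q' := by omega
        nlinarith
      subst h5
      omega
    · omega

/-- For small `s > 0` the inequality provides a monomial in variables of positive weight only. The
partner of `c₁` is then `c₃`, `c₄` or `-(c₃ + c₄)`; combined with the partner of `c₂`, this leads to
the two families refuted above, up to exchanging `x₃` and `x₄`. -/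
lemma not_CALine_of_pos_neg {c₁ c₂ c₃ c₄ : ℤ} (h1 : 0 < c₁) (h2 : c₂ < 0) (h3 : c₃ ≠ 0)
    (h4 : c₄ ≠ 0) (ht : c₃ + c₄ ≠ 0) (he : 0 < c₁ + c₂) : ¬ CALine c₁ c₂ c₃ c₄ := by
  intro h
  obtain ⟨heq, hp⟩ := floor_eq_and_exists_neg h1.ne' h2.ne h3 h4 he.ne' ht h.floor_le
  obtain ⟨s, hs, hsm⟩ := exists_irrational_floor_small c₁ c₂ c₃ c₄ (c₁ + c₂) (c₃ + c₄)
  have f1 := hsm c₁ (by simp)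
  have f2 := hsm c₂ (by simp)
  have f3 := hsm c₃ (by simp)
  have f4 := hsm c₄ (by simp)
  have fe := hsm (c₁ + c₂) (by simp)
  have hs' := heq s hs
  rw [if_neg (by omega)] at f1 fe
  rw [if_pos h2] at f2
  obtain ⟨p, q, hpq, hc, hle⟩ : ∃ p q : ℕ, 2 ≤ p + q ∧ p * c₃ + q * c₄ = c₁ + c₂ ∧
      0 ≤ (p : ℤ) * ⌊s * (c₃ : ℝ)⌋ + q * ⌊s * (c₄ : ℝ)⌋ := by
    rcases h s hs with h | ⟨p, q, h1, h2, h3⟩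
    · omega
    · exact ⟨p, q, h1, h2, by omega⟩
  have hp3 : c₃ < 0 → p = 0 := by
    intro h; rw [if_pos h] at f3; rw [f3] at hle
    split_ifs at f4 <;> rw [f4] at hle <;> omega
  have hq4 : c₄ < 0 → q = 0 := by
    intro h; rw [if_pos h] at f4; rw [f4] at hle
    split_ifs at f3 <;> rw [f3] at hle <;> omega
  -- the partner of `c₁` is one of `c₃`, `c₄`, `-t`
  have aux : ∀ {c₃ c₄ : ℤ} {q : ℕ}, CALine c₁ c₂ c₃ c₄ → c₃ = -c₁ → 2 ≤ q →
      (q : ℤ) * c₄ = c₁ + c₂ → c₄ = -c₂ → False := by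
    intro c₃ c₄ q h e3 hq hqc e4
    have e2 : c₂ = -c₄ := by omega
    have e1 : c₁ = (q + 1) * c₄ := by linear_combination -hqc - e4
    have := not_CALine_opposite (g := c₄) (by omega) hq
    rw [← e1, ← e2, ← e3] at this
    exact this h
  have aux2 : ∀ {c₃ c₄ : ℤ} {p q : ℕ}, CALine c₁ c₂ c₃ c₄ → c₃ + c₄ = c₁ → c₃ = -c₂ →
      2 ≤ p + q → (p : ℤ) * c₃ + q * c₄ = c₁ + c₂ → False := by
    intro c₃ c₄ p q h et e3 hpq hc
    have e4 : c₄ = c₁ + c₂ := by omega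
    have hq0 : q = 0 := by
      by_contra hq
      have : (1 : ℤ) ≤ q := by omega
      rcases Nat.eq_zero_or_pos p with h0 | h0
      · have : (2 : ℤ) ≤ q := by omega
        subst h0; push_cast at hc; nlinarith
      · have : (1 : ℤ) ≤ p := by omega
        nlinarith
    subst hq0
    have e1 : c₁ = (p + 1) * c₃ := by push_cast at hc; linear_combination -hc - e3
    have e4' : c₄ = p * c₃ := by push_cast at hc; linarith
    have e2 : c₂ = -c₃ := by omega
    have := not_CALine_parallel (g := c₃) (by omega) (p := p) (by omega)
    rw [← e1, ← e2, ← e4'] at this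
    exact this h
  have part2 := hp c₂ (by simp)
  rcases hp c₁ (by simp) with h' | h' | h' | h' | h' | h'
  · omega
  · omega
  · have hp0 := hp3 (by omega)
    subst hp0
    have hqc : (q : ℤ) * c₄ = c₁ + c₂ := by push_cast at hc; linarith
    refine aux h h' (by omega) hqc ?_
    by_contra hne
    have : c₄ = c₁ + c₂ := by omega
    rw [← this] at hqc
    have : (2 : ℤ) ≤ q := by omega
    have : 0 < c₄ := by omega
    nlinarith
  · have hq0 := hq4 (by omega)
    subst hq0
    have hqc : (p : ℤ) * c₃ = c₁ + c₂ := by push_cast at hc; linarith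
    refine aux h.swap_right h' (by omega) hqc ?_
    by_contra hne
    have : c₃ = c₁ + c₂ := by omega
    rw [← this] at hqc
    have : (2 : ℤ) ≤ p := by omega
    have : 0 < c₃ := by omega
    nlinarith
  · omega
  · have : c₃ = -c₂ ∨ c₄ = -c₂ := by omega
    rcases this with h3' | h4'
    · exact aux2 h (by omega) h3' hpq hc
    · exact aux2 h.swap_right (by omega) h4' (by omega : 2 ≤ q + p) (by linarith)

/-- For small `s > 0` the monomial contains variables of negative weight to total degree at most
one, and exactly one because its weight is negative. That variable has no partner. -/
lemma not_CALine_of_neg_neg {c₁ c₂ c₃ c₄ : ℤ} (h1 : c₁ < 0) (h2 : c₂ < 0) (h3 : c₃ ≠ 0)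
    (h4 : c₄ ≠ 0) (ht : c₃ + c₄ ≠ 0) : ¬ CALine c₁ c₂ c₃ c₄ := by
  intro h
  obtain ⟨heq, hp⟩ := floor_eq_and_exists_neg h1.ne h2.ne h3 h4 (by omega) ht h.floor_le
  obtain ⟨s, hs, hsm⟩ := exists_irrational_floor_small c₁ c₂ c₃ c₄ (c₁ + c₂) (c₃ + c₄)
  have f1 := hsm c₁ (by simp)
  have f2 := hsm c₂ (by simp)
  have f3 := hsm c₃ (by simp)
  have f4 := hsm c₄ (by simp)
  have fe := hsm (c₁ + c₂) (by simp)
  have hs' := heq s hs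
  rw [if_pos (by omega)] at f1 f2 fe
  obtain ⟨p, q, hpq, hc, hle⟩ : ∃ p q : ℕ, 2 ≤ p + q ∧ p * c₃ + q * c₄ = c₁ + c₂ ∧
      -1 ≤ (p : ℤ) * ⌊s * (c₃ : ℝ)⌋ + q * ⌊s * (c₄ : ℝ)⌋ := by
    rcases h s hs with h | ⟨p, q, h1, h2, h3⟩
    · omega
    · exact ⟨p, q, h1, h2, by omega⟩
  rw [f3, f4] at hle
  have aux : ∀ {c₃ c₄ : ℤ} {q : ℕ}, c₃ < 0 → 0 < c₄ → 1 ≤ q → c₃ + q * c₄ = c₁ + c₂ →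
      ¬ (c₁ = -c₃ ∨ c₂ = -c₃ ∨ c₃ = -c₃ ∨ c₄ = -c₃ ∨ -(c₁ + c₂) = -c₃ ∨ -(c₃ + c₄) = -c₃) := by
    intro c₃ c₄ q h3 h4 hq hc
    have : c₄ ≤ q * c₄ := le_mul_of_one_le_left h4.le (by omega)
    omega
  rcases lt_or_gt_of_ne h3 with h3' | h3' <;> rcases lt_or_gt_of_ne h4 with h4' | h4'
  · rw [if_pos h3', if_pos h4'] at hle; omega
  · rw [if_pos h3', if_neg (by omega)] at hle
    have hq : (0 : ℤ) ≤ q * c₄ := by positivity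
    have hp1 : p = 1 := by
      by_contra hne
      have : p = 0 := by omega
      subst this; push_cast at hc; omega
    subst hp1
    exact aux (q := q) h3' h4' (by omega) (by push_cast at hc; linarith) (hp c₃ (by simp))
  · rw [if_neg (by omega), if_pos h4'] at hle
    have hq : (0 : ℤ) ≤ p * c₃ := by positivity
    have hp1 : q = 1 := by
      by_contra hne
      have : q = 0 := by omega
      subst this; push_cast at hc; omega
    subst hp1
    refine aux (q := p) h4' h3' (by omega) (by push_cast at hc; linarith) ?_
    have := hp c₄ (by simp)
    omega
  · have : (0 : ℤ) ≤ p * c₃ + q * c₄ := by positivity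
    omega

theorem not_CALine {c₁ c₂ c₃ c₄ : ℤ} (h1 : c₁ ≠ 0) (h2 : c₂ ≠ 0) (h3 : c₃ ≠ 0) (h4 : c₄ ≠ 0)
    (ht : c₃ + c₄ ≠ 0) : ¬ CALine c₁ c₂ c₃ c₄ := by
  intro h
  by_cases he : c₁ + c₂ = 0
  · exact not_CALine_of_add_eq_zero h1 h3 h4 ht he h
  rcases lt_or_gt_of_ne h1 with h1' | h1' <;> rcases lt_or_gt_of_ne h2 with h2' | h2'
  · exact not_CALine_of_neg_neg h1' h2' h3 h4 ht h
  · rcases lt_or_gt_of_ne he with he' | he'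
    · exact not_CALine_of_pos_neg (by omega) (by omega) (by omega) (by omega) (by omega)
        (by omega) h.neg
    · exact not_CALine_of_pos_neg h2' h1' h3 h4 ht (by omega) h.swap_left
  · rcases lt_or_gt_of_ne he with he' | he'
    · exact not_CALine_of_pos_neg (by omega) (by omega) (by omega) (by omega) (by omega)
        (by omega) h.neg.swap_left
    · exact not_CALine_of_pos_neg h1' h2' h3 h4 ht he' h
  · exact not_CALine_of_neg_neg (by omega) (by omega) (by omega) (by omega) (by omega) h.neg

/-! ### Lines for the cD-E type with `x₁` of non-zero weight. -/

/-- The weight inequalities along a line for the type `x₁² + g(x₂, x₃, x₄)`. -/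
def CDELine (c₁ c₂ c₃ c₄ : ℤ) : Prop := ∀ s : ℝ, Irrational s →
  ⌊s * (c₁ : ℝ)⌋ + ⌊s * (c₂ : ℝ)⌋ + ⌊s * (c₃ : ℝ)⌋ + ⌊s * (c₄ : ℝ)⌋ + 1 ≤
    ⌊s * ((c₂ + c₃ + c₄ - c₁ : ℤ) : ℝ)⌋ + 2 * ⌊s * (c₁ : ℝ)⌋ ∨
  ∃ p q u : ℕ, 3 ≤ p + q + u ∧ p * c₂ + q * c₃ + u * c₄ = 2 * c₁ ∧
    ⌊s * (c₁ : ℝ)⌋ + ⌊s * (c₂ : ℝ)⌋ + ⌊s * (c₃ : ℝ)⌋ + ⌊s * (c₄ : ℝ)⌋ + 1 ≤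
      ⌊s * ((c₂ + c₃ + c₄ - c₁ : ℤ) : ℝ)⌋ +
        (p * ⌊s * (c₂ : ℝ)⌋ + q * ⌊s * (c₃ : ℝ)⌋ + u * ⌊s * (c₄ : ℝ)⌋)

lemma CDELine.swap_left {c₁ c₂ c₃ c₄ : ℤ} (h : CDELine c₁ c₂ c₃ c₄) : CDELine c₁ c₃ c₂ c₄ := by
  intro s hs
  rw [add_comm c₃ c₂]
  rcases h s hs with h | ⟨p, q, u, h1, h2, h3⟩
  · exact Or.inl (by linarith)
  · exact Or.inr ⟨q, p, u, by omega, by linarith, by linarith⟩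

lemma CDELine.swap_right {c₁ c₂ c₃ c₄ : ℤ} (h : CDELine c₁ c₂ c₃ c₄) : CDELine c₁ c₂ c₄ c₃ := by
  intro s hs
  rw [add_right_comm c₂ c₄ c₃]
  rcases h s hs with h | ⟨p, q, u, h1, h2, h3⟩
  · exact Or.inl (by linarith)
  · exact Or.inr ⟨p, u, q, by omega, by linarith, by linarith⟩

lemma CDELine.neg {c₁ c₂ c₃ c₄ : ℤ} (h : CDELine c₁ c₂ c₃ c₄) :
    CDELine (-c₁) (-c₂) (-c₃) (-c₄) := by
  intro s hs
  have key : ∀ c : ℤ, s * ((-c : ℤ) : ℝ) = -s * (c : ℝ) := fun c => by push_cast; ring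
  rw [show -c₂ + -c₃ + -c₄ - -c₁ = -(c₂ + c₃ + c₄ - c₁) by ring, key, key, key, key, key]
  rcases h (-s) hs.neg with h | ⟨p, q, u, h1, h2, h3⟩
  · exact Or.inl h
  · exact Or.inr ⟨p, q, u, h1, by linarith, h3⟩

lemma sum_mul_floor_le {s : ℝ} {p q u : ℕ} {c d e f : ℤ} (h : p * c + q * d + u * e = f) :
    (p : ℤ) * ⌊s * (c : ℝ)⌋ + q * ⌊s * (d : ℝ)⌋ + u * ⌊s * (e : ℝ)⌋ ≤ ⌊s * (f : ℝ)⌋ := by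
  rw [Int.le_floor, ← h]
  push_cast
  have b1 : (p : ℝ) * ⌊s * (c : ℝ)⌋ ≤ p * (s * c) := by gcongr; exact Int.floor_le _
  have b2 : (q : ℝ) * ⌊s * (d : ℝ)⌋ ≤ q * (s * d) := by gcongr; exact Int.floor_le _
  have b3 : (u : ℝ) * ⌊s * (e : ℝ)⌋ ≤ u * (s * e) := by gcongr; exact Int.floor_le _
  linarith

lemma CDELine.floor_le {c₁ c₂ c₃ c₄ : ℤ} (h : CDELine c₁ c₂ c₃ c₄) (s : ℝ) (hs : Irrational s) :
    ⌊s * (c₁ : ℝ)⌋ + ⌊s * (c₂ : ℝ)⌋ + ⌊s * (c₃ : ℝ)⌋ + ⌊s * (c₄ : ℝ)⌋ + 1 ≤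
      ⌊s * ((c₂ + c₃ + c₄ - c₁ : ℤ) : ℝ)⌋ + ⌊s * ((2 * c₁ : ℤ) : ℝ)⌋ := by
  rcases h s hs with h | ⟨p, q, u, -, h2, h3⟩
  · have := sum_mul_floor_le (s := s) (p := 2) (q := 0) (u := 0) (c := c₁) (d := c₁) (e := c₁)
      (f := 2 * c₁) (by push_cast; ring)
    push_cast at this ⊢
    push_cast at h
    linarith
  · have := sum_mul_floor_le (s := s) h2
    omega

/-- In the window both `⌊w⌋` and `⌊2 w⌋` vanish and `⌊(u + 2) w⌋ = 1`. The floors then demand `2p' -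
1 ≤ q'`, whereas the negative total weight demands `q' < p'`. -/
lemma not_CDELine_opposite {g : ℤ} (hg : 0 < g) {u : ℕ} (hu : 2 ≤ u) :
    ¬ CDELine (-g) (-((u + 2) * g)) ((u + 2) * g) g := by
  intro h
  have huR : (2 : ℝ) ≤ u := by exact_mod_cast hu
  obtain ⟨s, hs, h1, h2⟩ := exists_irrational_scaled hg (x := 1 / (u + 2)) (y := 2 / (u + 2)) (by
    gcongr; norm_num)
  rw [div_lt_iff₀ (by positivity)] at h1
  rw [lt_div_iff₀ (by positivity)] at h2
  set w := s * (g : ℝ) with hw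
  have f3 : ⌊s * (((u + 2) * g : ℤ) : ℝ)⌋ = 1 := by
    rw [Int.floor_eq_iff]; push_cast
    rw [show s * ((u + 2) * (g : ℝ)) = w * (u + 2) by rw [hw]; ring]
    constructor <;> nlinarith
  have hw0 : 0 < w := by
    by_contra hcon
    nlinarith
  have f4 : ⌊s * (g : ℝ)⌋ = 0 := by
    rw [Int.floor_eq_iff]; push_cast; constructor <;> nlinarith
  have f1 := floor_mul_neg hs hg.ne'
  have f2 := floor_mul_neg hs (by positivity : ((u : ℤ) + 2) * g ≠ 0)
  have ft : ⌊s * ((-((u + 2) * g) + (u + 2) * g + g - -g : ℤ) : ℝ)⌋ = 0 := by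
    rw [Int.floor_eq_iff]; push_cast
    rw [show s * (-((u + 2) * (g : ℝ)) + (u + 2) * g + g - -g) = w * 2 by rw [hw]; ring]
    constructor <;> nlinarith
  rcases h s hs with h | ⟨p', q', u', hpq, hc, h⟩
  · rw [ft, f1, f2, f3, f4] at h; omega
  · rw [ft, f1, f2, f3, f4] at h
    have h5 : 2 * (p' : ℤ) - 1 ≤ q' := by linarith
    have hc' : (((u : ℤ) + 2) * (q' - p') + u' + 2) * g = 0 := by linear_combination hc
    rcases mul_eq_zero.1 hc' with h0 | h0
    · have h6 : (q' : ℤ) < p' := by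
        by_contra hcon
        have : (0 : ℤ) ≤ ((u : ℤ) + 2) * (q' - p') := mul_nonneg (by positivity) (by omega)
        omega
      omega
    · omega

/-- With the same window the floors leave only `p' = 0`, `u' ≤ 1`, and the weight equation then
gives the linear monomial `x₄`, of too low a degree. -/
lemma not_CDELine_parallel {g : ℤ} (hg : 0 < g) {q : ℕ} (hq : 2 ≤ q) :
    ¬ CDELine (-g) (-((q + 2) * g)) g (-(2 * g)) := by
  intro h
  have hqR : (2 : ℝ) ≤ q := by exact_mod_cast hq
  obtain ⟨s, hs, h1, h2⟩ := exists_irrational_scaled hg (x := 1 / (q + 2)) (y := 2 / (q + 2)) (by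
    gcongr; norm_num)
  rw [div_lt_iff₀ (by positivity)] at h1
  rw [lt_div_iff₀ (by positivity)] at h2
  set w := s * (g : ℝ) with hw
  have hw0 : 0 < w := by
    by_contra hcon
    nlinarith
  have f2' : ⌊s * (((q + 2) * g : ℤ) : ℝ)⌋ = 1 := by
    rw [Int.floor_eq_iff]; push_cast
    rw [show s * ((q + 2) * (g : ℝ)) = w * (q + 2) by rw [hw]; ring]
    constructor <;> nlinarith
  have f3 : ⌊s * (g : ℝ)⌋ = 0 := by
    rw [Int.floor_eq_iff]; push_cast; constructor <;> nlinarith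
  have f4' : ⌊s * ((2 * g : ℤ) : ℝ)⌋ = 0 := by
    rw [Int.floor_eq_iff]; push_cast
    rw [show s * (2 * (g : ℝ)) = w * 2 by rw [hw]; ring]
    constructor <;> nlinarith
  have f1 := floor_mul_neg hs hg.ne'
  have f2 := floor_mul_neg hs (by positivity : ((q : ℤ) + 2) * g ≠ 0)
  have f4 := floor_mul_neg hs (by positivity : 2 * g ≠ 0)
  have et : -((q + 2) * g) + g + -(2 * g) - -g = -((q + 2) * g) := by ring
  rw [f3] at f1
  rw [f2'] at f2
  rw [f4'] at f4
  rcases h s hs with h | ⟨p', q', u', hpq, hc, h⟩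
  · rw [et, f1, f2, f3, f4] at h; omega
  · rw [et, f1, f2, f3, f4] at h
    have hp0 : p' = 0 := by omega
    have hu1 : u' ≤ 1 := by omega
    subst hp0
    have hc' : ((q' : ℤ) - 2 * u' + 2) * g = 0 := by push_cast at hc; linear_combination hc
    rcases mul_eq_zero.1 hc' with h0 | h0 <;> omega

lemma not_CDELine_of_neg {c₁ c₂ c₃ c₄ : ℤ} (h1 : c₁ < 0) (h2 : c₂ ≠ 0) (h3 : c₃ ≠ 0) (h4 : c₄ ≠ 0)
    (ht : c₂ + c₃ + c₄ - c₁ ≠ 0) : ¬ CDELine c₁ c₂ c₃ c₄ := by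
  intro h
  -- the variable of negative weight that divides the initial monomial is `x₂` in the auxiliary facts
  have opp : ∀ {c₂ c₃ c₄ : ℤ} {q u : ℕ}, CDELine c₁ c₂ c₃ c₄ → c₂ < 2 * c₁ → c₄ ≠ 0 →
      (u = 0 ∨ 0 < c₄) → 2 ≤ q + u → c₂ + q * c₃ + u * c₄ = 2 * c₁ → c₃ = -c₂ →
      (c₁ = -c₁ ∨ c₂ = -c₁ ∨ c₃ = -c₁ ∨ c₄ = -c₁ ∨ -(2 * c₁) = -c₁ ∨
        -(c₂ + c₃ + c₄ - c₁) = -c₁) → False := by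
    intro c₂ c₃ c₄ q u h hlt h4 hu hqu hc e3 hp
    have hu0 : 0 ≤ (u : ℤ) * c₄ := by
      rcases hu with rfl | hu
      · simp
      · positivity
    have hq0 : q = 0 := by
      by_contra hne
      have : c₃ ≤ q * c₃ := le_mul_of_one_le_left (by omega) (by omega)
      omega
    subst hq0
    have hc4 : 0 < c₄ := by omega
    have e4 : c₄ = -c₁ := by omega
    have e3' : c₃ = (u + 2) * c₄ := by push_cast at hc; linear_combination e3 - hc - 2 * e4
    have := not_CDELine_opposite hc4 (u := u) (by omega)
    rw [← e3', show -c₄ = c₁ by omega, show -c₃ = c₂ by omega] at this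
    exact this h
  -- The case where the partner of `c₂` is `-t`; the partner of `c₄` then fixes the vector up to
  -- scaling.
  have par : ∀ {c₂ c₃ c₄ : ℤ} {q u : ℕ}, CDELine c₁ c₂ c₃ c₄ → c₂ < 2 * c₁ → 0 < c₃ →
      (u = 0 ∨ 0 < c₄) → 2 ≤ q + u → c₂ + q * c₃ + u * c₄ = 2 * c₁ → c₃ + c₄ = c₁ →
      (c₁ = -c₄ ∨ c₂ = -c₄ ∨ c₃ = -c₄ ∨ c₄ = -c₄ ∨ -(2 * c₁) = -c₄ ∨
        -(c₂ + c₃ + c₄ - c₁) = -c₄) → False := by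
    intro c₂ c₃ c₄ q u h hlt h3 hu hqu hc et hp
    have hu0 : u = 0 := by omega
    subst hu0
    have hq2 : 2 * c₃ ≤ q * c₃ := mul_le_mul_of_nonneg_right (by omega) h3.le
    push_cast at hc
    have e4 : c₄ = 2 * c₁ := by omega
    have e3 : c₁ = -c₃ := by omega
    have e2 : c₂ = -((q + 2) * c₃) := by linear_combination hc + 2 * e3
    have := not_CDELine_parallel h3 (q := q) (by omega)
    rw [← e2, ← e3, show -(2 * c₃) = c₄ by omega] at this
    exact this h
  -- The negative variable satisfies `c₂ < 2 c₁`, since the rest of the monomial has positive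
  -- weight. Its partner can therefore only be `c₃`, `c₄` or `-t`.
  have aux : ∀ {c₂ c₃ c₄ : ℤ} {q u : ℕ}, CDELine c₁ c₂ c₃ c₄ → c₂ < 0 → c₃ ≠ 0 → c₄ ≠ 0 →
      c₂ + c₃ + c₄ - c₁ ≠ 0 → (q = 0 ∨ 0 < c₃) → (u = 0 ∨ 0 < c₄) → 2 ≤ q + u →
      c₂ + q * c₃ + u * c₄ = 2 * c₁ → False := by
    intro c₂ c₃ c₄ q u h h2 h3 h4 ht hq hu hqu hc
    obtain ⟨-, hp⟩ := floor_eq_and_exists_neg h1.ne h2.ne h3 h4 (by omega) ht h.floor_le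
    have hlt : c₂ < 2 * c₁ := by
      have hq' : 0 ≤ (q : ℤ) * c₃ ∧ (0 < q → 0 < (q : ℤ) * c₃) := by
        rcases hq with rfl | hq
        · simp
        · exact ⟨by positivity, fun _ => by positivity⟩
      have hu' : 0 ≤ (u : ℤ) * c₄ ∧ (0 < u → 0 < (u : ℤ) * c₄) := by
        rcases hu with rfl | hu
        · simp
        · exact ⟨by positivity, fun _ => by positivity⟩
      by_cases hq0 : 0 < q
      · have := hq'.2 hq0; omega
      · have := hu'.2 (by omega); omega
    have p1 := hp c₁ (by simp)
    have p3 := hp c₃ (by simp)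
    have p4 := hp c₄ (by simp)
    rcases hp c₂ (by simp) with e | e | e | e | e | e
    · omega
    · omega
    · exact opp h hlt h4 hu hqu hc e p1
    · exact opp h.swap_right hlt h3 hq (by omega : 2 ≤ u + q) (by linarith) e (by omega)
    · omega
    · by_cases hc3 : 0 < c₃
      · exact par h hlt hc3 hu hqu hc (by omega) p4
      · have hq0 : q = 0 := by omega
        exact par h.swap_right hlt (by omega) hq (by omega : 2 ≤ u + q) (by linarith) (by omega)
          (by omega)
  obtain ⟨heq, -⟩ := floor_eq_and_exists_neg h1.ne h2 h3 h4 (by omega) ht h.floor_le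
  obtain ⟨s, hs, hsm⟩ := exists_irrational_floor_small c₁ c₂ c₃ c₄ (2 * c₁) (c₂ + c₃ + c₄ - c₁)
  have f1 := hsm c₁ (by simp)
  have f2 := hsm c₂ (by simp)
  have f3 := hsm c₃ (by simp)
  have f4 := hsm c₄ (by simp)
  have fe := hsm (2 * c₁) (by simp)
  have hs' := heq s hs
  rw [if_pos (by omega)] at f1 fe
  obtain ⟨p, q, u, hpq, hc, hle⟩ : ∃ p q u : ℕ, 3 ≤ p + q + u ∧
      p * c₂ + q * c₃ + u * c₄ = 2 * c₁ ∧
      -1 ≤ (p : ℤ) * ⌊s * (c₂ : ℝ)⌋ + q * ⌊s * (c₃ : ℝ)⌋ + u * ⌊s * (c₄ : ℝ)⌋ := by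
    rcases h s hs with h | ⟨p, q, u, h1, h2, h3⟩
    · omega
    · exact ⟨p, q, u, h1, h2, by omega⟩
  rw [f2, f3, f4] at hle
  have nn : ∀ (n : ℕ) {c : ℤ}, (n = 0 ∨ 0 < c) → 0 ≤ (n : ℤ) * c := by
    rintro n c (rfl | h)
    · simp
    · positivity
  -- For small `s > 0` each variable of negative weight contributes `-1` per degree, so the bound
  -- `-1` allows one such factor, and the negative weight `2 c₁` requires one.
  have key : (c₂ < 0 ∧ p = 1 ∧ (q = 0 ∨ 0 < c₃) ∧ (u = 0 ∨ 0 < c₄)) ∨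
      (c₃ < 0 ∧ q = 1 ∧ (p = 0 ∨ 0 < c₂) ∧ (u = 0 ∨ 0 < c₄)) ∨
      (c₄ < 0 ∧ u = 1 ∧ (p = 0 ∨ 0 < c₂) ∧ (q = 0 ∨ 0 < c₃)) := by
    by_contra hcon
    have : (p = 0 ∨ 0 < c₂) ∧ (q = 0 ∨ 0 < c₃) ∧ (u = 0 ∨ 0 < c₄) := by
      split_ifs at hle <;> omega
    have := nn p this.1
    have := nn q (by tauto : q = 0 ∨ 0 < c₃)
    have := nn u (by tauto : u = 0 ∨ 0 < c₄)
    omega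
  rcases key with ⟨hn, rfl, hx, hy⟩ | ⟨hn, rfl, hx, hy⟩ | ⟨hn, rfl, hx, hy⟩
  · exact aux h hn h3 h4 ht hx hy (by omega) (by push_cast at hc; linarith)
  · exact aux h.swap_left hn h2 h4 (by omega) hx hy (by omega : 2 ≤ p + u)
      (by push_cast at hc; linarith)
  · exact aux h.swap_right.swap_left hn h2 h3 (by omega) hx hy (by omega : 2 ≤ p + q)
      (by push_cast at hc; linarith)

theorem not_CDELine {c₁ c₂ c₃ c₄ : ℤ} (h1 : c₁ ≠ 0) (h2 : c₂ ≠ 0) (h3 : c₃ ≠ 0) (h4 : c₄ ≠ 0)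
    (ht : c₂ + c₃ + c₄ - c₁ ≠ 0) : ¬ CDELine c₁ c₂ c₃ c₄ := by
  intro h
  rcases lt_or_gt_of_ne h1 with h1' | h1'
  · exact not_CDELine_of_neg h1' h2 h3 h4 ht h
  · exact not_CDELine_of_neg (by omega) (by omega) (by omega) (by omega) (by omega) h.neg

/-! ### Lines for the odd type. -/

/-- The weight inequalities along a line for the type `x₁² + x₂² + g(x₃, x₄)`, where `x₁` and `x₂`
have the same weight. -/
def OddLine (c c₃ c₄ : ℤ) : Prop := ∀ s : ℝ, Irrational s →
  ⌊s * (c₃ : ℝ)⌋ + ⌊s * (c₄ : ℝ)⌋ + 1 ≤ ⌊s * ((c₃ + c₄ : ℤ) : ℝ)⌋ ∨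
  ∃ q u : ℕ, 3 ≤ q + u ∧ q * c₃ + u * c₄ = 2 * c ∧
    2 * ⌊s * (c : ℝ)⌋ + ⌊s * (c₃ : ℝ)⌋ + ⌊s * (c₄ : ℝ)⌋ + 1 ≤
      ⌊s * ((c₃ + c₄ : ℤ) : ℝ)⌋ + (q * ⌊s * (c₃ : ℝ)⌋ + u * ⌊s * (c₄ : ℝ)⌋)

lemma OddLine.neg {c c₃ c₄ : ℤ} (h : OddLine c c₃ c₄) : OddLine (-c) (-c₃) (-c₄) := by
  intro s hs
  have key : ∀ c : ℤ, s * ((-c : ℤ) : ℝ) = -s * (c : ℝ) := fun c => by push_cast; ring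
  rw [← neg_add c₃ c₄, key, key, key, key]
  rcases h (-s) hs.neg with h | ⟨q, u, h1, h2, h3⟩
  · exact Or.inl h
  · exact Or.inr ⟨q, u, h1, by linarith, h3⟩

lemma OddLine.floor_le {c c₃ c₄ : ℤ} (h : OddLine c c₃ c₄) (s : ℝ) (hs : Irrational s) :
    ⌊s * (c : ℝ)⌋ + ⌊s * (c : ℝ)⌋ + ⌊s * (c₃ : ℝ)⌋ + ⌊s * (c₄ : ℝ)⌋ + 1 ≤
      ⌊s * ((c₃ + c₄ : ℤ) : ℝ)⌋ + ⌊s * ((2 * c : ℤ) : ℝ)⌋ := by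
  rcases h s hs with h | ⟨q, u, -, h2, h3⟩
  · have := sum_mul_floor_le (s := s) (p := 2) (q := 0) (u := 0) (c := c) (d := c) (e := c)
      (f := 2 * c) (by push_cast; ring)
    push_cast at this ⊢
    push_cast at h
    linarith
  · have := sum_mul_floor_le (s := s) (p := 0) (c := c) (q := q) (u := u) (d := c₃) (e := c₄)
      (f := 2 * c) (by push_cast; linarith)
    push_cast at this ⊢
    push_cast at h3
    linarith

/-- As in the cD-E type, a small `s` gives a monomial with exactly one factor of negative weight.
With only `x₃` and `x₄` available, that weight has no partner, so no exceptional family arises. -/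
lemma not_OddLine_of_neg {c c₃ c₄ : ℤ} (h1 : c < 0) (h3 : c₃ ≠ 0) (h4 : c₄ ≠ 0)
    (ht : c₃ + c₄ ≠ 0) : ¬ OddLine c c₃ c₄ := by
  intro h
  obtain ⟨heq, hp⟩ := floor_eq_and_exists_neg h1.ne h1.ne h3 h4 (by omega) ht h.floor_le
  obtain ⟨s, hs, hsm⟩ := exists_irrational_floor_small c c c₃ c₄ (2 * c) (c₃ + c₄)
  have f1 := hsm c (by simp)
  have f3 := hsm c₃ (by simp)
  have f4 := hsm c₄ (by simp)
  have fe := hsm (2 * c) (by simp)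
  have hs' := heq s hs
  rw [if_pos (by omega)] at f1 fe
  obtain ⟨q, u, hqu, hc, hle⟩ : ∃ q u : ℕ, 3 ≤ q + u ∧ q * c₃ + u * c₄ = 2 * c ∧
      -1 ≤ (q : ℤ) * ⌊s * (c₃ : ℝ)⌋ + u * ⌊s * (c₄ : ℝ)⌋ := by
    rcases h s hs with h | ⟨q, u, h1, h2, h3⟩
    · omega
    · exact ⟨q, u, h1, h2, by omega⟩
  rw [f3, f4] at hle
  have p3 := hp c₃ (by simp)
  have p4 := hp c₄ (by simp)
  rcases lt_or_gt_of_ne h3 with h3' | h3' <;> rcases lt_or_gt_of_ne h4 with h4' | h4'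
  · rw [if_pos h3', if_pos h4'] at hle; omega
  · rw [if_pos h3', if_neg (by omega)] at hle
    have hu : (0 : ℤ) ≤ u * c₄ := by positivity
    have hq1 : q = 1 := by
      by_contra hne
      have : q = 0 := by omega
      subst this; push_cast at hc; omega
    subst hq1
    have : 2 * c₄ ≤ u * c₄ := mul_le_mul_of_nonneg_right (by omega) h4'.le
    push_cast at hc
    omega
  · rw [if_neg (by omega), if_pos h4'] at hle
    have hq : (0 : ℤ) ≤ q * c₃ := by positivity
    have hu1 : u = 1 := by
      by_contra hne
      have : u = 0 := by omega
      subst this; push_cast at hc; omega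
    subst hu1
    have : 2 * c₃ ≤ q * c₃ := mul_le_mul_of_nonneg_right (by omega) h3'.le
    push_cast at hc
    omega
  · have : (0 : ℤ) ≤ q * c₃ + u * c₄ := by positivity
    omega

theorem not_OddLine {c c₃ c₄ : ℤ} (h1 : c ≠ 0) (h3 : c₃ ≠ 0) (h4 : c₄ ≠ 0) (ht : c₃ + c₄ ≠ 0) :
    ¬ OddLine c c₃ c₄ := by
  intro h
  rcases lt_or_gt_of_ne h1 with h1' | h1'
  · exact not_OddLine_of_neg h1' h3 h4 ht h
  · exact not_OddLine_of_neg (by omega) (by omega) (by omega) (by omega) h.neg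

/-! ### Lines for the cD-E type with `x₁` of zero weight along the line. -/

/-- The weight inequalities along a line for the type `x₁² + g(x₂, x₃, x₄)`, where `x₁` has weight
`1` everywhere. -/
def CDEUnitLine (c₂ c₃ c₄ : ℤ) : Prop := ∀ s : ℝ, Irrational s →
  ⌊s * (c₂ : ℝ)⌋ + ⌊s * (c₃ : ℝ)⌋ + ⌊s * (c₄ : ℝ)⌋ + 2 ≤ ⌊s * ((c₂ + c₃ + c₄ : ℤ) : ℝ)⌋ ∨
  ∃ p q u : ℕ, 3 ≤ p + q + u ∧ p * c₂ + q * c₃ + u * c₄ = 0 ∧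
    ⌊s * (c₂ : ℝ)⌋ + ⌊s * (c₃ : ℝ)⌋ + ⌊s * (c₄ : ℝ)⌋ ≤ ⌊s * ((c₂ + c₃ + c₄ : ℤ) : ℝ)⌋ +
      (p * ⌊s * (c₂ : ℝ)⌋ + q * ⌊s * (c₃ : ℝ)⌋ + u * ⌊s * (c₄ : ℝ)⌋)

/-- `H` and its reflection give an equality that excludes `x₁²` and pairs `c₂, c₃, c₄, -t`; hence
two of `c₂, c₃, c₄` are opposite. Small `s` of both signs then yield incompatible monomials. -/
theorem not_CDEUnitLine {c₂ c₃ c₄ : ℤ} (h2 : c₂ ≠ 0) (h3 : c₃ ≠ 0) (h4 : c₄ ≠ 0)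
    (ht : c₂ + c₃ + c₄ ≠ 0)
    (H : ∀ s : ℝ, Irrational s → ⌊s * (c₂ : ℝ)⌋ + ⌊s * (c₃ : ℝ)⌋ + ⌊s * (c₄ : ℝ)⌋ + 1 ≤
      ⌊s * ((c₂ + c₃ + c₄ : ℤ) : ℝ)⌋) : ¬ CDEUnitLine c₂ c₃ c₄ := by
  intro h
  have heq : ∀ s : ℝ, Irrational s → ⌊s * (c₂ : ℝ)⌋ + ⌊s * (c₃ : ℝ)⌋ + ⌊s * (c₄ : ℝ)⌋ + 1 =
      ⌊s * ((c₂ + c₃ + c₄ : ℤ) : ℝ)⌋ := by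
    intro s hs
    have ha := H s hs
    have hb := H (-s) hs.neg
    simp only [floor_neg_mul hs h2, floor_neg_mul hs h3, floor_neg_mul hs h4,
      floor_neg_mul hs ht] at hb
    omega
  have hmon : ∀ s : ℝ, Irrational s → ∃ p q u : ℕ, 3 ≤ p + q + u ∧
      p * c₂ + q * c₃ + u * c₄ = 0 ∧
      -1 ≤ (p : ℤ) * ⌊s * (c₂ : ℝ)⌋ + q * ⌊s * (c₃ : ℝ)⌋ + u * ⌊s * (c₄ : ℝ)⌋ := by
    intro s hs
    have := heq s hs
    rcases h s hs with h | ⟨p, q, u, h5, h6, h7⟩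
    · omega
    · exact ⟨p, q, u, h5, h6, by omega⟩
  -- For weights `m, -m, τ`: at most one factor of weight `-m` in degree at least `3` forces `2 τ ≤
  -- m`, and at most one factor of positive weight forces `2 m ≤ τ`.
  have aux : ∀ {m τ : ℤ}, 0 < m → 0 < τ →
      (∃ p q u : ℕ, 3 ≤ p + q + u ∧ p * m + q * (-m) + u * τ = 0 ∧ q ≤ 1) →
      (∃ p q u : ℕ, 3 ≤ p + q + u ∧ p * m + q * (-m) + u * τ = 0 ∧ p + u ≤ 1) → False := by
    rintro m τ hm hτ ⟨p, q, u, h5, h6, h7⟩ ⟨p', q', u', h5', h6', h7'⟩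
    have hmτ : 2 * τ ≤ m := by
      have hq1 : q = 1 := by
        by_contra hne
        have : q = 0 := by omega
        subst this
        have a1 : 0 ≤ (p : ℤ) * m := by positivity
        have a2 : 0 ≤ (u : ℤ) * τ := by positivity
        push_cast at h6
        have b1 : (p : ℤ) * m = 0 := by linarith
        have b2 : (u : ℤ) * τ = 0 := by linarith
        rcases mul_eq_zero.1 b1 with h | h <;> rcases mul_eq_zero.1 b2 with h' | h' <;> omega
      subst hq1
      push_cast at h6
      have : 2 * τ ≤ (u + p) * τ := mul_le_mul_of_nonneg_right (by omega) hτ.le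
      have hp0 : p = 0 := by
        by_contra hne
        have a1 : m ≤ p * m := le_mul_of_one_le_left hm.le (by omega)
        have a2 : 0 ≤ (u : ℤ) * τ := by positivity
        have b1 : ((p : ℤ) - 1) * m = 0 := by linarith
        have b2 : (u : ℤ) * τ = 0 := by linarith
        rcases mul_eq_zero.1 b1 with h | h <;> rcases mul_eq_zero.1 b2 with h' | h' <;> omega
      subst hp0
      push_cast at h6 this
      linarith
    have hτm : 2 * m ≤ τ := by
      have hq2 : 2 * m ≤ q' * m := mul_le_mul_of_nonneg_right (by omega) hm.le
      have hcase : (p' = 0 ∧ u' = 0) ∨ (p' = 1 ∧ u' = 0) ∨ (p' = 0 ∧ u' = 1) := by omega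
      rcases hcase with ⟨rfl, rfl⟩ | ⟨rfl, rfl⟩ | ⟨rfl, rfl⟩ <;> push_cast at h6' <;> linarith
    omega
  have hmon' : ∀ {d₂ d₃ d₄ : ℤ}, d₂ ≠ 0 → d₄ ≠ 0 → d₃ = -d₂ →
      (∀ s : ℝ, Irrational s → ∃ p q u : ℕ, 3 ≤ p + q + u ∧
      p * d₂ + q * d₃ + u * d₄ = 0 ∧
      -1 ≤ (p : ℤ) * ⌊s * (d₂ : ℝ)⌋ + q * ⌊s * (d₃ : ℝ)⌋ + u * ⌊s * (d₄ : ℝ)⌋) → False := by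
    intro d₂ d₃ d₄ h2 h4 e3 hm
    obtain ⟨s, hs, hsm⟩ := exists_irrational_floor_small d₂ d₃ d₄ 0 0 0
    have f2 := hsm d₂ (by simp)
    have f3 := hsm d₃ (by simp)
    have f4 := hsm d₄ (by simp)
    have g2 := floor_neg_mul hs h2
    have g3 := floor_neg_mul hs (c := d₃) (by omega)
    have g4 := floor_neg_mul hs h4
    obtain ⟨p, q, u, h5, h6, h7⟩ := hm s hs
    obtain ⟨p', q', u', h5', h6', h7'⟩ := hm (-s) hs.neg
    rw [g2, g3, g4] at h7'
    rw [f2, f3, f4] at h7 h7'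
    subst e3
    rcases lt_or_gt_of_ne h2 with h2' | h2' <;> rcases lt_or_gt_of_ne h4 with h4' | h4'
    · rw [if_pos h2', if_pos h4', if_neg (by omega)] at h7 h7'
      exact aux (m := -d₂) (τ := -d₄) (by omega) (by omega)
        ⟨p', q', u', h5', by linarith, by omega⟩ ⟨p, q, u, h5, by linarith, by omega⟩
    · rw [if_pos h2', if_neg (by omega), if_neg (by omega)] at h7 h7'
      exact aux (m := -d₂) (τ := d₄) (by omega) (by omega)
        ⟨q, p, u, by omega, by linarith, by omega⟩ ⟨q', p', u', by omega, by linarith, by omega⟩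
    · rw [if_neg (by omega), if_pos (by omega), if_pos h4'] at h7 h7'
      exact aux (m := d₂) (τ := -d₄) (by omega) (by omega)
        ⟨q', p', u', by omega, by linarith, by omega⟩ ⟨q, p, u, by omega, by linarith, by omega⟩
    · rw [if_neg (by omega), if_pos (by omega), if_neg (by omega)] at h7 h7'
      exact aux (m := d₂) (τ := d₄) (by omega) (by omega)
        ⟨p, q, u, h5, by linarith, by omega⟩ ⟨p', q', u', h5', by linarith, by omega⟩
  have hconst : ∀ s : ℝ, Irrational s →
      ∑ i, ⌊s * ((![c₂, c₃, c₄, -(c₂ + c₃ + c₄)] i : ℤ) : ℝ)⌋ = -2 := by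
    intro s hs
    have h := heq s hs
    have e1 := floor_mul_neg hs ht
    simp only [Fin.sum_univ_four, Matrix.cons_val]
    omega
  obtain ⟨j, hj⟩ := exists_eq_neg_of_sum_floor_const hconst (i := 0) h2
  have hj' : c₃ = -c₂ ∨ c₄ = -c₂ ∨ c₄ = -c₃ := by
    fin_cases j <;> simp at hj <;> omega
  rcases hj' with e | e | e
  · exact hmon' h2 h4 e hmon
  · refine hmon' h2 h3 e fun s hs => ?_
    obtain ⟨p, q, u, h5, h6, h7⟩ := hmon s hs
    exact ⟨p, u, q, by omega, by linarith, by linarith⟩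
  · refine hmon' h3 h2 e fun s hs => ?_
    obtain ⟨p, q, u, h5, h6, h7⟩ := hmon s hs
    exact ⟨q, u, p, by omega, by linarith, by linarith⟩

/-! ### From sequences of data to bounds on the index. -/

/-- Writing each fractional part as the number minus its floor, the linear terms cancel because the
monomial has the weight of the equation. -/
lemma floor_le_of_fract_le {n b : Fin 4 → ℕ} {c ε : Fin 4 → ℤ} {s : ℝ}
    (hn : ∑ i, (n i : ℤ) * c i = ∑ i, ε i * c i)
    (h : ∑ i, (n i : ℝ) * (Int.fract (s * c i) + b i) + 1 +
        Int.fract (s * (∑ i, (1 - ε i) * c i : ℤ)) ≤ ∑ i, (Int.fract (s * c i) + b i)) :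
    ∑ i, ⌊s * (c i : ℝ)⌋ + 1 + ∑ i, (n i : ℤ) * b i ≤
      ⌊s * ((∑ i, (1 - ε i) * c i : ℤ) : ℝ)⌋ + ∑ i, (n i : ℤ) * ⌊s * (c i : ℝ)⌋ + ∑ i, (b i : ℤ) := by
  have hnR : ∑ i, (n i : ℝ) * c i = ∑ i, (ε i : ℝ) * c i := by exact_mod_cast hn
  have ht : ((∑ i, (1 - ε i) * c i : ℤ) : ℝ) = ∑ i, (c i : ℝ) - ∑ i, (ε i : ℝ) * c i := by
    push_cast; rw [← Finset.sum_sub_distrib]; exact Finset.sum_congr rfl fun i _ => by ring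
  have key : ((∑ i, ⌊s * (c i : ℝ)⌋ + 1 + ∑ i, (n i : ℤ) * b i : ℤ) : ℝ) ≤
      ((⌊s * ((∑ i, (1 - ε i) * c i : ℤ) : ℝ)⌋ + ∑ i, (n i : ℤ) * ⌊s * (c i : ℝ)⌋ +
        ∑ i, (b i : ℤ) : ℤ) : ℝ) := by
    generalize hτ : (∑ i, (1 - ε i) * c i : ℤ) = τ at h ht ⊢
    simp only [Int.fract, Fin.sum_univ_four] at h hnR ht ⊢
    rw [ht] at h
    push_cast
    rw [ht]
    linear_combination h - s * hnR
  exact_mod_cast key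

/-- A line in general position orthogonal to all relations of a sequence of admissible data. -/
lemma exists_generic_line {U : Ultrafilter ℕ} {k : ℕ} {r : ℕ → ℕ} {a : ℕ → Fin 4 → ℤ}
    {ε : Fin 4 → ℤ} {S : ℕ → Set (Fin 4 → ℕ)} (hr : Tendsto r U atTop)
    (hadm : ∀ x, Admissible k (r x) (a x) ε (S x)) :
    ∃ (c : Fin 4 → ℤ) (N : ℕ), 0 < N ∧ (∀ w ∈ relations U r a, ∑ i, w i * c i = 0) ∧
      (∀ i, c i = 0 → ∀ᶠ x in U, (r x : ℤ) ∣ N * a x i) ∧ ∑ i, (1 - ε i) * c i ≠ 0 ∧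
      (∀ i j, i ≠ j → c i = 0 → c j ≠ 0) ∧ ∀ i, c i = 0 → ∑ i, ε i * c i = 0 := by
  obtain ⟨c, hc, hgen⟩ := exists_generic_orthogonal (relations U r a)
    (fun o : Option (Fin 4) => o.elim (fun i => 1 - ε i) fun i => Pi.single i 1)
  have hnot : ∀ N : ℕ, 0 < N → ¬ ∀ᶠ x in U, (r x : ℤ) ∣ N := by
    intro N hN h
    obtain ⟨x, hx, hx2⟩ := (h.and (hr.eventually_gt_atTop N)).exists
    have := Int.le_of_dvd (by omega) hx
    omega
  have hNi : ∀ i, ∃ N : ℕ, 0 < N ∧ (c i = 0 → ∀ᶠ x in U, (r x : ℤ) ∣ N * a x i) := by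
    intro i
    by_cases hi : c i = 0
    · obtain ⟨N, hN, hmem⟩ := hgen (some i) (by simp [Pi.single_apply, hi])
      refine ⟨N, hN, fun _ => ?_⟩
      filter_upwards [mem_relations.1 hmem] with x hx
      simpa [Pi.single_apply] using hx
    · exact ⟨1, one_pos, fun h => absurd h hi⟩
  choose M hM hMz using hNi
  have hz : ∀ i, c i = 0 → ∀ᶠ x in U, (r x : ℤ) ∣ ((∏ i, M i : ℕ) : ℤ) * a x i := by
    intro i hi
    filter_upwards [hMz i hi] with x hx
    obtain ⟨q, hq⟩ := Finset.dvd_prod_of_mem M (Finset.mem_univ i)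
    rw [hq]
    push_cast
    rw [mul_right_comm]
    exact Dvd.dvd.mul_right hx _
  have hN : 0 < ∏ i, M i := Finset.prod_pos fun i _ => hM i
  refine ⟨c, ∏ i, M i, hN, hc, hz, fun ht => ?_, fun i j hij hi hj => ?_, fun i hi => ?_⟩
  -- Otherwise a fixed positive multiple of a form congruent to `1` would be divisible by `r → ∞`.
  · obtain ⟨N, hN, hmem⟩ := hgen none ht
    refine hnot N hN ?_
    filter_upwards [mem_relations.1 hmem] with x hx
    obtain ⟨q, hq⟩ := (hadm x).wt
    have hx' : (r x : ℤ) ∣ N * ∑ i, (1 - ε i) * a x i := by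
      rw [Finset.mul_sum]
      simpa [mul_assoc] using hx
    rw [show ∑ i, (1 - ε i) * a x i = 1 + r x * q by linarith] at hx'
    obtain ⟨q', hq'⟩ := hx'
    exact ⟨q' - N * q, by linear_combination hq'⟩
  · refine hnot _ hN ?_
    filter_upwards [hz i hi, hz j hj] with x h1 h2 using (hadm x).pair i j hij _ h1 h2
  · have hmem : (fun i => ((∏ i, M i : ℕ) : ℤ) * ε i) ∈ relations U r a := by
      rw [mem_relations]
      filter_upwards [hz i hi] with x hx
      have := (hadm x).edvd i _ hx
      rw [Finset.mul_sum] at this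
      simpa [mul_assoc] using this
    have h0 := hc _ hmem
    have h1 : ((∏ i, M i : ℕ) : ℤ) * ∑ i, ε i * c i = 0 := by
      rw [← h0, Finset.mul_sum]
      exact Finset.sum_congr rfl fun i _ => by ring
    rcases mul_eq_zero.1 h1 with h | h
    · omega
    · exact h

lemma exists_bound_of_no_sequence {P : ℕ → (Fin 4 → ℤ) → Set (Fin 4 → ℕ) → Prop}
    (h : ∀ (r : ℕ → ℕ) (a : ℕ → Fin 4 → ℤ) (S : ℕ → Set (Fin 4 → ℕ)),
      Tendsto r (hyperfilter ℕ) atTop → (∀ x, P (r x) (a x) (S x)) → False) :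
    ∃ R : ℕ, ∀ r a S, P r a S → r ≤ R := by
  by_contra hcon
  push Not at hcon
  choose r a S hP hlt using hcon
  refine h r a S ?_ hP
  have : Tendsto r atTop atTop := tendsto_atTop_mono (fun x => (hlt x).le) tendsto_id
  exact this.mono_left Nat.hyperfilter_le_atTop

/-- A nonintegral number has a multiple with fractional part at least `1 / 2`. -/
lemma exists_half_le_fract_mul {x : ℝ} (hx : 0 < Int.fract x) :
    ∃ l : ℕ, 1 / 2 ≤ Int.fract (l * x) := by
  set y := Int.fract x with hy
  have hlx : ∀ l : ℕ, Int.fract (l * x) = Int.fract (l * y) := fun l => by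
    have : (l : ℝ) * x = l * y + ((l * ⌊x⌋ : ℤ) : ℝ) := by
      rw [hy, Int.fract]; push_cast; ring
    rw [this, Int.fract_add_intCast]
  have hy1 : y < 1 := Int.fract_lt_one x
  by_cases h : 1 / 2 ≤ y
  · refine ⟨1, ?_⟩
    rw [hlx, Nat.cast_one, one_mul, Int.fract_eq_self.2 ⟨hx.le, hy1⟩]
    exact h
  -- The first multiple of `y` to reach `1/2`; steps shorter than `1/2` cannot carry it past `1`.
  · refine ⟨⌈1 / (2 * y)⌉₊, ?_⟩
    have h1 := Nat.le_ceil (1 / (2 * y))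
    have h2 := Nat.ceil_lt_add_one (show 0 ≤ 1 / (2 * y) by positivity)
    rw [hlx]
    set l : ℝ := (⌈1 / (2 * y)⌉₊ : ℝ)
    have e : 1 / (2 * y) * y = 1 / 2 := by field_simp
    have h3 : 1 / 2 ≤ l * y := by rw [← e]; gcongr
    have h4 : l * y < 1 := by nlinarith
    rw [Int.fract_eq_self.2 ⟨by linarith, h4⟩]
    exact h3

lemma fract_div_eq_of_dvd {r : ℕ} (hr : 0 < r) {u v : ℤ} (h : (r : ℤ) ∣ u - v) :
    Int.fract ((u : ℝ) / r) = Int.fract ((v : ℝ) / r) := by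
  obtain ⟨q, hq⟩ := h
  have hqR : (u : ℝ) - v = r * q := by exact_mod_cast hq
  have : (u : ℝ) / r = v / r + q := by field_simp; linarith
  rw [this, Int.fract_add_intCast]

/-- In the type `x₁x₂ + g(x₃, x₄)`, the weight of `x₃` or `x₄` is not torsion of small order. -/
lemma le_of_dvd_mul_of_cA {k r N : ℕ} {a : Fin 4 → ℤ} {S : Set (Fin 4 → ℕ)}
    (hadm : Admissible k r a ![1, 1, 0, 0] S)
    (hS : ∀ n ∈ S, n = ![1, 1, 0, 0] ∨ n 0 = 0 ∧ n 1 = 0 ∧ 2 ≤ n 2 + n 3) (hN : 0 < N)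
    {i i' : Fin 4} (hi : i = 2 ∧ i' = 3 ∨ i = 3 ∧ i' = 2) (hNa : (r : ℤ) ∣ N * a i)
    (ha : ¬ (r : ℤ) ∣ a i) : r ≤ N * N * (k + 4) := by
  by_contra hcon
  push Not at hcon
  have hr := hadm.r_pos
  have hrR : (0 : ℝ) < r := by exact_mod_cast hr
  have hNR : (0 : ℝ) < N := by exact_mod_cast hN
  have hNN : N * (k + 4) ≤ N * N * (k + 4) :=
    Nat.mul_le_mul_right _ (Nat.le_mul_of_pos_left _ hN)
  have hfr : 0 < Int.fract ((a i : ℝ) / r) := by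
    refine lt_of_le_of_ne (Int.fract_nonneg _) fun h0 => ha ?_
    obtain ⟨-, -, z, hz⟩ := Int.fract_eq_iff.1 h0.symm
    rw [sub_zero, div_eq_iff hrR.ne'] at hz
    exact ⟨z, by rw [mul_comm]; exact_mod_cast hz⟩
  obtain ⟨l, hl⟩ := exists_half_le_fract_mul hfr
  set X := Int.fract ((l : ℝ) * ((a i : ℝ) / r)) with hX
  -- `X` is a multiple of `1/N` less than `1`.
  have hXN : N * X ≤ N - 1 := by
    obtain ⟨q, hq⟩ := hNa
    have hqR : (N : ℝ) * a i = r * q := by exact_mod_cast hq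
    obtain ⟨z, hz⟩ : ∃ z : ℤ, N * X = z := by
      refine ⟨l * q - N * ⌊(l : ℝ) * ((a i : ℝ) / r)⌋, ?_⟩
      rw [hX, Int.fract]; push_cast
      have : (N : ℝ) * (l * (a i / r)) = l * q := by
        field_simp; linear_combination (l : ℝ) * hqR
      linarith
    have : N * X < N := by
      have := Int.fract_lt_one ((l : ℝ) * ((a i : ℝ) / r))
      nlinarith
    rw [hz] at this ⊢
    have h1 : z < N := by exact_mod_cast this
    have h2 : z ≤ N - 1 := by omega
    exact_mod_cast h2
  obtain ⟨J, hJ, hJn⟩ := hadm.ineq 0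
  set l₀ := l % N with hl₀
  have hl₀N : l₀ < N := Nat.mod_lt _ hN
  set Q := (r - 1 - l₀) / N with hQ
  have hQ1 : N * Q ≤ r - 1 - l₀ := Nat.mul_div_le _ _
  have hQ2 : r - 1 - l₀ < N * (Q + 1) := by
    have := Nat.lt_div_mul_add (a := r - 1 - l₀) hN
    rw [mul_add, mul_comm N Q, mul_one]; exact this
  have hQk : k + 1 ≤ Q := by
    rw [hQ, Nat.le_div_iff_mul_le hN]
    have : N * (k + 4) = (k + 1) * N + 3 * N := by ring
    omega
  -- Among `k + 1` candidates congruent to `l` modulo `N` just below `r`, one is not exceptional.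
  -- Thus `{j aᵢ/r} = X ≥ 1/2` while `j/r` is close to `1`.
  obtain ⟨m, hm, hmJ⟩ : ∃ m ∈ Finset.Icc (Q - k) Q, l₀ + N * m ∉ J := by
    by_contra hall
    push Not at hall
    have := Finset.card_le_card_of_injOn (fun m => l₀ + N * m) hall (by
      intro m _ m' _ h
      simp only [Nat.add_left_cancel_iff] at h
      exact Nat.eq_of_mul_eq_mul_left hN h)
    rw [Nat.card_Icc] at this
    omega
  rw [Finset.mem_Icc] at hm
  set j := l₀ + N * m with hj
  have hmQ : N * m ≤ N * Q := Nat.mul_le_mul_left _ hm.2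
  have hm1 : 0 < N * m := Nat.mul_pos hN (by omega)
  have hjr : j < r := by omega
  have hjlow : r ≤ j + N * (k + 1) := by
    have h1 : N * (Q + 1) ≤ N * (m + (k + 1)) := Nat.mul_le_mul_left _ (by omega)
    rw [mul_add N m] at h1
    omega
  obtain ⟨n, hnS, hn⟩ := hJn j (by omega) hjr hmJ
  simp only [Pi.zero_apply, Nat.cast_zero, add_zero] at hn
  have hαi : Int.fract ((j * a i : ℝ) / r) = X := by
    have h1 : ((j : ℤ) - l) = N * (m - (l / N : ℕ)) := by
      have := Nat.div_add_mod l N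
      zify at this
      rw [hj, hl₀]; push_cast
      linear_combination this
    have h2 : (r : ℤ) ∣ j * a i - l * a i := by
      obtain ⟨q, hq⟩ := hNa
      exact ⟨q * (m - (l / N : ℕ)), by linear_combination a i * h1 + (m - (l / N : ℕ)) * hq⟩
    have := fract_div_eq_of_dvd hr h2
    push_cast at this
    rw [this, hX, mul_div_assoc]
  have hii : a i + a i' = a 2 + a 3 := by rcases hi with ⟨rfl, rfl⟩ | ⟨rfl, rfl⟩ <;> ring
  have hwt : (r : ℤ) ∣ a i + a i' - 1 := by
    have := hadm.wt
    rw [hii]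
    simpa [Fin.sum_univ_four] using this
  -- From `X ≤ 1 - 1/N` and `j ≥ r - N(k + 1)`; the size of `r` leaves the required margin.
  have hgap : (N : ℝ) / r ≤ j / r - X := by
    have h1 : (r : ℝ) ≤ j + N * (k + 1) := by exact_mod_cast hjlow
    have h2 : (N : ℝ) * N * (k + 4) < r := by exact_mod_cast hcon
    rw [le_sub_iff_add_le, ← le_sub_iff_add_le', ← sub_div, le_div_iff₀ hrR]
    have h3 : N * X * r ≤ (N - 1) * r := by gcongr
    have h4 : (N : ℝ) * (X * r) ≤ N * (j - N) := by nlinarith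
    exact le_of_mul_le_mul_left h4 hNR
  have hαi' : Int.fract ((j * a i' : ℝ) / r) = j / r - X := by
    have hjr1 : (j : ℝ) / r < 1 := by rw [div_lt_one hrR]; exact_mod_cast hjr
    rw [Int.fract_eq_iff]
    obtain ⟨q, hq⟩ := hwt
    have hqR : (a i : ℝ) + a i' - 1 = r * q := by exact_mod_cast hq
    have hfl := Int.self_sub_fract ((j * a i : ℝ) / r)
    rw [hαi] at hfl
    refine ⟨le_trans (by positivity) hgap, by linarith, j * q - ⌊(j * a i : ℝ) / r⌋, ?_⟩
    push_cast
    rw [← hfl]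
    field_simp
    linear_combination (j : ℝ) * hqR
  have hpair : ∀ g : Fin 4 → ℝ, ∑ i, g i = g 0 + g 1 + g i' + g i := by
    intro g
    rw [Fin.sum_univ_four]
    rcases hi with ⟨rfl, rfl⟩ | ⟨rfl, rfl⟩ <;> ring
  rw [hpair, hpair, hαi, hαi'] at hn
  have b0 := Int.fract_lt_one ((j * a 0 : ℝ) / r)
  have b1 := Int.fract_lt_one ((j * a 1 : ℝ) / r)
  rcases hS n hnS with rfl | ⟨n0, n1, hn2⟩
  · have e1 : (![1, 1, 0, 0] : Fin 4 → ℕ) i = 0 := by rcases hi with ⟨rfl, rfl⟩ | ⟨rfl, rfl⟩ <;> rfl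
    have e2 : (![1, 1, 0, 0] : Fin 4 → ℕ) i' = 0 := by
      rcases hi with ⟨rfl, rfl⟩ | ⟨rfl, rfl⟩ <;> rfl
    rw [e1, e2] at hn
    simp at hn
    linarith
  · have hn2' : 2 ≤ n i' + n i := by rcases hi with ⟨rfl, rfl⟩ | ⟨rfl, rfl⟩ <;> omega
    rw [n0, n1] at hn
    simp only [Nat.cast_zero, zero_mul, zero_add] at hn
    have hpos : 0 ≤ (j : ℝ) / r - X := le_trans (by positivity) hgap
    have hp0 : 0 ≤ (n i' : ℝ) * (j / r - X) := by positivity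
    -- The inequality leaves weight less than `1` for the monomial, and two factors of weight `X ≥
    -- 1/2` would use it up.
    have hq1 : n i ≤ 1 := by
      by_contra hq
      have : (2 : ℝ) ≤ n i := by exact_mod_cast (by omega : 2 ≤ n i)
      nlinarith
    have hp1 : 0 < n i' := by omega
    -- After multiplication by `N`, both `aᵢ` and the weight of the equation vanish modulo `r` and
    -- the other variable has weight `N`. Its exponent is therefore at least `r/N`, and its
    -- contribution to the weight at least `1`.
    have hdvd : (r : ℤ) ∣ N * n i' := by
      obtain ⟨u, hu⟩ := hadm.semi n hnS
      obtain ⟨v, hv⟩ := hadm.edvd i N hNa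
      obtain ⟨w, hw⟩ := hwt
      obtain ⟨y, hy⟩ := hNa
      have hu' : (n i' : ℤ) * a i' + n i * a i - a 0 - a 1 = r * u := by
        rw [← hu]
        rcases hi with ⟨rfl, rfl⟩ | ⟨rfl, rfl⟩ <;>
        · simp [Fin.sum_univ_four, n0, n1]; ring
      have hv' : (N : ℤ) * (a 0 + a 1) = r * v := by
        rw [← hv]; simp [Fin.sum_univ_four]
      exact ⟨N * u + v - n i * y - N * n i' * w + n i' * y, by
        linear_combination (N : ℤ) * hu' + hv' - (n i : ℤ) * hy - N * n i' * hw + n i' * hy⟩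
    have hle := Int.le_of_dvd (by positivity) hdvd
    have hleR : (r : ℝ) ≤ N * n i' := by exact_mod_cast hle
    have : 1 ≤ (n i' : ℝ) * (j / r - X) := by
      calc (1 : ℝ) ≤ n i' * (N / r) := by
            rw [mul_div_assoc', le_div_iff₀ hrR]; linarith
        _ ≤ _ := by gcongr
    have : 0 ≤ (n i : ℝ) * X := mul_nonneg (by positivity) (by linarith)
    linarith

/-- Once `c₃, c₄ ≠ 0`, the vanishing of `c₁` or `c₂` would give the equation weight `0` and make
both vanish, against pairwise coprimality. -/
theorem exists_bound_cA (k : ℕ) : ∃ R : ℕ, ∀ r a S, (Admissible k r a ![1, 1, 0, 0] S ∧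
    (∀ n ∈ S, n = ![1, 1, 0, 0] ∨ n 0 = 0 ∧ n 1 = 0 ∧ 2 ≤ n 2 + n 3) ∧
    ¬ (r : ℤ) ∣ a 2 ∧ ¬ (r : ℤ) ∣ a 3) → r ≤ R := by
  refine exists_bound_of_no_sequence fun r a S hr h => ?_
  obtain ⟨c, N, hN, hc, hz, ht, hpair, he⟩ := exists_generic_line hr fun x => (h x).1
  have hbig : ∀ i i' : Fin 4, (i = 2 ∧ i' = 3 ∨ i = 3 ∧ i' = 2) → c i ≠ 0 := by
    intro i i' hi h0
    obtain ⟨x, hx, hx2⟩ := ((hz i h0).and (hr.eventually_gt_atTop (N * N * (k + 4)))).exists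
    have := le_of_dvd_mul_of_cA (h x).1 (h x).2.1 hN hi hx
      (by rcases hi with ⟨rfl, -⟩ | ⟨rfl, -⟩; exacts [(h x).2.2.1, (h x).2.2.2])
    omega
  have h2 := hbig 2 3 (by simp)
  have h3 := hbig 3 2 (by simp)
  simp only [Fin.sum_univ_four, Matrix.cons_val, one_mul, zero_mul, add_zero, sub_self, sub_zero,
    zero_add] at he ht
  have h0 : c 0 ≠ 0 := fun h0 => hpair 0 1 (by decide) h0 (by have := he 0 h0; omega)
  have h1 : c 1 ≠ 0 := fun h1 => hpair 1 0 (by decide) h1 (by have := he 1 h1; omega)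
  have hall : ∀ i, c i ≠ 0 := by intro i; fin_cases i <;> assumption
  refine not_CALine h0 h1 h2 h3 ht fun s hs => ?_
  obtain ⟨n, hn, hnc, hle⟩ := exists_limit_exponent hr (fun x => (h x).1) hc hN hz
    (by simpa [Fin.sum_univ_four] using ht) hs 0
  obtain ⟨x, n', hn', hnn⟩ := hn.exists
  have hnn' : n' = n := funext fun i => hnn i (Or.inl (hall i))
  have hfl := floor_le_of_fract_le hnc hle
  simp only [Fin.sum_univ_four, Matrix.cons_val, Pi.zero_apply, Nat.cast_zero, mul_zero, add_zero,
    one_mul, zero_mul, sub_self, sub_zero, zero_add] at hfl hnc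
  rcases (h x).2.1 n' hn' with h' | ⟨n0, n1, hn2⟩
  · left
    rw [hnn'] at h'
    rw [h'] at hfl
    simp only [Matrix.cons_val, Nat.cast_one, Nat.cast_zero, one_mul, zero_mul, add_zero] at hfl
    linarith
  · right
    rw [hnn'] at n0 n1 hn2
    rw [n0, n1] at hfl hnc
    simp only [Nat.cast_zero, zero_mul, zero_add] at hfl hnc
    exact ⟨n 2, n 3, hn2, hnc, by linarith⟩

theorem exists_bound_odd (k : ℕ) : ∃ R : ℕ, ∀ r a S, (Admissible k r a ![2, 0, 0, 0] S ∧
    (∀ n ∈ S, n = ![2, 0, 0, 0] ∨ n = ![0, 2, 0, 0] ∨ n 0 = 0 ∧ n 1 = 0 ∧ 3 ≤ n 2 + n 3) ∧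
    ![0, 2, 0, 0] ∈ S) → r ≤ R := by
  refine exists_bound_of_no_sequence fun r a S hr h => ?_
  obtain ⟨c, N, hN, hc, hz, ht, hpair, he⟩ := exists_generic_line hr fun x => (h x).1
  -- Both squares occur, so `2 a₁ ≡ 2 a₂` is a relation and the line sees equal weights.
  have h01 : c 1 = c 0 := by
    have := hc ![-2, 2, 0, 0] (mem_relations.2 (Eventually.of_forall fun x => by
      have := (h x).1.semi _ (h x).2.2
      simpa [Fin.sum_univ_four] using this))
    simp [Fin.sum_univ_four] at this
    omega
  simp only [Fin.sum_univ_four, Matrix.cons_val, one_mul, zero_mul, add_zero, sub_zero] at he ht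
  have h0 : c 0 ≠ 0 := fun h0 => hpair 0 1 (by decide) h0 (by omega)
  have h1 : c 1 ≠ 0 := by omega
  have h2 : c 2 ≠ 0 := fun h2 => h0 (by have := he 2 h2; omega)
  have h3 : c 3 ≠ 0 := fun h3 => h0 (by have := he 3 h3; omega)
  have hall : ∀ i, c i ≠ 0 := by intro i; fin_cases i <;> assumption
  refine not_OddLine h0 h2 h3 (by omega) fun s hs => ?_
  obtain ⟨n, hn, hnc, hle⟩ := exists_limit_exponent hr (fun x => (h x).1) hc hN hz
    (by simpa [Fin.sum_univ_four] using ht) hs 0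
  obtain ⟨x, n', hn', hnn⟩ := hn.exists
  have hnn' : n' = n := funext fun i => hnn i (Or.inl (hall i))
  have hfl := floor_le_of_fract_le hnc hle
  simp only [Fin.sum_univ_four, Matrix.cons_val, Pi.zero_apply, Nat.cast_zero, mul_zero, add_zero,
    one_mul, zero_mul, sub_zero] at hfl hnc
  rw [show (1 - 2) * c 0 + c 1 + c 2 + c 3 = c 2 + c 3 by rw [h01]; ring, h01] at hfl
  rcases (h x).2.1 n' hn' with h' | h' | ⟨n0, n1, hn2⟩
  · left
    rw [hnn'] at h'
    rw [h'] at hfl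
    simp only [Matrix.cons_val, Nat.cast_zero, zero_mul, add_zero] at hfl
    push_cast at hfl ⊢
    linarith
  · left
    rw [hnn'] at h'
    rw [h'] at hfl
    simp only [Matrix.cons_val, Nat.cast_zero, zero_mul, add_zero] at hfl
    push_cast at hfl ⊢
    linarith
  · right
    rw [hnn'] at n0 n1 hn2
    rw [n0, n1] at hfl hnc
    simp only [Nat.cast_zero, zero_mul, zero_add] at hfl hnc
    exact ⟨n 2, n 3, hn2, hnc, by linarith⟩

/-- Only the first coordinate of `c` can vanish: any other zero gives the equation weight `2 c₁ =
0`, hence a second zero. -/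
theorem exists_bound_cDE (k : ℕ) : ∃ R : ℕ, ∀ r a S, (Admissible k r a ![2, 0, 0, 0] S ∧
    ∀ n ∈ S, n = ![2, 0, 0, 0] ∨ n 0 = 0 ∧ 3 ≤ n 1 + n 2 + n 3) → r ≤ R := by
  refine exists_bound_of_no_sequence fun r a S hr h => ?_
  obtain ⟨c, N, hN, hc, hz, ht, hpair, he⟩ := exists_generic_line hr fun x => (h x).1
  have hlim := fun (s : ℝ) (hs : Irrational s) (b : Fin 4 → ℕ) =>
    exists_limit_exponent hr (fun x => (h x).1) hc hN hz ht hs b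
  simp only [Fin.sum_univ_four, Matrix.cons_val, zero_mul, add_zero] at he
  have hne : ∀ i, i ≠ 0 → c i ≠ 0 := fun i hi h0 => hpair i 0 hi h0 (by have := he i h0; omega)
  have h1 := hne 1 (by decide)
  have h2 := hne 2 (by decide)
  have h3 := hne 3 (by decide)
  have hτ : ∑ i, (1 - (![2, 0, 0, 0] : Fin 4 → ℤ) i) * c i = c 1 + c 2 + c 3 - c 0 := by
    simp [Fin.sum_univ_four]; ring
  rw [hτ] at ht
  by_cases h0 : c 0 = 0
  · rw [h0, sub_zero] at ht hτ
    refine not_CDEUnitLine h1 h2 h3 ht (fun s hs => ?_) fun s hs => ?_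
    -- Dropping the non-negative weight of the monomial yields the inequality behind the pairing.
    · obtain ⟨n, -, hnc, hle⟩ := hlim s hs 0
      have hle' : ∑ i, ((0 : Fin 4 → ℕ) i : ℝ) * (Int.fract (s * c i) + (0 : Fin 4 → ℕ) i) + 1 +
          Int.fract (s * (∑ i, (1 - (![2, 0, 0, 0] : Fin 4 → ℤ) i) * c i : ℤ)) ≤
            ∑ i, (Int.fract (s * c i) + ((0 : Fin 4 → ℕ) i : ℝ)) := by
        refine le_trans ?_ hle
        gcongr
        simp
      have hfl := floor_le_of_fract_le (by simp [Fin.sum_univ_four, h0]) hle'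
      rw [hτ] at hfl
      simp only [Fin.sum_univ_four, Pi.zero_apply, Nat.cast_zero, zero_mul, add_zero, h0,
        Int.cast_zero, mul_zero, Int.floor_zero, zero_add] at hfl
      exact hfl
    -- Translating by the first basis vector gives `x₁` weight `1`, so its exponent becomes visible
    -- in the limit and `x₁²` costs `2`.
    · obtain ⟨n, hn, hnc, hle⟩ := hlim s hs ![1, 0, 0, 0]
      obtain ⟨x, n', hn', hnn⟩ := hn.exists
      have hnn' : n' = n := funext fun i => hnn i (by
        by_cases hi : i = 0
        · right; subst hi; simp
        · exact Or.inl (hne i hi))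
      have hfl := floor_le_of_fract_le hnc hle
      rw [hτ] at hfl
      simp only [Fin.sum_univ_four, Matrix.cons_val, Nat.cast_zero, Nat.cast_one, mul_one, zero_mul,
        add_zero, h0, Int.cast_zero, mul_zero, Int.floor_zero, zero_add] at hfl hnc
      rcases (h x).2 n' hn' with h' | ⟨n0, hn2⟩
      · left
        rw [hnn'] at h'
        rw [h'] at hfl
        simp only [Matrix.cons_val, Nat.cast_zero, zero_mul, add_zero] at hfl
        push_cast at hfl ⊢
        linarith
      · right
        rw [hnn'] at n0 hn2
        rw [n0] at hfl
        simp only [Nat.cast_zero, add_zero] at hfl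
        exact ⟨n 1, n 2, n 3, hn2, hnc, by linarith⟩
  · refine not_CDELine h0 h1 h2 h3 ht fun s hs => ?_
    obtain ⟨n, hn, hnc, hle⟩ := hlim s hs 0
    obtain ⟨x, n', hn', hnn⟩ := hn.exists
    have hnn' : n' = n := funext fun i => hnn i (Or.inl (by
      by_cases hi : i = 0
      · subst hi; exact h0
      · exact hne i hi))
    have hfl := floor_le_of_fract_le hnc hle
    rw [hτ] at hfl
    simp only [Fin.sum_univ_four, Matrix.cons_val, Pi.zero_apply, Nat.cast_zero, mul_zero, add_zero,
      zero_mul] at hfl hnc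
    rcases (h x).2 n' hn' with h' | ⟨n0, hn2⟩
    · left
      rw [hnn'] at h'
      rw [h'] at hfl
      simp only [Matrix.cons_val, Nat.cast_zero, zero_mul, add_zero] at hfl
      push_cast at hfl ⊢
      linarith
    · right
      rw [hnn'] at n0 hn2
      rw [n0] at hfl hnc
      simp only [Nat.cast_zero, zero_mul, zero_add] at hfl hnc
      exact ⟨n 1, n 2, n 3, hn2, hnc, by linarith⟩

/-! ### Monomials of the three types and conclusion. -/

open MvPowerSeries in
lemma IsCAType.exponents {f : ConvergentSeries} (hf : IsCAType f) :
    ![1, 1, 0, 0] ∈ exponents f ∧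
      ∀ n ∈ exponents f, n = ![1, 1, 0, 0] ∨ n 0 = 0 ∧ n 1 = 0 ∧ 2 ≤ n 2 + n 3 := by
  classical
  obtain ⟨g, hg, hg', hfg⟩ := hf
  have hXX : ∀ n : Fin 4 → ℕ, coeff (Finsupp.equivFunOnFinite.symm n)
      (X 0 * X 1 : MvPowerSeries (Fin 4) ℂ) = if n = ![1, 1, 0, 0] then 1 else 0 := by
    intro n
    rw [X_def, X_def, monomial_mul_monomial, coeff_monomial, mul_one]
    congr 1
    rw [Equiv.symm_apply_eq]
    refine propext ⟨fun h => h.trans ?_, fun h => h.trans ?_⟩ <;>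
    · funext i; fin_cases i <;> simp
  constructor
  · have h0 : coeff (Finsupp.equivFunOnFinite.symm ![1, 1, 0, 0])
        (g : MvPowerSeries (Fin 4) ℂ) = 0 := by
      by_contra hne
      have := hg' _ hne 0 (by simp)
      simp at this
    simp only [EncCDV.exponents, Set.mem_ofPred_eq, hfg, map_add, h0, hXX]
    simp
  · intro n hn
    simp only [EncCDV.exponents, Set.mem_ofPred_eq, hfg, map_add, hXX] at hn
    by_cases h : n = ![1, 1, 0, 0]
    · exact Or.inl h
    · right
      rw [if_neg h, zero_add] at hn
      have h0 := hg' _ hn 0 (by simp)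
      have h1 := hg' _ hn 1 (by simp)
      simp only [Finsupp.equivFunOnFinite_symm_apply_apply] at h0 h1
      refine ⟨h0, h1, ?_⟩
      by_contra hlt
      refine hn (coeff_eq_zero_of_mem_maxIdeal_pow hg ?_)
      rw [Finsupp.degree_eq_sum]
      simp [Fin.sum_univ_four, h0, h1]
      omega

open MvPowerSeries in
lemma coeff_X_sq (n : Fin 4 → ℕ) (i : Fin 4) [Decidable (n = Pi.single i 2)] :
    coeff (Finsupp.equivFunOnFinite.symm n) (X i ^ 2 : MvPowerSeries (Fin 4) ℂ) =
      if n = Pi.single i 2 then 1 else 0 := by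
  classical
  rw [coeff_X_pow]
  congr 1
  rw [Equiv.symm_apply_eq, Finsupp.equivFunOnFinite_single]

open MvPowerSeries in
lemma IsOddType.exponents {r : ℕ} {a : Fin 4 → ℕ} {f : ConvergentSeries} (hf : IsOddType r a f) :
    ![2, 0, 0, 0] ∈ exponents f ∧ ![0, 2, 0, 0] ∈ exponents f ∧
      ∀ n ∈ exponents f, n = ![2, 0, 0, 0] ∨ n = ![0, 2, 0, 0] ∨
        n 0 = 0 ∧ n 1 = 0 ∧ 3 ≤ n 2 + n 3 := by
  classical
  obtain ⟨⟨g, hg, hg', hfg⟩, -⟩ := hf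
  have e0 : (Pi.single 0 2 : Fin 4 → ℕ) = ![2, 0, 0, 0] := by
    funext i; fin_cases i <;> simp
  have e1 : (Pi.single 1 2 : Fin 4 → ℕ) = ![0, 2, 0, 0] := by
    funext i; fin_cases i <;> simp
  refine ⟨?_, ?_, ?_⟩
  · have h0 : coeff (Finsupp.equivFunOnFinite.symm ![2, 0, 0, 0])
        (g : MvPowerSeries (Fin 4) ℂ) = 0 := by
      by_contra hne
      have := hg' _ hne 0 (by simp)
      simp at this
    simp only [EncCDV.exponents, Set.mem_ofPred_eq, hfg, map_add, h0, coeff_X_sq, e0, e1]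
    simp
  · have h0 : coeff (Finsupp.equivFunOnFinite.symm ![0, 2, 0, 0])
        (g : MvPowerSeries (Fin 4) ℂ) = 0 := by
      by_contra hne
      have := hg' _ hne 1 (by simp)
      simp at this
    simp only [EncCDV.exponents, Set.mem_ofPred_eq, hfg, map_add, h0, coeff_X_sq, e0, e1]
    simp
  · intro n hn
    simp only [EncCDV.exponents, Set.mem_ofPred_eq, hfg, map_add, coeff_X_sq, e0, e1] at hn
    by_cases h : n = ![2, 0, 0, 0]
    · exact Or.inl h
    by_cases h' : n = ![0, 2, 0, 0]
    · exact Or.inr (Or.inl h')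
    right; right
    rw [if_neg h, if_neg h', zero_add, zero_add] at hn
    have h0 := hg' _ hn 0 (by simp)
    have h1 := hg' _ hn 1 (by simp)
    simp only [Finsupp.equivFunOnFinite_symm_apply_apply] at h0 h1
    refine ⟨h0, h1, ?_⟩
    by_contra hlt
    refine hn (coeff_eq_zero_of_mem_maxIdeal_pow hg ?_)
    rw [Finsupp.degree_eq_sum]
    simp [Fin.sum_univ_four, h0, h1]
    omega

open MvPowerSeries in
lemma IsCDEType.exponents {f : ConvergentSeries} (hf : IsCDEType f) :
    ![2, 0, 0, 0] ∈ exponents f ∧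
      ∀ n ∈ exponents f, n = ![2, 0, 0, 0] ∨ n 0 = 0 ∧ 3 ≤ n 1 + n 2 + n 3 := by
  classical
  obtain ⟨g, hg, hg', hfg⟩ := hf
  have e0 : (Pi.single 0 2 : Fin 4 → ℕ) = ![2, 0, 0, 0] := by
    funext i; fin_cases i <;> simp
  constructor
  · have h0 : coeff (Finsupp.equivFunOnFinite.symm ![2, 0, 0, 0])
        (g : MvPowerSeries (Fin 4) ℂ) = 0 := by
      by_contra hne
      have := hg' _ hne 0 (by simp)
      simp at this
    simp only [EncCDV.exponents, Set.mem_ofPred_eq, hfg, map_add, h0, coeff_X_sq, e0]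
    simp
  · intro n hn
    simp only [EncCDV.exponents, Set.mem_ofPred_eq, hfg, map_add, coeff_X_sq, e0] at hn
    by_cases h : n = ![2, 0, 0, 0]
    · exact Or.inl h
    right
    rw [if_neg h, zero_add] at hn
    have h0 := hg' _ hn 0 (by simp)
    simp only [Finsupp.equivFunOnFinite_symm_apply_apply] at h0
    refine ⟨h0, ?_⟩
    by_contra hlt
    refine hn (coeff_eq_zero_of_mem_maxIdeal_pow hg ?_)
    rw [Finsupp.degree_eq_sum]
    simp [Fin.sum_univ_four, h0]
    omega

/-- In the cA case the excluded weights are the only ones with `x₃` or `x₄` invariant. -/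
lemma EncSetting.not_dvd {k r : ℕ} {a : Fin 4 → ℕ} {e : ℕ} {ξ : ℂ} {f : ConvergentSeries}
    {β : Fin 4 → ℚ} (h : EncSetting k r a e ξ f β) (hf : IsCAType f) :
    ¬ (r : ℤ) ∣ a 2 ∧ ¬ (r : ℤ) ∣ a 3 := by
  have hadm := h.admissible hf.exponents.1
  obtain ⟨u, hu⟩ := exponents_weight h.primitiveRoot h.r_pos h.semiInvariant hf.exponents.1
  obtain ⟨w, hw⟩ := hadm.wt
  simp [Fin.sum_univ_four] at hu hw
  -- If `aᵢ ≡ 0`, then `r ∣ gcd(aᵢ, r)`, so the divisibility condition gives `e ≡ 0`, and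
  -- coprimality makes `a₁` a unit modulo `r`.
  have key : ∀ i : Fin 4, i ≠ 0 → (r : ℤ) ∣ a i →
      Int.gcd (a 0) r = 1 ∧ (a 1 : ℤ) ≡ -(a 0) [ZMOD r] ∧ (e : ℤ) ≡ 0 [ZMOD r] := by
    intro i hi hd
    obtain ⟨v, hv⟩ := hadm.edvd i 1 (by simpa using hd)
    simp [Fin.sum_univ_four] at hv
    refine ⟨?_, ?_, ?_⟩
    · have hg := h.gcd_pair 0 i (Fin.pos_of_ne_zero hi)
      rw [Int.gcd_natCast_natCast]
      have h1 : Nat.gcd (a 0) r ∣ 1 := by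
        rw [← hg]
        refine Nat.dvd_gcd (Nat.dvd_gcd (Nat.gcd_dvd_left _ _) ?_) (Nat.gcd_dvd_right _ _)
        exact (Nat.gcd_dvd_right _ _).trans (by exact_mod_cast hd)
      exact Nat.dvd_one.1 h1
    · exact (Int.modEq_iff_dvd.2 ⟨v, by linear_combination hv⟩ : -(a 0 : ℤ) ≡ a 1 [ZMOD r]).symm
    · exact (Int.modEq_iff_dvd.2 ⟨v - u, by linear_combination hv - hu⟩ :
        (0 : ℤ) ≡ e [ZMOD r]).symm
  constructor
  · intro hd
    obtain ⟨h1, h2, h3⟩ := key 2 (by decide) hd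
    obtain ⟨y, hy⟩ := hd
    refine h.exclude hf (a 0) h1 ⟨Int.ModEq.refl _, h2, h3, Or.inr ⟨?_, ?_⟩⟩
    · exact Int.modEq_zero_iff_dvd.2 ⟨y, hy⟩
    · exact (Int.modEq_iff_dvd.2 ⟨w - y, by linear_combination hw - hy⟩ :
        (1 : ℤ) ≡ a 3 [ZMOD r]).symm
  · intro hd
    obtain ⟨h1, h2, h3⟩ := key 3 (by decide) hd
    obtain ⟨y, hy⟩ := hd
    refine h.exclude hf (a 0) h1 ⟨Int.ModEq.refl _, h2, h3, Or.inl ⟨?_, ?_⟩⟩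
    · exact (Int.modEq_iff_dvd.2 ⟨w - y, by linear_combination hw - hy⟩ :
        (1 : ℤ) ≡ a 2 [ZMOD r]).symm
    · exact Int.modEq_zero_iff_dvd.2 ⟨y, hy⟩

/-- The index `r` is bounded in terms of `k` alone. -/
theorem exists_bound (k : ℕ) : ∃ R : ℕ, ∀ (r : ℕ) (a : Fin 4 → ℕ) (e : ℕ) (ξ : ℂ)
    (f : ConvergentSeries) (β : Fin 4 → ℚ), EncSetting k r a e ξ f β → r ≤ R := by
  obtain ⟨R₁, h₁⟩ := exists_bound_cA k
  obtain ⟨R₂, h₂⟩ := exists_bound_odd k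
  obtain ⟨R₃, h₃⟩ := exists_bound_cDE k
  have e1 : (fun i => ((![1, 1, 0, 0] : Fin 4 → ℕ) i : ℤ)) = ![1, 1, 0, 0] := by
    funext i; fin_cases i <;> rfl
  have e2 : (fun i => ((![2, 0, 0, 0] : Fin 4 → ℕ) i : ℤ)) = ![2, 0, 0, 0] := by
    funext i; fin_cases i <;> rfl
  refine ⟨max R₁ (max R₂ R₃), fun r a e ξ f β h => ?_⟩
  rcases h.type with hf | hf | hf
  · have hadm := h.admissible hf.exponents.1
    rw [e1] at hadm
    exact (h₁ r _ _ ⟨hadm, hf.exponents.2, h.not_dvd hf⟩).trans (le_max_left _ _)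
  · have hadm := h.admissible hf.exponents.1
    rw [e2] at hadm
    exact (h₂ r _ _ ⟨hadm, hf.exponents.2.2, hf.exponents.2.1⟩).trans (by simp)
  · have hadm := h.admissible hf.exponents.1
    rw [e2] at hadm
    exact (h₃ r _ _ ⟨hadm, hf.exponents.2⟩).trans (by simp)

end EncCDV

theorem theorem1p2 (k : ℕ) (hk : 1 ≤ k) :
    ∃ (Γr : Finset ℕ) (Γβ : Finset (Fin 4 → ℚ)),
      ∀ (r : ℕ) (a : Fin 4 → ℕ) (e : ℕ) (ξ : ℂ) (f : EncCDV.ConvergentSeries) (β : Fin 4 → ℚ),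
        EncCDV.EncSetting k r a e ξ f β → r ∈ Γr ∨ (β ≠ 0 ∧ β ∈ Γβ) := by
  obtain ⟨R, hR⟩ := EncCDV.exists_bound k
  exact ⟨Finset.range (R + 1), ∅, fun r a e ξ f β h =>
    Or.inl (Finset.mem_range.2 (Nat.lt_succ_of_le (hR r a e ξ f β h)))⟩
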